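/- Let $n\ge 1$. A polygon is a sequence $(v_i)_{i\in\mathbb Z}$ in $\mathbb C$ with $v_i\ne v_{i+1}$; put $z_i=v_i-v_{i-1}$ (edge vectors), $y_i=z_{i+1}/z_i$, $\phi_i=\arg y_i\in\mathbb R/2\pi\mathbb Z$ (exterior angles). Let $S$ and $E$ be the groups of maps $z\mapsto az+b$ of $\mathbb C$ with $a\in\mathbb C^*$, respectively $|a|=1$. Let $\mathcal P_n^S$ and $\mathcal P_n^E$ be the sets of polygons with $v_{i+n}=\psi(v_i)$ for all $i$, for some $\psi\in S$, respectively $\psi\in E$. Let $\tilde{\mathcal P}_n^E$ be the set of pairs $((v_i),\alpha)$ with $\alpha\in\mathbb C$, $|\alpha|=1$, and $v_{i+n}=\alpha^2v_i+\beta$ for all $i$, for some $\beta\in\mathbb C$. The quotients $\mathcal P_n^S/S$, $\mathcal P_n^E/E$, $\tilde{\mathcal P}_n^E/E$ have the smooth structures given by the coordinates $(y_1,\dots,y_n)$, by $(|z_1|,\dots,|z_n|,\phi_1,\dots,\phi_n)$, and by $(z_1,\dots,z_n,\alpha)$ modulo simultaneous rotation of the $z_i$, respectively. Recutting at $v_j$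 reflects every $v_i$ with $i\equiv j \bmod n$ in the perpendicular bisector of $v_{i-1}$ and $v_{i+1}$ (and keeps $\alpha$); it is defined where $v_{j-1}\ne v_{j+1}$. For $((v_i),\alpha)\in\tilde{\mathcal P}_n^E$ put $$E_k=\sum_{1\le i_1<\dots<i_k\le n}|z_{i_1}|^2\cdots|z_{i_k}|^2,\qquad I_k=\mathrm{Re}\Big(\alpha\sum_{1\le i_1<\dots<i_{2k}\le n}z_{i_1}\bar z_{i_2}\cdots z_{i_{2k-1}}\bar z_{i_{2k}}\Big).$$ Let $X$ be the set of $n$-tuples $g_i=a_i+b_i\mathbf j t$ of linear special quaternionic polynomials (even coefficients complex, odd ones in $\mathrm{span}_{\mathbb R}\langle\mathbf j,\mathbf k\rangle$), with $a_i,b_i\in\mathbb C^*$ and $|a_1\cdots a_n|=1$. It carries the restriction of the product of the brackets $$\{a,b\}=-\tfrac12ab,\quad \{a,\bar b\}=\tfrac12a\bar b,\quad \{\bar a,\bar b\}=-\tfrac12\bar a\bar b,\quad \{\bar a,b\}=\tfrac12\bar ab,\quad \{a,\bar a\}=\{b,\bar b\}=0 .$$ The group $(\mathbb C^*)^n$ acts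 by $g_i\mapsto\lambda_ig_i\lambda_{i+1}^{-1}$ (indices modulo $n$), and $X/(\mathbb C^*)^n$ is identified with $\tilde{\mathcal P}_n^E/E$ by sending the class of $(1+z_1\mathbf jt,\dots,1+z_{n-1}\mathbf jt,(1+z_n\mathbf jt)\alpha)$ to the class of the polygon with edge vectors $z_1,\dots,z_n$ and square root $\alpha$. Then there is a unique Poisson bracket on $\tilde{\mathcal P}_n^E/E$ for which the resulting map $X\to\tilde{\mathcal P}_n^E/E$ is Poisson, and the following hold. Here $\delta_{i,j}=1$ if $i\equiv j\bmod n$, and $\delta_{i,j}=0$ otherwise. 1. The bracket on $\tilde{\mathcal P}_n^E/E$ is invariant under recutting (on the open set where the recutting is defined). 2. The functions $E_1,\dots,E_n,I_0,\dots,I_{\lfloor n/2\rfloor}$ Poisson commute. 3. $E_1,\dots,E_n,I_0$ are Casimirs. 4. The bracket descends to a (unique) Poisson bracket on $\mathcal P_n^E/E$. 5. In the coordinates $|z_i|,\phi_i$ on $\mathcal P_n^E/E$, the $|z_i|$ are Casimirs and $\{\phi_i,\phi_j\}=\delta_{i-1,j}-\delta_{i+1,j}$. The function $\phi_1+\dots+\phi_n$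 is a Casimir and, for even $n$, so is $\phi_1+\phi_3+\dots+\phi_{n-1}$. The joint level sets of the $|z_i|$ and these Casimirs are the symplectic leaves. 6. The natural map $\mathcal P_n^E/E\to\mathcal P_n^S/S$ is Poisson, where $\mathcal P_n^S/S$ carries the cluster bracket $$\{y_i,y_j\}=(\delta_{i+1,j}-\delta_{i-1,j})y_iy_j,\qquad \{y_i,\bar y_j\}=(\delta_{i-1,j}-\delta_{i+1,j})y_i\bar y_j,$$ together with the complex conjugate relations. -/

import Mathlib

open scoped ContDiff Quaternion

noncomputable section

namespace Recutting

/-! ## Smooth functions and Poisson brackets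

A space `M` is described by a surjection `q : P → M` together with a coordinate map `c : P → V` into
a normed space whose image is open; a function on `M` is smooth when, pulled back to `P`, it is a
smooth function of the coordinates. -/

section Poisson

variable {P M V : Type*} [NormedAddCommGroup V] [NormedSpace ℝ V]

/-- The function `F` of the coordinates represents the function `f` on `M`. -/
def Represents (q : P → M) (c : P → V) (F : V → ℝ) (f : M → ℝ) : Prop :=
  ContDiffOn ℝ ∞ F (Set.range c) ∧ ∀ p, f (q p) = F (c p)

/-- The algebra `C^∞(M)` of smooth functions. -/
def smoothFns (q : P → M) (c : P → V) : Subalgebra ℝ (M → ℝ) where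
  carrier := {f | ∃ F : V → ℝ, Represents q c F f}
  mul_mem' := by
    rintro f g ⟨F, hF, hf⟩ ⟨G, hG, hg⟩
    exact ⟨fun x => F x * G x, hF.mul hG, fun p => by simp [hf, hg]⟩
  add_mem' := by
    rintro f g ⟨F, hF, hf⟩ ⟨G, hG, hg⟩
    exact ⟨fun x => F x + G x, hF.add hG, fun p => by simp [hf, hg]⟩
  algebraMap_mem' := fun r => ⟨fun _ => r, contDiffOn_const, fun _ => rfl⟩

/-- Smooth functions on a subset `D` of `M` (`D` open, that is, given by an open set of
coordinates). -/
def smoothFnsOn (q : P → M) (c : P → V) (D : Set M) : Subalgebra ℝ (D → ℝ) :=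
  smoothFns (fun p : {p : P // q p ∈ D} => (⟨q p.1, p.2⟩ : D)) (fun p => c p.1)

/-- A Poisson bracket on an algebra of functions. -/
@[ext]
structure PoissonBracket (S : Subalgebra ℝ (M → ℝ)) where
  br : S →ₗ[ℝ] S →ₗ[ℝ] S
  skew : ∀ f g, br f g = -br g f
  leibniz : ∀ f g h, br f (g * h) = br f g * h + g * br f h
  jacobi : ∀ f g h, br f (br g h) + br g (br h f) + br h (br f g) = 0

/-- `φ : M → N` is a smooth map with `{f ∘ φ, g ∘ φ} = {f, g} ∘ φ`. -/
def IsPoissonMap {N : Type*} {S : Subalgebra ℝ (M → ℝ)} {T : Subalgebra ℝ (N → ℝ)}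
    (B : PoissonBracket S) (C : PoissonBracket T) (φ : M → N) : Prop :=
  ∃ h : ∀ f : T, f.1 ∘ φ ∈ S,
    ∀ f g : T, (B.br ⟨f.1 ∘ φ, h f⟩ ⟨g.1 ∘ φ, h g⟩).1 = (C.br f g).1 ∘ φ

variable {S : Subalgebra ℝ (M → ℝ)}

/-- `f` and `g` are smooth and `{f, g} = 0`. -/
def PoissonCommute (B : PoissonBracket S) (f g : M → ℝ) : Prop :=
  ∃ (hf : f ∈ S) (hg : g ∈ S), B.br ⟨f, hf⟩ ⟨g, hg⟩ = 0

/-- `f` is smooth and `{f, g} = 0` for all smooth `g`. -/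
def IsCasimir (B : PoissonBracket S) (f : M → ℝ) : Prop :=
  ∃ hf : f ∈ S, ∀ g : S, B.br ⟨f, hf⟩ g = 0

/-- A function with values in `ℝ / 2πℤ` is a Casimir if its cosine and its sine are. -/
def IsAngleCasimir (B : PoissonBracket S) (f : M → Real.Angle) : Prop :=
  IsCasimir B (fun x => (f x).cos) ∧ IsCasimir B (fun x => (f x).sin)

/-- `y` is the end point of an integral curve, starting at `x`, of the Hamiltonian vector field
`{·, h}` of a smooth function `h`. -/
def HamiltonianStep (B : PoissonBracket S) (x y : M) : Prop :=
  ∃ (h : S) (γ : ℝ → M), γ 0 = x ∧ γ 1 = y ∧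
    ∀ f : S, ∀ t ∈ Set.Icc (0 : ℝ) 1,
      HasDerivWithinAt (fun s => f.1 (γ s)) ((B.br f h).1 (γ t)) (Set.Icc 0 1) t

/-- `x` and `y` lie on the same symplectic leaf: they are joined by a piecewise smooth curve
consisting of trajectories of Hamiltonian vector fields. -/
def SameSymplecticLeaf (B : PoissonBracket S) (x y : M) : Prop :=
  Relation.ReflTransGen (HamiltonianStep B) x y

end Poisson

/-- Wirtinger derivative `∂/∂w` of a function with real differential `L` (in the variable `w`). -/
def wirt (L : ℂ → ℝ) : ℂ := ((L 1 : ℂ) - Complex.I * (L Complex.I : ℂ)) / 2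

/-- Wirtinger derivative `∂/∂w̄` of a function with real differential `L` (in the variable `w`). -/
def wirtBar (L : ℂ → ℝ) : ℂ := ((L 1 : ℂ) + Complex.I * (L Complex.I : ℂ)) / 2

/-- `δ_{i+1,j} - δ_{i-1,j}`, with indices modulo `n`. -/
def cyc {n : ℕ} [NeZero n] (i j : Fin n) : ℝ :=
  (if i + 1 = j then 1 else 0) - (if i - 1 = j then 1 else 0)

/-! ## Polygons -/

def edge (v : ℤ → ℂ) (i : ℤ) : ℂ := v i - v (i - 1)

/-- The ratio `y_i = z_{i+1} / z_i` of consecutive edge vectors. -/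
def ratio (v : ℤ → ℂ) (i : ℤ) : ℂ := edge v (i + 1) / edge v i

def extAngle (v : ℤ → ℂ) (i : ℤ) : Real.Angle := (Complex.arg (ratio v i) : Real.Angle)

/-- `n`-gons closed up to a similarity. -/
structure PolygonS (n : ℕ) where
  v : ℤ → ℂ
  ne : ∀ i, v i ≠ v (i + 1)
  mono : ∃ a b : ℂ, a ≠ 0 ∧ ∀ i, v (i + n) = a * v i + b

/-- `n`-gons closed up to an isometry. -/
structure PolygonE (n : ℕ) where
  v : ℤ → ℂ
  ne : ∀ i, v i ≠ v (i + 1)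
  mono : ∃ (a : Circle) (b : ℂ), ∀ i, v (i + n) = a * v i + b

/-- `n`-gons closed up to an isometry, with a chosen square root `α` of the rotational part of the
monodromy. -/
structure PolygonT (n : ℕ) where
  v : ℤ → ℂ
  α : Circle
  ne : ∀ i, v i ≠ v (i + 1)
  mono : ∃ b : ℂ, ∀ i, v (i + n) = (α : ℂ) ^ 2 * v i + b

/-- `w` is the image of `v` under a similarity. -/
def SimRel (v w : ℤ → ℂ) : Prop := ∃ a b : ℂ, a ≠ 0 ∧ ∀ i, w i = a * v i + b

/-- `w` is the image of `v` under an isometry. -/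
def IsoRel (v w : ℤ → ℂ) : Prop := ∃ (a : Circle) (b : ℂ), ∀ i, w i = a * v i + b

theorem simRel_refl (v : ℤ → ℂ) : SimRel v v := ⟨1, 0, one_ne_zero, fun i => by simp⟩

theorem simRel_symm {v w : ℤ → ℂ} (h : SimRel v w) : SimRel w v := by
  obtain ⟨a, b, ha, h⟩ := h
  refine ⟨a⁻¹, -(a⁻¹ * b), inv_ne_zero ha, fun i => ?_⟩
  rw [h]; field_simp; ring

theorem simRel_trans {u v w : ℤ → ℂ} (h : SimRel u v) (k : SimRel v w) : SimRel u w := by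
  obtain ⟨a, b, ha, h⟩ := h
  obtain ⟨c, d, hc, k⟩ := k
  exact ⟨c * a, c * b + d, mul_ne_zero hc ha, fun i => by rw [k, h]; ring⟩

theorem isoRel_refl (v : ℤ → ℂ) : IsoRel v v := ⟨1, 0, fun i => by simp⟩

theorem isoRel_symm {v w : ℤ → ℂ} (h : IsoRel v w) : IsoRel w v := by
  obtain ⟨a, b, h⟩ := h
  refine ⟨a⁻¹, -((a : ℂ)⁻¹ * b), fun i => ?_⟩
  have ha : (a : ℂ) ≠ 0 := Circle.coe_ne_zero a
  rw [h, Circle.coe_inv]; field_simp; ring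

theorem isoRel_trans {u v w : ℤ → ℂ} (h : IsoRel u v) (k : IsoRel v w) : IsoRel u w := by
  obtain ⟨a, b, h⟩ := h
  obtain ⟨c, d, k⟩ := k
  exact ⟨c * a, c * b + d, fun i => by rw [k, h, Circle.coe_mul]; ring⟩

theorem isoRel_simRel {v w : ℤ → ℂ} (h : IsoRel v w) : SimRel v w := by
  obtain ⟨a, b, h⟩ := h
  exact ⟨a, b, Circle.coe_ne_zero a, h⟩

instance setoidS (n : ℕ) : Setoid (PolygonS n) where
  r x y := SimRel x.v y.v
  iseqv := ⟨fun x => simRel_refl x.v, simRel_symm, simRel_trans⟩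

instance setoidE (n : ℕ) : Setoid (PolygonE n) where
  r x y := IsoRel x.v y.v
  iseqv := ⟨fun x => isoRel_refl x.v, isoRel_symm, isoRel_trans⟩

instance setoidT (n : ℕ) : Setoid (PolygonT n) where
  r x y := IsoRel x.v y.v ∧ x.α = y.α
  iseqv := ⟨fun x => ⟨isoRel_refl x.v, rfl⟩, fun h => ⟨isoRel_symm h.1, h.2.symm⟩,
    fun h k => ⟨isoRel_trans h.1 k.1, h.2.trans k.2⟩⟩

/-- Similarity classes of polygons closed up to similarity. -/
abbrev SpaceS (n : ℕ) : Type := Quotient (setoidS n)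

/-- Isometry classes of polygons closed up to isometry. -/
abbrev SpaceE (n : ℕ) : Type := Quotient (setoidE n)

/-- The double cover of `SpaceE n`. -/
abbrev SpaceT (n : ℕ) : Type := Quotient (setoidT n)

def PolygonT.toE {n : ℕ} (x : PolygonT n) : PolygonE n where
  v := x.v
  ne := x.ne
  mono := by
    obtain ⟨b, h⟩ := x.mono
    exact ⟨x.α ^ 2, b, fun i => by rw [h, Circle.coe_pow]⟩

def PolygonE.toS {n : ℕ} (x : PolygonE n) : PolygonS n where
  v := x.v
  ne := x.ne
  mono := by
    obtain ⟨a, b, h⟩ := x.mono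
    exact ⟨a, b, Circle.coe_ne_zero a, h⟩

/-- The covering map, forgetting the square root. -/
def projTE (n : ℕ) : SpaceT n → SpaceE n :=
  Quotient.map PolygonT.toE (fun _ _ h => h.1)

/-- The natural map from isometry classes to similarity classes. -/
def mapES (n : ℕ) : SpaceE n → SpaceS n :=
  Quotient.map PolygonE.toS (fun _ _ h => isoRel_simRel h)

/-! ### Coordinates -/

/-- A polygon with a choice of an argument of the square root `α`. -/
def ParT (n : ℕ) : Type := {p : PolygonT n × ℝ // p.1.α = Circle.exp p.2}

def qT (n : ℕ) (p : ParT n) : SpaceT n := Quotient.mk _ p.1.1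

/-- The coordinates `(z_1, …, z_n, θ)`, where `α = exp (i θ)`. -/
def cT (n : ℕ) (p : ParT n) : (Fin n → ℂ) × ℝ := (fun i => edge p.1.1.v (i.val + 1), p.1.2)

/-- A polygon with a choice of real values of its exterior angles. -/
def ParE (n : ℕ) : Type :=
  {p : PolygonE n × (Fin n → ℝ) // ∀ i, (p.2 i : Real.Angle) = extAngle p.1.v (i.val + 1)}

def qE (n : ℕ) (p : ParE n) : SpaceE n := Quotient.mk _ p.1.1

/-- The coordinates `(|z_1|, …, |z_n|, φ_1, …, φ_n)`. -/
def cE (n : ℕ) (p : ParE n) : (Fin n → ℝ) × (Fin n → ℝ) :=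
  (fun i => ‖edge p.1.1.v (i.val + 1)‖, p.1.2)

def qS (n : ℕ) (x : PolygonS n) : SpaceS n := Quotient.mk _ x

/-- The coordinates `(y_1, …, y_n)`. -/
def cS (n : ℕ) (x : PolygonS n) : Fin n → ℂ := fun i => ratio x.v (i.val + 1)

/-- Smooth functions on the double cover. -/
def smoothT (n : ℕ) : Subalgebra ℝ (SpaceT n → ℝ) := smoothFns (qT n) (cT n)

/-- Smooth functions on isometry classes. -/
def smoothE (n : ℕ) : Subalgebra ℝ (SpaceE n → ℝ) := smoothFns (qE n) (cE n)

/-- Smooth functions on similarity classes. -/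
def smoothS (n : ℕ) : Subalgebra ℝ (SpaceS n → ℝ) := smoothFns (qS n) (cS n)

/-! ### Functions on the polygon spaces -/

theorem edge_iso {v w : ℤ → ℂ} (h : IsoRel v w) :
    ∃ a : Circle, ∀ i, edge w i = a * edge v i := by
  obtain ⟨a, b, h⟩ := h
  exact ⟨a, fun i => by simp only [edge, h]; ring⟩

theorem norm_edge_iso {v w : ℤ → ℂ} (h : IsoRel v w) (i : ℤ) : ‖edge w i‖ = ‖edge v i‖ := by
  obtain ⟨a, h⟩ := edge_iso h
  rw [h, norm_mul, Circle.norm_coe, one_mul]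

theorem edge_mul_conj_iso {v w : ℤ → ℂ} (h : IsoRel v w) (i j : ℤ) :
    edge w i * starRingEnd ℂ (edge w j) = edge v i * starRingEnd ℂ (edge v j) := by
  obtain ⟨a, h⟩ := edge_iso h
  have ha : (a : ℂ) * starRingEnd ℂ (a : ℂ) = 1 := by
    rw [Complex.mul_conj, Circle.normSq_coe, Complex.ofReal_one]
  rw [h, h, map_mul]
  linear_combination (edge v i * starRingEnd ℂ (edge v j)) * ha

theorem extAngle_iso {v w : ℤ → ℂ} (h : IsoRel v w) (i : ℤ) : extAngle w i = extAngle v i := by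
  obtain ⟨a, h⟩ := edge_iso h
  have ha : (a : ℂ) ≠ 0 := Circle.coe_ne_zero a
  rw [extAngle, extAngle, ratio, ratio, h, h, mul_div_mul_left _ _ ha]

/-- `E_k = ∑_{i_1 < ⋯ < i_k} |z_{i_1}|² ⋯ |z_{i_k}|²`. -/
def invE (n k : ℕ) : SpaceT n → ℝ :=
  Quotient.lift
    (fun x : PolygonT n => ∑ s ∈ (Finset.univ : Finset (Fin n)).powersetCard k,
      ∏ i ∈ s, ‖edge x.v (i.val + 1)‖ ^ 2)
    (fun x y h => by simp only [norm_edge_iso (show IsoRel x.v y.v from h.1)])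

open Classical in
/-- `I_k = Re (α ∑_{i_1 < ⋯ < i_{2k}} z_{i_1} z̄_{i_2} ⋯ z_{i_{2k-1}} z̄_{i_{2k}})`. -/
def invI (n k : ℕ) : SpaceT n → ℝ :=
  Quotient.lift
    (fun x : PolygonT n => ((x.α : ℂ) *
      ∑ i ∈ (Finset.univ : Finset (Fin (2 * k) → Fin n)).filter StrictMono,
        ∏ m : Fin k, (edge x.v ((i ⟨2 * m.val, by omega⟩).val + 1) *
          starRingEnd ℂ (edge x.v ((i ⟨2 * m.val + 1, by omega⟩).val + 1)))).re)
    (fun x y h => by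
      simp only [edge_mul_conj_iso (show IsoRel x.v y.v from h.1), show x.α = y.α from h.2])

/-- The side length `|z_i|`. -/
def sideLength (n : ℕ) (i : ℤ) : SpaceE n → ℝ :=
  Quotient.lift (fun x : PolygonE n => ‖edge x.v i‖)
    (fun x y h => (norm_edge_iso (show IsoRel x.v y.v from h) i).symm)

/-- The exterior angle `φ_i`. -/
def exteriorAngle (n : ℕ) (i : ℤ) : SpaceE n → Real.Angle :=
  Quotient.lift (fun x : PolygonE n => extAngle x.v i)
    (fun x y h => (extAngle_iso (show IsoRel x.v y.v from h) i).symm)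

/-- `φ_1 + ⋯ + φ_n`. -/
def angleSum (n : ℕ) (x : SpaceE n) : Real.Angle := ∑ i : Fin n, exteriorAngle n (i.val + 1) x

/-- `φ_1 + φ_3 + φ_5 + ⋯` (the indices are the odd numbers between `1` and `n`). -/
def oddAngleSum (n : ℕ) (x : SpaceE n) : Real.Angle :=
  ∑ i ∈ (Finset.univ : Finset (Fin n)).filter (fun i => Odd (i.val + 1)),
    exteriorAngle n (i.val + 1) x

/-! ### Recutting -/

instance perpBisectorNonempty (a b : ℂ) : Nonempty (AffineSubspace.perpBisector a b) :=
  AffineSubspace.perpBisector_nonempty.to_subtype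

/-- Recutting at all `v_i` with `i ≡ j` mod `n`: such a `v_i` is reflected in the perpendicular
bisector of `v_{i-1}` and `v_{i+1}`. -/
def recutVertex (n : ℕ) (j : ℤ) (v : ℤ → ℂ) (i : ℤ) : ℂ :=
  if i ≡ j [ZMOD n] then
    EuclideanGeometry.reflection (AffineSubspace.perpBisector (v (i - 1)) (v (i + 1))) (v i)
  else v i

/-- The polygons that can be recut at `v_j`: those with `v_{j-1} ≠ v_{j+1}`. -/
def recutDomain (n : ℕ) (j : ℤ) : Set (SpaceT n) :=
  {X | ∀ x : PolygonT n, Quotient.mk _ x = X → x.v (j - 1) ≠ x.v (j + 1)}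

/-- `ρ` is the recutting map `[(v, α)] ↦ [(v', α)]`. -/
def IsRecutting (n : ℕ) (j : ℤ) (ρ : recutDomain n j → SpaceT n) : Prop :=
  ∀ (x : PolygonT n) (hx : Quotient.mk _ x ∈ recutDomain n j),
    ∃ x' : PolygonT n, x'.v = recutVertex n j x.v ∧ x'.α = x.α ∧
      ρ ⟨Quotient.mk _ x, hx⟩ = Quotient.mk _ x'

/-! ## Special quaternionic polynomials -/

def quatJ : ℍ[ℝ] := ⟨0, 0, 1, 0⟩

/-- Even coefficients are complex numbers, odd ones lie in the span of `j` and `k`. -/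
def IsSpecial (f : Polynomial ℍ[ℝ]) : Prop :=
  ∀ m, (Even m → (f.coeff m).imJ = 0 ∧ (f.coeff m).imK = 0) ∧
    (Odd m → (f.coeff m).re = 0 ∧ (f.coeff m).imI = 0)

/-- The space `X_{1,…,1}` of tuples of special quaternionic polynomials of degree one with
`g_i(0) ≠ 0` and `|g_1(0) ⋯ g_n(0)| = 1`. -/
def gaugeSpace (n : ℕ) : Set (Fin n → Polynomial ℍ[ℝ]) :=
  {g | (∀ i, IsSpecial (g i) ∧ (g i).natDegree = 1 ∧ (g i).coeff 0 ≠ 0) ∧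
    ∏ i, ‖(g i).coeff 0‖ = 1}

/-- The tuple of polynomials `a_i + b_i j t`. -/
def linTuple {n : ℕ} (p : Fin n → ℂ × ℂ) : Fin n → Polynomial ℍ[ℝ] := fun i =>
  Polynomial.C ((p i).1 : ℍ[ℝ]) + Polynomial.C (((p i).2 : ℍ[ℝ]) * quatJ) * Polynomial.X

/-- Equivalence under the gauge action `g_i ↦ λ_i g_i λ_{i+1}⁻¹`, indices modulo `n`. -/
def GaugeEquiv {n : ℕ} [NeZero n] (g h : Fin n → Polynomial ℍ[ℝ]) : Prop :=
  ∃ l : Fin n → ℂˣ, ∀ i, h i =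
    Polynomial.C ((l i : ℂ) : ℍ[ℝ]) * g i * Polynomial.C ((((l (i + 1))⁻¹ : ℂˣ) : ℂ) : ℍ[ℝ])

/-- The tuple `(1 + z_1 j t, …, 1 + z_{n-1} j t, (1 + z_n j t) α)`. -/
def gaugeSection {n : ℕ} (x : PolygonT n) : Fin n → Polynomial ℍ[ℝ] := fun i =>
  (1 + Polynomial.C ((edge x.v (i.val + 1) : ℍ[ℝ]) * quatJ) * Polynomial.X) *
    (if i.val + 1 = n then Polynomial.C ((x.α : ℂ) : ℍ[ℝ]) else 1)

/-- The product, over the `n` factors, of the bracket on linear polynomials `a + b j t` given by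
`{a, b} = -ab/2`, `{a, b̄} = ab̄/2`, `{ā, b̄} = -āb̄/2`, `{ā, b} = āb/2`, `{a, ā} = {b, b̄} = 0`. -/
def linBracket {n : ℕ} (F G : (Fin n → ℂ × ℂ) → ℝ) (p : Fin n → ℂ × ℂ) : ℂ :=
  ∑ i,
    let a := (p i).1
    let b := (p i).2
    let a' := starRingEnd ℂ a
    let b' := starRingEnd ℂ b
    let DA (H : (Fin n → ℂ × ℂ) → ℝ) : ℂ → ℝ := fun w => fderiv ℝ H p (Pi.single i (w, 0))
    let DB (H : (Fin n → ℂ × ℂ) → ℝ) : ℂ → ℝ := fun w => fderiv ℝ H p (Pi.single i (0, w))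
    (-(1 / 2) * a * b * (wirt (DA F) * wirt (DB G) - wirt (DB F) * wirt (DA G))
      + (1 / 2) * a * b' * (wirt (DA F) * wirtBar (DB G) - wirtBar (DB F) * wirt (DA G))
      - (1 / 2) * a' * b' * (wirtBar (DA F) * wirtBar (DB G) - wirtBar (DB F) * wirtBar (DA G))
      + (1 / 2) * a' * b * (wirtBar (DA F) * wirt (DB G) - wirt (DB F) * wirtBar (DA G)))

/-- `F`, a smooth function of `(a_i, b_i)` near `p`, restricts near `p` on `X_{1,…,1}` to the
pull-back of `f` under the identification of `X_{1,…,1} / (ℂ*)ⁿ` with the double cover, which sends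
the gauge class of `gaugeSection x` to the class of `x`. -/
def IsLocalPullback {n : ℕ} [NeZero n] (f : SpaceT n → ℝ) (p : Fin n → ℂ × ℂ)
    (F : (Fin n → ℂ × ℂ) → ℝ) : Prop :=
  ContDiffAt ℝ ∞ F p ∧ ∀ᶠ p' in nhds p, linTuple p' ∈ gaugeSpace n →
    ∀ x : PolygonT n, GaugeEquiv (linTuple p') (gaugeSection x) → F p' = f (Quotient.mk _ x)

/-- `B` is the bracket on the double cover obtained from the bracket on special quaternionic
polynomials: the identification map from `X_{1,…,1}` is Poisson. -/
def IsTransferred {n : ℕ} [NeZero n] (B : PoissonBracket (smoothT n)) : Prop :=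
  ∀ (f g : smoothT n) (p : Fin n → ℂ × ℂ) (F G : (Fin n → ℂ × ℂ) → ℝ) (x : PolygonT n),
    linTuple p ∈ gaugeSpace n → GaugeEquiv (linTuple p) (gaugeSection x) →
    IsLocalPullback f.1 p F → IsLocalPullback g.1 p G →
    (((B.br f g).1 (Quotient.mk _ x) : ℝ) : ℂ) = linBracket F G p

/-! ## Coordinate forms of brackets -/

/-- The cluster bracket `{y_i, y_j} = (δ_{i+1,j} - δ_{i-1,j}) y_i y_j`,
`{y_i, ȳ_j} = -(δ_{i+1,j} - δ_{i-1,j}) y_i ȳ_j`, with the complex conjugate relations. -/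
def clusterFormula {n : ℕ} [NeZero n] (F G : (Fin n → ℂ) → ℝ) (y : Fin n → ℂ) : ℂ :=
  ∑ i, ∑ j,
    let D (H : (Fin n → ℂ) → ℝ) (k : Fin n) : ℂ → ℝ := fun w => fderiv ℝ H y (Pi.single k w)
    let yi := y i
    let yj := y j
    let yi' := starRingEnd ℂ yi
    let yj' := starRingEnd ℂ yj
    (cyc i j : ℂ) *
      (yi * yj * wirt (D F i) * wirt (D G j) - yi * yj' * wirt (D F i) * wirtBar (D G j)
        - yi' * yj * wirtBar (D F i) * wirt (D G j)
        + yi' * yj' * wirtBar (D F i) * wirtBar (D G j))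

def IsClusterBracket {n : ℕ} [NeZero n] (B : PoissonBracket (smoothS n)) : Prop :=
  ∀ (f g : smoothS n) (F G : (Fin n → ℂ) → ℝ),
    Represents (qS n) (cS n) F f.1 → Represents (qS n) (cS n) G g.1 →
    ∀ x : PolygonS n, (((B.br f g).1 (qS n x) : ℝ) : ℂ) = clusterFormula F G (cS n x)

/-- In the coordinates `|z_i|, φ_i`, the only nonzero brackets are
`{φ_i, φ_j} = δ_{i-1,j} - δ_{i+1,j}`. -/
def HasAngleForm {n : ℕ} [NeZero n] (B : PoissonBracket (smoothE n)) : Prop :=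
  ∀ (f g : smoothE n) (F G : (Fin n → ℝ) × (Fin n → ℝ) → ℝ),
    Represents (qE n) (cE n) F f.1 → Represents (qE n) (cE n) G g.1 →
    ∀ p : ParE n, (B.br f g).1 (qE n p) = ∑ i, ∑ j, -cyc i j *
      fderiv ℝ F (cE n p) (0, Pi.single i 1) * fderiv ℝ G (cE n p) (0, Pi.single j 1)

end Recutting

end

open Recutting

/-!
The proof rests on one description of the bracket. In the coordinates `(z_1, …, z_n, θ)` with
`α = exp (i θ)`, let `W_k` be the infinitesimal rotation of the single edge vector `z_k`. These
fields commute and are invariant under rotations of the polygon, so they act on functions on the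
double cover as commuting derivations `D_k`, and for any skew matrix `C` of constants
`{f, g} = ∑ C_ij (D_i f) (D_j g)` is a Poisson bracket; only the Jacobi identity needs an argument
(`derivationBracket_iterated`, `iteratedTerm_swap`). `bracketT` is the case
`C_ij = sign (i - j)`. Since `∑ D_k` is the rotation of the whole polygon, `∑ D_k f = 0` for every
`f` (`sum_der_eq_zero`).

*Transfer.* The bracket on linear special polynomials differentiates only in the directions of the
rotations of the coefficients `a_i`, `b_i` (`linBracket_eq`). The edge `z_k` of the polygon is an
explicit monomial in these coefficients (`gaugeEdge`, `gaugeEquiv_iff`), so that each such rotation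
is a combination of the `W_k` and of a motion of `θ`; the contributions of `θ` cancel because
`∑ D_k f = 0` (`isTransferred_bracketT`). Every point and every smooth function lifts, hence
uniqueness.

*Descent.* The exterior angle `φ_i` is the difference of the arguments of two consecutive edges, so
`D_i` is a difference of the fields `∂ / ∂φ`, and the second difference of `sign (i - j)` on the
cycle is the matrix `δ_{i-1,j} - δ_{i+1,j}` (`orderSign_second_difference`). The cluster
bracket differentiates only along rotations of the `y_i`, that is, along the `φ_i`, with the same
matrix (`isClusterBracket_bracketS`, `der_comp_mapES`).

*Leaves.* Casimirs are constant on leaves. Conversely, the Hamiltonian `A sin (φ_j - a)` moves the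
exterior angles linearly in the direction of the `j`-th column of the matrix
(`hamiltonianStep_flowDir`), and these columns span the common kernel of the differentials of the
Casimirs (`mem_span_flowDir`).

*Recutting.* Recutting replaces the two edges `a`, `b` at a vertex by `b̄ S / S̄`, `ā S / S̄` with
`S = a + b`. On the derivatives `D_k` it therefore acts by a transvection along `e_i - e_{i+1}`
(`hasDerivAt_recutCoord`), which preserves the form `sign (i - j)` on vectors with sum zero
(`sum_orderSign_transvection`).

*Involutivity.* `E_k` and `I_0` do not change when single edges are rotated, so all `D_m` kill them.
The polynomial `∑ (-t²)^k I_k` is the real part of the quaternionic product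
`(1 + z_1 j t) ⋯ (1 + z_n j t) α` (`re_edgeProd_mul`). The rotation of an edge is the commutator of
its factor with `i / 2`, so `D_m` of the generating function is a difference of the `i`-components
of the cyclically permuted products `M_m` (`hasDerivAt_re_edgeProd`). The relation
`M_m (1 + z_m j t) = (1 + z_m j t) M_{m+1}` for two values `t`, `s` makes `(t² - s²)` times the
bracket density a difference in `m` (`monodromy_telescope`), whose sum around the polygon is zero.
-/

open scoped ContDiff Quaternion

noncomputable section

namespace Recutting

/-! ### Poisson brackets from commuting invariant vector fields -/

section Abstract

variable {M ι : Type*} [Fintype ι] {S : Subalgebra ℝ (M → ℝ)}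

/-- The trilinear expression `∑ C_ij C_kl (D_i f) (D_j D_k g) (D_l h)`, of which the iterated
bracket `{f, {g, h}}` is a difference. -/
def iteratedTerm (C : ι → ι → ℝ) (D : ι → Derivation ℝ S S) (f g h : S) : S :=
  ∑ i, ∑ j, ∑ k, ∑ l, (C i j * C k l) • (D i f * D j (D k g) * D l h)

theorem iteratedTerm_swap {C : ι → ι → ℝ} (hC : ∀ i j, C i j = -C j i)
    {D : ι → Derivation ℝ S S} (hD : ∀ i j f, D i (D j f) = D j (D i f)) (f g h : S) :
    iteratedTerm C D f g h = iteratedTerm C D h g f := by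
  have key : ∀ i j k l, (C i j * C k l) • (D i f * D j (D k g) * D l h) =
      (C l k * C j i) • (D l h * D k (D j g) * D i f) := fun i j k l => by
    rw [hC l k, hC j i, hD k j]
    congr 1
    · ring
    · ring
  unfold iteratedTerm
  simp_rw [key]
  calc _ = ∑ i, ∑ j, ∑ l, ∑ k, (C l k * C j i) • (D l h * D k (D j g) * D i f) :=
        Finset.sum_congr rfl fun i _ => Finset.sum_congr rfl fun j _ => Finset.sum_comm
    _ = ∑ i, ∑ l, ∑ j, ∑ k, (C l k * C j i) • (D l h * D k (D j g) * D i f) :=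
        Finset.sum_congr rfl fun i _ => Finset.sum_comm
    _ = ∑ l, ∑ i, ∑ j, ∑ k, (C l k * C j i) • (D l h * D k (D j g) * D i f) := Finset.sum_comm
    _ = ∑ l, ∑ i, ∑ k, ∑ j, (C l k * C j i) • (D l h * D k (D j g) * D i f) :=
        Finset.sum_congr rfl fun i _ => Finset.sum_congr rfl fun j _ => Finset.sum_comm
    _ = ∑ l, ∑ k, ∑ i, ∑ j, (C l k * C j i) • (D l h * D k (D j g) * D i f) :=
        Finset.sum_congr rfl fun i _ => Finset.sum_comm
    _ = _ := Finset.sum_congr rfl fun i _ => Finset.sum_congr rfl fun j _ => Finset.sum_comm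

/-- The bracket `{f, g} = ∑ C_ij (D_i f) (D_j g)`. -/
def derivationBracket (C : ι → ι → ℝ) (D : ι → Derivation ℝ S S) : S →ₗ[ℝ] S →ₗ[ℝ] S :=
  ∑ i, ∑ j, C i j • (LinearMap.mul ℝ S).compl₁₂ (D i : S →ₗ[ℝ] S) (D j : S →ₗ[ℝ] S)

theorem derivationBracket_apply (C : ι → ι → ℝ) (D : ι → Derivation ℝ S S) (f g : S) :
    derivationBracket C D f g = ∑ i, ∑ j, C i j • (D i f * D j g) := by
  simp [derivationBracket, LinearMap.sum_apply]

/-- The terms of the iterated bracket with second derivatives of `g` and of `h`; by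
`iteratedTerm_swap` they cancel in the cyclic sum of the Jacobi identity. -/
theorem derivationBracket_iterated {C : ι → ι → ℝ} (hC : ∀ i j, C i j = -C j i)
    (D : ι → Derivation ℝ S S) (f g h : S) :
    derivationBracket C D f (derivationBracket C D g h) =
      iteratedTerm C D f g h - iteratedTerm C D f h g := by
  have h1 : derivationBracket C D f (derivationBracket C D g h) = iteratedTerm C D f g h +
      ∑ i, ∑ j, ∑ k, ∑ l, (C i j * C k l) • (D i f * D j (D l h) * D k g) := by
    rw [derivationBracket_apply C D f, derivationBracket_apply C D g]
    simp only [iteratedTerm, map_sum, ← Finset.sum_add_distrib,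
      Derivation.map_smul, Derivation.leibniz, smul_eq_mul, Finset.mul_sum, Finset.smul_sum]
    refine Finset.sum_congr rfl fun i _ => Finset.sum_congr rfl fun j _ =>
      Finset.sum_congr rfl fun k _ => Finset.sum_congr rfl fun l _ => ?_
    rw [mul_smul_comm, smul_smul, ← smul_add]
    congr 1
    ring
  rw [h1, sub_eq_add_neg]
  congr 1
  unfold iteratedTerm
  simp only [← Finset.sum_neg_distrib]
  refine Finset.sum_congr rfl fun i _ => Finset.sum_congr rfl fun j _ => ?_
  rw [Finset.sum_comm]
  refine Finset.sum_congr rfl fun k _ => Finset.sum_congr rfl fun l _ => ?_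
  rw [hC l k, mul_neg, neg_smul]

/-- A skew matrix of constants and a family of commuting derivations give a Poisson bracket. -/
def poissonOfDerivations (C : ι → ι → ℝ) (hC : ∀ i j, C i j = -C j i)
    (D : ι → Derivation ℝ S S) (hD : ∀ i j f, D i (D j f) = D j (D i f)) : PoissonBracket S where
  br := derivationBracket C D
  skew f g := by
    rw [derivationBracket_apply, derivationBracket_apply, Finset.sum_comm,
      ← Finset.sum_neg_distrib]
    refine Finset.sum_congr rfl fun i _ => ?_
    rw [← Finset.sum_neg_distrib]
    refine Finset.sum_congr rfl fun j _ => ?_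
    rw [hC j i, neg_smul, mul_comm]
  leibniz f g h := by
    simp only [derivationBracket_apply, Derivation.leibniz, smul_eq_mul, Finset.sum_mul,
      Finset.mul_sum, ← Finset.sum_add_distrib]
    refine Finset.sum_congr rfl fun i _ => Finset.sum_congr rfl fun j _ => ?_
    rw [smul_mul_assoc, mul_smul_comm, ← smul_add]
    congr 1
    ring
  jacobi f g h := by
    simp only [derivationBracket_iterated hC]
    rw [iteratedTerm_swap hC hD f g h, iteratedTerm_swap hC hD g h f,
      iteratedTerm_swap hC hD h f g]
    abel

end Abstract

section Fields

variable {P M V ι : Type*} [NormedAddCommGroup V] [NormedSpace ℝ V] {q : P → M} {c : P → V}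

/-- A family of commuting vector fields on `M`, given by vector fields `W i` in the coordinates.
They descend to `M` because any two points of `P` over the same point of `M` are related by an
affine map of the coordinates that preserves the fields and is covered by a map of `P` over `M`. -/
structure CommutingFields (q : P → M) (c : P → V) (ι : Type*) where
  surj : Function.Surjective q
  isOpen : IsOpen (Set.range c)
  W : ι → V → V
  smooth : ∀ i, ContDiff ℝ ∞ (W i)
  inv : ∀ i p p', q p = q p' → ∃ (L : V →L[ℝ] V) (b : V), c p' = L (c p) + b ∧
    L (W i (c p)) = W i (c p') ∧ ∀ p₁, ∃ p₂, q p₂ = q p₁ ∧ c p₂ = L (c p₁) + b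
  comm : ∀ i j v, fderiv ℝ (W i) v (W j v) = fderiv ℝ (W j) v (W i v)

theorem Represents.differentiableAt {F : V → ℝ} {f : M → ℝ} (hF : Represents q c F f)
    (ho : IsOpen (Set.range c)) (p : P) : DifferentiableAt ℝ F (c p) :=
  (hF.1.contDiffAt (ho.mem_nhds ⟨p, rfl⟩)).differentiableAt (by simp)

namespace CommutingFields

variable (X : CommutingFields q c ι)

include X in
theorem represents_eventuallyEq {F G : V → ℝ} {f : M → ℝ} (hF : Represents q c F f)
    (hG : Represents q c G f) (p : P) : F =ᶠ[nhds (c p)] G := by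
  filter_upwards [X.isOpen.mem_nhds ⟨p, rfl⟩] with v hv
  obtain ⟨p', rfl⟩ := hv
  rw [← hF.2, ← hG.2]

/-- The derivative of a function along an invariant field depends only on the point of `M`. -/
theorem fderiv_eq {F : V → ℝ} {f : M → ℝ} (hF : Represents q c F f) (i : ι) {p p' : P}
    (h : q p = q p') :
    fderiv ℝ F (c p) (X.W i (c p)) = fderiv ℝ F (c p') (X.W i (c p')) := by
  obtain ⟨L, b, h1, h2, h3⟩ := X.inv i p p' h
  have hd := hF.differentiableAt X.isOpen p'
  rw [h1] at hd
  have hcomp : F =ᶠ[nhds (c p)] fun v => F (L v + b) := by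
    filter_upwards [X.isOpen.mem_nhds ⟨p, rfl⟩] with v hv
    obtain ⟨p₁, rfl⟩ := hv
    obtain ⟨p₂, h4, h5⟩ := h3 p₁
    rw [← h5, ← hF.2, ← hF.2, h4]
  have hA : HasFDerivAt (fun v => F (L v + b)) ((fderiv ℝ F (L (c p) + b)).comp L) (c p) :=
    HasFDerivAt.comp (c p) hd.hasFDerivAt (L.hasFDerivAt.add_const b)
  rw [hcomp.fderiv_eq, hA.fderiv, ← h2, h1]
  rfl

/-- A representative of a smooth function. -/
def rep (f : smoothFns q c) : V → ℝ := f.2.choose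

theorem rep_spec (f : smoothFns q c) : Represents q c (rep f) f.1 := f.2.choose_spec

/-- The function `W_i f` on `M`. -/
def derFun (i : ι) (f : smoothFns q c) (m : M) : ℝ :=
  fderiv ℝ (rep f) (c (Function.surjInv X.surj m)) (X.W i (c (Function.surjInv X.surj m)))

theorem derFun_eq (i : ι) (f : smoothFns q c) {F : V → ℝ} (hF : Represents q c F f.1) (p : P) :
    X.derFun i f (q p) = fderiv ℝ F (c p) (X.W i (c p)) := by
  rw [derFun, X.fderiv_eq (rep_spec f) i (Function.surjInv_eq X.surj (q p)),
    (X.represents_eventuallyEq (rep_spec f) hF p).fderiv_eq]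

theorem represents_derFun (i : ι) (f : smoothFns q c) {F : V → ℝ} (hF : Represents q c F f.1) :
    Represents q c (fun v => fderiv ℝ F v (X.W i v)) (X.derFun i f) :=
  ⟨(hF.1.fderiv_of_isOpen X.isOpen (by simp)).clm_apply (X.smooth i).contDiffOn,
    X.derFun_eq i f hF⟩

theorem Represents_add {F G : V → ℝ} {f g : M → ℝ} (hF : Represents q c F f)
    (hG : Represents q c G g) : Represents q c (fun v => F v + G v) (f + g) :=
  ⟨hF.1.add hG.1, fun p => by simp [hF.2, hG.2]⟩

theorem Represents_mul {F G : V → ℝ} {f g : M → ℝ} (hF : Represents q c F f)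
    (hG : Represents q c G g) : Represents q c (fun v => F v * G v) (f * g) :=
  ⟨hF.1.mul hG.1, fun p => by simp [hF.2, hG.2]⟩

theorem Represents_smul {F : V → ℝ} {f : M → ℝ} (r : ℝ) (hF : Represents q c F f) :
    Represents q c (fun v => r * F v) (r • f) :=
  ⟨contDiffOn_const.mul hF.1, fun p => by simp [hF.2]⟩

/-- The derivation `W_i` of the algebra of smooth functions on `M`. -/
def der (i : ι) : Derivation ℝ (smoothFns q c) (smoothFns q c) :=
  Derivation.mk'
    { toFun := fun f => ⟨X.derFun i f, _, X.represents_derFun i f (rep_spec f)⟩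
      map_add' := fun f g => by
        ext m
        obtain ⟨p, rfl⟩ := X.surj m
        have hf := (rep_spec f).differentiableAt X.isOpen p
        have hg := (rep_spec g).differentiableAt X.isOpen p
        change X.derFun i (f + g) (q p) = X.derFun i f (q p) + X.derFun i g (q p)
        rw [X.derFun_eq i (f + g) (Represents_add (rep_spec f) (rep_spec g)),
          X.derFun_eq i f (rep_spec f), X.derFun_eq i g (rep_spec g), fderiv_fun_add hf hg]
        rfl
      map_smul' := fun r f => by
        ext m
        obtain ⟨p, rfl⟩ := X.surj m
        have hf := (rep_spec f).differentiableAt X.isOpen p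
        change X.derFun i (r • f) (q p) = r * X.derFun i f (q p)
        rw [X.derFun_eq i (r • f) (Represents_smul r (rep_spec f)),
          X.derFun_eq i f (rep_spec f), fderiv_const_mul hf]
        rfl }
    (fun f g => by
      ext m
      obtain ⟨p, rfl⟩ := X.surj m
      have hf := (rep_spec f).differentiableAt X.isOpen p
      have hg := (rep_spec g).differentiableAt X.isOpen p
      change X.derFun i (f * g) (q p) =
        f.1 (q p) * X.derFun i g (q p) + g.1 (q p) * X.derFun i f (q p)
      rw [X.derFun_eq i (f * g) (Represents_mul (rep_spec f) (rep_spec g)),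
        X.derFun_eq i f (rep_spec f), X.derFun_eq i g (rep_spec g), fderiv_fun_mul hf hg,
        (rep_spec f).2, (rep_spec g).2]
      rfl)

theorem der_apply (i : ι) (f : smoothFns q c) {F : V → ℝ} (hF : Represents q c F f.1) (p : P) :
    (X.der i f).1 (q p) = fderiv ℝ F (c p) (X.W i (c p)) :=
  X.derFun_eq i f hF p

theorem represents_der (i : ι) (f : smoothFns q c) {F : V → ℝ} (hF : Represents q c F f.1) :
    Represents q c (fun v => fderiv ℝ F v (X.W i v)) (X.der i f).1 :=
  X.represents_derFun i f hF

/-- The derivative of `f` along `W_i` is computed along any curve tangent to `W_i`. -/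
theorem der_eq_of_hasDerivAt {i : ι} {f : smoothFns q c} {F : V → ℝ} (hF : Represents q c F f.1)
    {p : P} {γ : ℝ → V} (hγ : HasDerivAt γ (X.W i (c p)) 0) (h0 : γ 0 = c p) {d : ℝ}
    (hd : HasDerivAt (fun s => F (γ s)) d 0) : (X.der i f).1 (q p) = d := by
  have h1 : HasFDerivAt F (fderiv ℝ F (c p)) (γ 0) := by
    rw [h0]; exact (hF.differentiableAt X.isOpen p).hasFDerivAt
  rw [X.der_apply i f hF p]
  exact (h1.comp_hasDerivAt 0 hγ).unique hd

theorem der_comm (i j : ι) (f : smoothFns q c) : X.der i (X.der j f) = X.der j (X.der i f) := by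
  ext m
  obtain ⟨p, rfl⟩ := X.surj m
  have hf := rep_spec f
  rw [X.der_apply i _ (X.represents_der j f hf), X.der_apply j _ (X.represents_der i f hf)]
  have hc : ContDiffAt ℝ ∞ (rep f) (c p) := hf.1.contDiffAt (X.isOpen.mem_nhds ⟨p, rfl⟩)
  have h2 : DifferentiableAt ℝ (fderiv ℝ (rep f)) (c p) :=
    (hc.fderiv_right (m := 1) (by norm_cast)).differentiableAt (by simp)
  have hW : ∀ k, DifferentiableAt ℝ (X.W k) (c p) := fun k =>
    (X.smooth k).contDiffAt.differentiableAt (by simp)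
  have hs : IsSymmSndFDerivAt ℝ (rep f) (c p) :=
    hc.isSymmSndFDerivAt (by simp [minSmoothness_of_isRCLikeNormedField]; norm_cast)
  rw [fderiv_clm_apply h2 (hW j), fderiv_clm_apply h2 (hW i)]
  simp only [add_apply, ContinuousLinearMap.comp_apply,
    ContinuousLinearMap.flip_apply]
  rw [X.comm j i, hs.eq (X.W i (c p)) (X.W j (c p))]

variable [Fintype ι]

/-- The Poisson bracket `∑ C_ij W_i ∧ W_j`. -/
def poisson (C : ι → ι → ℝ) (hC : ∀ i j, C i j = -C j i) : PoissonBracket (smoothFns q c) :=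
  poissonOfDerivations C hC X.der X.der_comm

theorem poisson_apply (C : ι → ι → ℝ) (hC : ∀ i j, C i j = -C j i) (f g : smoothFns q c) (m : M) :
    ((X.poisson C hC).br f g).1 m = ∑ i, ∑ j, C i j * ((X.der i f).1 m * (X.der j g).1 m) := by
  change (derivationBracket C X.der f g).1 m = _
  rw [derivationBracket_apply]
  simp

end CommutingFields

end Fields

/-! ### Polygons and their edge vectors -/

section Edges

theorem edge_ne_zero {v : ℤ → ℂ} (h : ∀ i, v i ≠ v (i + 1)) (k : ℤ) : edge v k ≠ 0 := by
  have := h (k - 1)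
  rw [sub_add_cancel] at this
  exact sub_ne_zero.mpr this.symm

theorem ne_of_edge_ne_zero {v : ℤ → ℂ} (h : ∀ k, edge v k ≠ 0) (i : ℤ) : v i ≠ v (i + 1) := by
  have := h (i + 1)
  rw [edge, add_sub_cancel_right] at this
  exact (sub_ne_zero.mp this).symm

/-- A sequence of vertices is determined by its edge vectors up to translation. -/
theorem exists_translation {v w : ℤ → ℂ} {a : ℂ} (h : ∀ k, edge w k = a * edge v k) :
    ∃ b, ∀ i, w i = a * v i + b := by
  refine ⟨w 0 - a * v 0, fun i => ?_⟩
  induction i using Int.induction_on with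
  | zero => ring
  | succ k ih =>
    have := h (k + 1)
    simp only [edge, add_sub_cancel_right] at this
    linear_combination this + ih
  | pred k ih =>
    have := h (-k)
    simp only [edge] at this
    linear_combination ih - this

theorem edge_add_period {v : ℤ → ℂ} {m : ℤ} {a b : ℂ} (h : ∀ i, v (i + m) = a * v i + b) (k : ℤ) :
    edge v (k + m) = a * edge v k := by
  have h2 := h (k - 1)
  rw [show k - 1 + m = k + m - 1 by ring] at h2
  rw [edge, edge, h, h2]
  ring

theorem exists_mono_of_edge {v : ℤ → ℂ} {m : ℤ} {a : ℂ} (h : ∀ k, edge v (k + m) = a * edge v k) :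
    ∃ b, ∀ i, v (i + m) = a * v i + b :=
  exists_translation (w := fun i => v (i + m)) fun k => by
    rw [← h k]
    simp only [edge]
    congr 2
    ring

theorem ratio_add_period {v : ℤ → ℂ} {m : ℤ} {a : ℂ} (ha : a ≠ 0)
    (h : ∀ k, edge v (k + m) = a * edge v k) (k : ℤ) : ratio v (k + m) = ratio v k := by
  rw [ratio, ratio, show k + m + 1 = (k + 1) + m by ring, h, h, mul_div_mul_left _ _ ha]

theorem periodic_iff {n : ℕ} {Q : ℤ → Prop} (hQ : ∀ k, Q k ↔ Q (k + n)) (m l : ℤ) :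
    Q l ↔ Q (l + n * m) := by
  induction m using Int.induction_on with
  | zero => simp
  | succ m ih => rw [ih, hQ (l + n * m)]; ring_nf
  | pred m ih => rw [ih, hQ (l + n * (-m - 1))]; ring_nf

/-- A property of integers that is periodic modulo `n` holds everywhere once it holds on
`1, …, n`. -/
theorem forall_of_periodic {n : ℕ} [NeZero n] {Q : ℤ → Prop} (hQ : ∀ k, Q k ↔ Q (k + n))
    (h : ∀ i : Fin n, Q (i.val + 1)) (k : ℤ) : Q k := by
  have hn : (0 : ℤ) < n := by exact_mod_cast Nat.pos_of_ne_zero (NeZero.ne n)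
  have h1 := Int.emod_nonneg (k - 1) hn.ne'
  have h2 := Int.emod_lt_of_pos (k - 1) hn
  have h3 := h ⟨((k - 1) % n).toNat, by omega⟩
  rw [periodic_iff hQ ((k - 1) / n)] at h3
  convert h3 using 1
  have := Int.emod_add_mul_ediv (k - 1) n
  push_cast [Int.toNat_of_nonneg h1]
  linarith

/-- The polygon with the given edge vectors and `v 0 = 0`. -/
def vertexOfEdges (e : ℤ → ℂ) (k : ℤ) : ℂ := ∑ i ∈ Finset.Ioc 0 k, e i - ∑ i ∈ Finset.Ioc k 0, e i

theorem edge_vertexOfEdges (e : ℤ → ℂ) (k : ℤ) : edge (vertexOfEdges e) k = e k := by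
  unfold edge vertexOfEdges
  rcases le_or_gt k 0 with hk | hk
  · have h1 : Finset.Ioc (k - 1) 0 = insert k (Finset.Ioc k 0) := by
      ext i; simp only [Finset.mem_Ioc, Finset.mem_insert]; omega
    rw [h1, Finset.sum_insert (by simp), Finset.Ioc_eq_empty_of_le hk,
      Finset.Ioc_eq_empty_of_le (by omega : k - 1 ≤ 0)]
    simp
  · have h1 : Finset.Ioc 0 k = insert k (Finset.Ioc 0 (k - 1)) := by
      ext i; simp only [Finset.mem_Ioc, Finset.mem_insert]; omega
    rw [h1, Finset.sum_insert (by simp), Finset.Ioc_eq_empty_of_le hk.le,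
      Finset.Ioc_eq_empty_of_le (by omega : 0 ≤ k - 1)]
    simp

variable {n : ℕ} [NeZero n]

/-- The residue of `k - 1` modulo `n`. -/
def residue (n : ℕ) [NeZero n] (k : ℤ) : Fin n :=
  ⟨((k - 1) % n).toNat, by
    have hn : (0 : ℤ) < n := by exact_mod_cast Nat.pos_of_ne_zero (NeZero.ne n)
    have h1 := Int.emod_nonneg (k - 1) hn.ne'
    have h2 := Int.emod_lt_of_pos (k - 1) hn
    omega⟩

/-- The sequence with values `z` at `1, …, n`, multiplied by `a` when the index grows by `n`. -/
def extendEdges (a : ℂ) (z : Fin n → ℂ) (k : ℤ) : ℂ := a ^ ((k - 1) / n) * z (residue n k)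

theorem extendEdges_val (a : ℂ) (z : Fin n → ℂ) (i : Fin n) : extendEdges a z (i.val + 1) = z i := by
  have h1 : ((i.val : ℤ) + 1 - 1) / n = 0 := by
    rw [add_sub_cancel_right]; exact Int.ediv_eq_zero_of_lt (by omega) (by exact_mod_cast i.2)
  have h2 : residue n (i.val + 1) = i := by
    ext
    simp only [residue, add_sub_cancel_right]
    rw [Int.emod_eq_of_lt (by omega) (by exact_mod_cast i.2)]
    simp
  rw [extendEdges, h1, h2, zpow_zero, one_mul]

theorem extendEdges_add {a : ℂ} (ha : a ≠ 0) (z : Fin n → ℂ) (k : ℤ) :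
    extendEdges a z (k + n) = a * extendEdges a z k := by
  have hn : (n : ℤ) ≠ 0 := by exact_mod_cast NeZero.ne n
  have h1 : residue n (k + n) = residue n k := by
    ext
    simp [residue, show k + n - 1 = k - 1 + n by ring]
  rw [extendEdges, extendEdges, h1, show k + n - 1 = k - 1 + n by ring,
    Int.add_ediv_of_dvd_right (dvd_refl _), Int.ediv_self hn, zpow_add_one₀ ha]
  ring

theorem extendEdges_ne_zero {a : ℂ} (ha : a ≠ 0) {z : Fin n → ℂ} (hz : ∀ i, z i ≠ 0) (k : ℤ) :
    extendEdges a z k ≠ 0 := mul_ne_zero (zpow_ne_zero _ ha) (hz _)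

/-- The polygon with edges `z` and square root `α` of the rotational part of the monodromy. -/
def polygonT (z : Fin n → ℂ) (hz : ∀ i, z i ≠ 0) (α : Circle) : PolygonT n where
  v := vertexOfEdges (extendEdges ((α : ℂ) ^ 2) z)
  α := α
  ne := ne_of_edge_ne_zero fun k => by
    rw [edge_vertexOfEdges]
    exact extendEdges_ne_zero (pow_ne_zero 2 (Circle.coe_ne_zero α)) hz k
  mono := exists_mono_of_edge fun k => by
    simp only [edge_vertexOfEdges]
    exact extendEdges_add (pow_ne_zero 2 (Circle.coe_ne_zero α)) z k

theorem edge_polygonT (z : Fin n → ℂ) (hz : ∀ i, z i ≠ 0) (α : Circle) (i : Fin n) :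
    edge (polygonT z hz α).v (i.val + 1) = z i := by
  rw [polygonT, edge_vertexOfEdges, extendEdges_val]

theorem PolygonT.edge_add {n : ℕ} (x : PolygonT n) (k : ℤ) :
    edge x.v (k + n) = (x.α : ℂ) ^ 2 * edge x.v k :=
  edge_add_period x.mono.choose_spec k

theorem PolygonT.edge_ne {n : ℕ} (x : PolygonT n) (k : ℤ) : edge x.v k ≠ 0 := edge_ne_zero x.ne k

theorem PolygonE.edge_ne {n : ℕ} (x : PolygonE n) (k : ℤ) : edge x.v k ≠ 0 := edge_ne_zero x.ne k

theorem PolygonE.edge_add {n : ℕ} (x : PolygonE n) :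
    ∃ a : Circle, ∀ k, edge x.v (k + n) = (a : ℂ) * edge x.v k := by
  obtain ⟨a, b, h⟩ := x.mono
  exact ⟨a, edge_add_period h⟩

theorem PolygonE.norm_edge_add {n : ℕ} (x : PolygonE n) (k : ℤ) :
    ‖edge x.v (k + n)‖ = ‖edge x.v k‖ := by
  obtain ⟨a, h⟩ := x.edge_add
  rw [h, norm_mul, Circle.norm_coe, one_mul]

theorem PolygonE.ratio_add {n : ℕ} (x : PolygonE n) (k : ℤ) : ratio x.v (k + n) = ratio x.v k := by
  obtain ⟨a, h⟩ := x.edge_add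
  exact ratio_add_period (Circle.coe_ne_zero a) h k

/-- The cyclic successor of `i`, as an integer: `i + 1`, or `0` at the end. -/
theorem val_add_one_cases (i : Fin n) :
    (((i + 1 : Fin n).val : ℤ) = i.val + 1) ∨ (i.val + 1 = n ∧ ((i + 1 : Fin n).val : ℤ) = 0) := by
  have hi := i.2
  rcases Nat.lt_or_ge (i.val + 1) n with h | h
  · left
    rw [Fin.val_add, Fin.val_one', Nat.add_mod_mod, Nat.mod_eq_of_lt h]
    push_cast; ring
  · right
    have h' : i.val + 1 = n := by omega
    refine ⟨h', ?_⟩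
    rw [Fin.val_add, Fin.val_one', Nat.add_mod_mod, h', Nat.mod_self]
    rfl

/-- The next edge is the edge with the cyclically next index, up to the rotation `α²` on passing
the end. -/
theorem PolygonT.edge_succ (x : PolygonT n) (i : Fin n) :
    edge x.v (i.val + 1 + 1) =
      (if i.val + 1 = n then (x.α : ℂ) ^ 2 else 1) * edge x.v ((i + 1 : Fin n).val + 1) := by
  rcases val_add_one_cases i with h | ⟨h, h'⟩
  · rw [h]
    by_cases hn : i.val + 1 = n
    · exfalso
      have := (i + 1 : Fin n).2
      omega
    · rw [if_neg hn, one_mul]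
  · rw [if_pos h, h', ← x.edge_add]
    congr 1
    omega

theorem PolygonE.norm_edge_succ (x : PolygonE n) (i : Fin n) :
    ‖edge x.v (i.val + 1 + 1)‖ = ‖edge x.v ((i + 1 : Fin n).val + 1)‖ := by
  rcases val_add_one_cases i with h | ⟨h, h'⟩
  · rw [h]
  · rw [h', ← x.norm_edge_add (0 + 1)]
    congr 2
    omega

/-! ### Classes of polygons in terms of coordinates -/

theorem mkT_eq_of_edges {x y : PolygonT n} (hα : x.α = y.α) (u : Circle)
    (h : ∀ i : Fin n, edge y.v (i.val + 1) = u * edge x.v (i.val + 1)) :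
    (Quotient.mk _ x : SpaceT n) = Quotient.mk _ y := by
  refine Quotient.sound ⟨?_, hα⟩
  have h' : ∀ k, edge y.v k = u * edge x.v k := by
    refine forall_of_periodic (n := n) (fun k => ?_) h
    rw [x.edge_add, y.edge_add, hα]
    have : ((y.α : ℂ) ^ 2) ≠ 0 := pow_ne_zero 2 (Circle.coe_ne_zero _)
    constructor
    · intro h; rw [h]; ring
    · intro h
      apply mul_left_cancel₀ this
      rw [h]; ring
  obtain ⟨b, hb⟩ := exists_translation h'
  exact ⟨u, b, hb⟩

theorem exists_scale_of_ratio {v w : ℤ → ℂ} (hv : ∀ k, edge v k ≠ 0) (hw : ∀ k, edge w k ≠ 0)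
    (h : ∀ k, ratio w k = ratio v k) (k : ℤ) : edge w k = edge w 0 / edge v 0 * edge v k := by
  have hs : ∀ k, edge w (k + 1) / edge v (k + 1) = edge w k / edge v k := fun k => by
    have := h k
    simp only [ratio] at this
    rw [div_eq_div_iff (hw _) (hv _)] at this
    rw [div_eq_div_iff (hv _) (hv _)]
    linear_combination this
  have : edge w k / edge v k = edge w 0 / edge v 0 := by
    induction k using Int.induction_on with
    | zero => rfl
    | succ k ih => rw [hs, ih]
    | pred k ih =>
      rw [← ih, ← hs (-k - 1)]
      simp
  rw [← this, div_mul_cancel₀ _ (hv k)]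

theorem PolygonE.ratio_ne {n : ℕ} (x : PolygonE n) (k : ℤ) : ratio x.v k ≠ 0 :=
  div_ne_zero (x.edge_ne _) (x.edge_ne _)

theorem ratio_eq_norm_mul_exp {v : ℤ → ℂ} {k : ℤ} {φ : ℝ} (h : (φ : Real.Angle) = extAngle v k) :
    ratio v k = (‖edge v (k + 1)‖ / ‖edge v k‖ : ℝ) * Complex.exp (φ * Complex.I) := by
  obtain ⟨m, hm⟩ := Real.Angle.angle_eq_iff_two_pi_dvd_sub.mp h
  have h1 : Complex.exp (φ * Complex.I) = Complex.exp (Complex.arg (ratio v k) * Complex.I) := by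
    have : (φ : ℂ) = Complex.arg (ratio v k) + m * (2 * Real.pi) := by
      have : φ = Complex.arg (ratio v k) + m * (2 * Real.pi) := by linarith
      exact_mod_cast this
    rw [this, add_mul, Complex.exp_add, show (m * (2 * (Real.pi : ℂ)) * Complex.I) =
      m * (2 * Real.pi * Complex.I) by ring, Complex.exp_int_mul_two_pi_mul_I, mul_one]
  rw [h1, ← norm_div]
  exact (Complex.norm_mul_exp_arg_mul_I _).symm

theorem mkE_eq_of_coords {x y : PolygonE n}
    (hr : ∀ i : Fin n, ‖edge y.v (i.val + 1)‖ = ‖edge x.v (i.val + 1)‖)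
    (hφ : ∀ i : Fin n, extAngle y.v (i.val + 1) = extAngle x.v (i.val + 1)) :
    (Quotient.mk _ x : SpaceE n) = Quotient.mk _ y := by
  have hr' : ∀ k, ‖edge y.v k‖ = ‖edge x.v k‖ :=
    forall_of_periodic (n := n) (fun k => by rw [x.norm_edge_add, y.norm_edge_add]) hr
  have h' : ∀ k, ratio y.v k = ratio x.v k := by
    refine forall_of_periodic (n := n) (fun k => by rw [x.ratio_add, y.ratio_add]) fun i => ?_
    rw [ratio_eq_norm_mul_exp (v := y.v) (φ := Complex.arg (ratio y.v (i.val + 1))) rfl,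
      ratio_eq_norm_mul_exp (v := x.v) (φ := Complex.arg (ratio y.v (i.val + 1))) (hφ i), hr', hr']
  obtain ⟨b, hb⟩ := exists_translation (exists_scale_of_ratio x.edge_ne y.edge_ne h')
  have hu : ‖edge y.v 0 / edge x.v 0‖ = 1 := by
    rw [norm_div, hr', div_self (norm_ne_zero_iff.mpr (x.edge_ne 0))]
  exact Quotient.sound ⟨⟨_, mem_sphere_zero_iff_norm.mpr hu⟩, b, hb⟩

end Edges

/-! ### Rotation fields on the three moduli spaces -/

section Charts

variable {n : ℕ} [NeZero n]

/-- A circle element acting on an edge sequence as a similarity of the polygon. -/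
def rotatePolygonT {n : ℕ} (u : Circle) (x : PolygonT n) : PolygonT n where
  v := fun i => u * x.v i
  α := x.α
  ne := fun i h => x.ne i (mul_left_cancel₀ (Circle.coe_ne_zero u) h)
  mono := by
    obtain ⟨b, h⟩ := x.mono
    exact ⟨u * b, fun i => by rw [h]; ring⟩

theorem mk_rotatePolygonT {n : ℕ} (u : Circle) (x : PolygonT n) :
    (Quotient.mk _ (rotatePolygonT u x) : SpaceT n) = Quotient.mk _ x :=
  (Quotient.sound ⟨⟨u, 0, fun i => by simp [rotatePolygonT]⟩, rfl⟩ :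
    (Quotient.mk _ x : SpaceT n) = Quotient.mk _ (rotatePolygonT u x)).symm

theorem edge_rotatePolygonT {n : ℕ} (u : Circle) (x : PolygonT n) (k : ℤ) :
    edge (rotatePolygonT u x).v k = u * edge x.v k := by
  simp only [edge, rotatePolygonT]; ring

theorem exists_parT (z : Fin n → ℂ) (hz : ∀ i, z i ≠ 0) (θ : ℝ) :
    ∃ p : ParT n, p.1.1 = polygonT z hz (Circle.exp θ) ∧ cT n p = (z, θ) :=
  ⟨⟨(polygonT z hz (Circle.exp θ), θ), rfl⟩, rfl,
    Prod.ext (funext fun i => edge_polygonT z hz _ i) rfl⟩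

theorem range_cT : Set.range (cT n) = {v | ∀ i, v.1 i ≠ 0} := by
  ext v
  constructor
  · rintro ⟨p, rfl⟩ i
    exact p.1.1.edge_ne _
  · intro h
    obtain ⟨p, -, hp⟩ := exists_parT v.1 h v.2
    exact ⟨p, hp⟩

theorem isOpen_range_cT : IsOpen (Set.range (cT n)) := by
  rw [range_cT, Set.ofPred_forall]
  exact isOpen_iInter_of_finite fun i =>
    isOpen_ne_fun ((continuous_apply i).comp continuous_fst) continuous_const

theorem surjective_qT {n : ℕ} : Function.Surjective (qT n) := fun X => by
  obtain ⟨x, rfl⟩ := Quotient.exists_rep X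
  exact ⟨⟨(x, Complex.arg x.α), (Circle.exp_arg x.α).symm⟩, rfl⟩

/-- The infinitesimal rotation of the `i`-th entry of a complex vector. -/
def rotField {n : ℕ} (i : Fin n) : (Fin n → ℂ) →L[ℝ] (Fin n → ℂ) :=
  ContinuousLinearMap.pi fun k =>
    if k = i then (Complex.I • ContinuousLinearMap.proj (R := ℝ) (φ := fun _ : Fin n => ℂ) i) else 0

theorem rotField_apply {n : ℕ} (i : Fin n) (z : Fin n → ℂ) :
    rotField i z = Pi.single i (Complex.I * z i) := by
  ext k
  by_cases h : k = i
  · subst h; simp [rotField]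
  · simp [rotField, h]

/-- The infinitesimal rotation of the `i`-th edge, as a field in the coordinates of the double
cover. -/
def rotFieldT {n : ℕ} (i : Fin n) : ((Fin n → ℂ) × ℝ) →L[ℝ] ((Fin n → ℂ) × ℝ) :=
  ((rotField i).comp (ContinuousLinearMap.fst ℝ _ _)).prod 0

theorem rotFieldT_apply {n : ℕ} (i : Fin n) (v : (Fin n → ℂ) × ℝ) :
    rotFieldT i v = (Pi.single i (Complex.I * v.1 i), 0) := by
  rw [rotFieldT, ContinuousLinearMap.prod_apply, ContinuousLinearMap.comp_apply, rotField_apply]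
  rfl

theorem rotField_comm {n : ℕ} (i j : Fin n) (z : Fin n → ℂ) :
    rotField i (rotField j z) = rotField j (rotField i z) := by
  by_cases h : i = j
  · rw [h]
  · simp [rotField_apply, h, Ne.symm h]

theorem rotFieldT_comm {n : ℕ} (i j : Fin n) (v : (Fin n → ℂ) × ℝ) :
    rotFieldT i (rotFieldT j v) = rotFieldT j (rotFieldT i v) :=
  Prod.ext (rotField_comm i j v.1) rfl

/-- The rotations of the edges, on the double cover. -/
def fieldsT (n : ℕ) [NeZero n] : CommutingFields (qT n) (cT n) (Fin n) where
  surj := surjective_qT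
  isOpen := isOpen_range_cT
  W i := rotFieldT i
  smooth i := (rotFieldT i).contDiff
  inv i p p' h := by
    obtain ⟨h1, h2⟩ := Quotient.exact h
    obtain ⟨u, hu⟩ := edge_iso h1
    have h3 : Circle.exp (p'.1.2 - p.1.2) = 1 := by
      rw [Circle.exp_sub, ← p'.2, ← p.2, ← show p.1.1.α = p'.1.1.α from h2, div_self']
    refine ⟨((((u : ℂ) • ContinuousLinearMap.id ℝ (Fin n → ℂ)).comp
      (ContinuousLinearMap.fst ℝ _ _)).prod (ContinuousLinearMap.snd ℝ _ _)),
      (0, p'.1.2 - p.1.2), ?_, ?_, fun p₁ => ?_⟩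
    · refine Prod.ext (funext fun k => ?_) ?_
      · simp [cT, hu]
      · simp [cT]
    · rw [rotFieldT_apply, rotFieldT_apply]
      refine Prod.ext (funext fun k => ?_) rfl
      by_cases hk : k = i
      · subst hk
        simp [cT, hu]
        ring
      · simp [hk]
    · refine ⟨⟨(rotatePolygonT u p₁.1.1, p₁.1.2 + (p'.1.2 - p.1.2)), ?_⟩,
        mk_rotatePolygonT u p₁.1.1, Prod.ext (funext fun k => ?_) ?_⟩
      · rw [Circle.exp_add, h3, mul_one]
        exact p₁.2
      · simp [cT, edge_rotatePolygonT]
      · simp [cT]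
  comm i j v := by
    rw [ContinuousLinearMap.fderiv, ContinuousLinearMap.fderiv, rotFieldT_comm]

/-- The edge vectors of a polygon with side lengths `r` and exterior angles `φ`. -/
def edgesOfAngles {n : ℕ} (r φ : Fin n → ℝ) (i : Fin n) : ℂ :=
  r i * Complex.exp ((∑ k ∈ Finset.Iio i, φ k : ℝ) * Complex.I)

theorem norm_edgesOfAngles {n : ℕ} {r : Fin n → ℝ} (hr : ∀ i, 0 < r i) (φ : Fin n → ℝ) (i : Fin n) :
    ‖edgesOfAngles r φ i‖ = r i := by
  rw [edgesOfAngles, norm_mul, Complex.norm_exp_ofReal_mul_I, mul_one, Complex.norm_real,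
    Real.norm_of_nonneg (hr i).le]

theorem edgesOfAngles_ne_zero {n : ℕ} {r : Fin n → ℝ} (hr : ∀ i, 0 < r i) (φ : Fin n → ℝ) (i : Fin n) :
    edgesOfAngles r φ i ≠ 0 :=
  norm_ne_zero_iff.mp (by rw [norm_edgesOfAngles hr]; exact (hr i).ne')

theorem coe_arg_real_mul_exp {r : ℝ} (hr : 0 < r) (φ : ℝ) :
    (Complex.arg (r * Complex.exp (φ * Complex.I)) : Real.Angle) = φ := by
  rw [Complex.arg_real_mul _ hr, Complex.arg_exp_mul_I, Real.Angle.coe_toIocMod]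

theorem Iio_add_one_of_val_eq {i : Fin n} (h : (((i + 1 : Fin n).val : ℤ) = i.val + 1)) :
    Finset.Iio (i + 1) = insert i (Finset.Iio i) := by
  ext k
  simp only [Finset.mem_Iio, Finset.mem_insert, Fin.lt_def, Fin.ext_iff]
  omega

theorem Iio_add_one_of_val_eq_zero {i : Fin n} (h : ((i + 1 : Fin n).val : ℤ) = 0) :
    Finset.Iio (i + 1) = ∅ :=
  Finset.eq_empty_of_forall_notMem fun k hk => by
    have := Fin.lt_def.mp (Finset.mem_Iio.mp hk)
    omega

theorem univ_eq_insert_Iio {n : ℕ} {i : Fin n} (h : i.val + 1 = n) :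
    (Finset.univ : Finset (Fin n)) = insert i (Finset.Iio i) := by
  refine (Finset.eq_univ_of_forall fun k => ?_).symm
  rw [Finset.mem_insert, Finset.mem_Iio, Fin.lt_def, Fin.ext_iff]
  omega

theorem exists_polygonE {r : Fin n → ℝ} (hr : ∀ i, 0 < r i) (φ : Fin n → ℝ) :
    ∃ x : PolygonE n, (∀ i : Fin n, ‖edge x.v (i.val + 1)‖ = r i) ∧
      ∀ i : Fin n, (φ i : Real.Angle) = extAngle x.v (i.val + 1) := by
  set α := Circle.exp ((∑ k, φ k) / 2)
  set x := polygonT (edgesOfAngles r φ) (edgesOfAngles_ne_zero hr φ) α with hx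
  have he : ∀ i : Fin n, edge x.v (i.val + 1) = edgesOfAngles r φ i := edge_polygonT _ _ _
  refine ⟨x.toE, fun i => ?_, fun i => ?_⟩
  · change ‖edge x.v (i.val + 1)‖ = _
    rw [he, norm_edgesOfAngles hr]
  · have hα : (α : ℂ) ^ 2 = Complex.exp ((∑ k, φ k : ℝ) * Complex.I) := by
      rw [Circle.coe_exp, ← Complex.exp_nat_mul]
      congr 1
      push_cast
      ring
    have hdiv : ∀ (s t u v : ℝ), (s : ℂ) * Complex.exp (u * Complex.I) /
        (t * Complex.exp (v * Complex.I)) = (s / t : ℝ) * Complex.exp ((u - v : ℝ) * Complex.I) := by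
      intro s t u v
      rw [mul_div_mul_comm, ← Complex.exp_sub]
      push_cast
      ring_nf
    have key : ratio x.v (i.val + 1) =
        (r (i + 1) / r i : ℝ) * Complex.exp (φ i * Complex.I) := by
      rw [ratio, x.edge_succ, he, he, show x.α = α from rfl, hα]
      unfold edgesOfAngles
      rcases val_add_one_cases i with h | ⟨h, h'⟩
      · have hlt : i.val + 1 ≠ n := by have := (i + 1 : Fin n).2; omega
        have := Iio_add_one_of_val_eq h
        rw [if_neg hlt, one_mul, hdiv, this, Finset.sum_insert (by simp), add_sub_cancel_right]
      · have h0 := Iio_add_one_of_val_eq_zero h'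
        have := univ_eq_insert_Iio h
        rw [if_pos h, h0, Finset.sum_empty, Complex.ofReal_zero, zero_mul, Complex.exp_zero,
          mul_one, mul_comm, hdiv, this, Finset.sum_insert (by simp), add_sub_cancel_right]
    change (φ i : Real.Angle) = Complex.arg (ratio x.v (i.val + 1))
    rw [key, coe_arg_real_mul_exp (div_pos (hr _) (hr _))]

theorem exists_parE {v : (Fin n → ℝ) × (Fin n → ℝ)} (hr : ∀ i, 0 < v.1 i) :
    ∃ p : ParE n, cE n p = v := by
  obtain ⟨x, h1, h2⟩ := exists_polygonE hr v.2
  exact ⟨⟨(x, v.2), h2⟩, Prod.ext (funext h1) rfl⟩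

theorem range_cE : Set.range (cE n) = {v | ∀ i, 0 < v.1 i} := by
  ext v
  constructor
  · rintro ⟨p, rfl⟩ i
    exact norm_pos_iff.mpr (p.1.1.edge_ne _)
  · exact fun h => exists_parE h

theorem isOpen_range_cE : IsOpen (Set.range (cE n)) := by
  rw [range_cE, Set.ofPred_forall]
  exact isOpen_iInter_of_finite fun i =>
    isOpen_lt continuous_const ((continuous_apply i).comp continuous_fst)

theorem surjective_qE {n : ℕ} : Function.Surjective (qE n) := fun X => by
  obtain ⟨x, rfl⟩ := Quotient.exists_rep X
  exact ⟨⟨(x, fun i => Complex.arg (ratio x.v (i.val + 1))), fun i => rfl⟩, rfl⟩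

theorem qE_eq_of_coords {p p' : ParE n} (hr : (cE n p').1 = (cE n p).1)
    (hφ : ∀ i, (((cE n p').2 i : ℝ) : Real.Angle) = ((cE n p).2 i : ℝ)) : qE n p = qE n p' :=
  mkE_eq_of_coords (fun i => congrFun hr i) fun i => by
    rw [← p.2 i, ← p'.2 i]
    exact hφ i

theorem qE_eq_iff {p p' : ParE n} : qE n p = qE n p' ↔ (cE n p').1 = (cE n p).1 ∧
    ∀ i, (((cE n p').2 i : ℝ) : Real.Angle) = ((cE n p).2 i : ℝ) := by
  refine ⟨fun h => ?_, fun h => qE_eq_of_coords h.1 h.2⟩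
  have h1 : IsoRel p.1.1.v p'.1.1.v := Quotient.exact h
  refine ⟨funext fun i => norm_edge_iso h1 _, fun i => ?_⟩
  exact (p'.2 i).trans ((extAngle_iso h1 _).trans (p.2 i).symm)

/-- The coordinate fields `∂/∂φ_i` on isometry classes. -/
def fieldsE (n : ℕ) [NeZero n] : CommutingFields (qE n) (cE n) (Fin n) where
  surj := surjective_qE
  isOpen := isOpen_range_cE
  W i _ := (0, Pi.single i 1)
  smooth i := contDiff_const
  inv i p p' h := by
    obtain ⟨h1, h2⟩ := qE_eq_iff.mp h
    refine ⟨ContinuousLinearMap.id ℝ _, (0, (cE n p').2 - (cE n p).2), ?_, rfl, fun p₁ => ?_⟩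
    · exact Prod.ext (by simp [h1]) (by simp)
    · refine ⟨⟨(p₁.1.1, p₁.1.2 + ((cE n p').2 - (cE n p).2)), fun i => ?_⟩, rfl, ?_⟩
      · simp only [Pi.add_apply, Pi.sub_apply, Real.Angle.coe_add, Real.Angle.coe_sub, h2, sub_self,
          add_zero]
        exact p₁.2 i
      · exact Prod.ext (by simp [cE]) (by simp [cE])
  comm i j v := by simp

/-- The polygon, closed up to similarity, with the given ratios of consecutive edges. -/
theorem exists_polygonS {y : Fin n → ℂ} (hy : ∀ i, y i ≠ 0) :
    ∃ x : PolygonS n, cS n x = y := by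
  set z : Fin n → ℂ := fun i => ∏ k ∈ Finset.Iio i, y k
  set a : ℂ := ∏ k, y k
  have hz : ∀ i, z i ≠ 0 := fun i => Finset.prod_ne_zero_iff.mpr fun k _ => hy k
  have ha : a ≠ 0 := Finset.prod_ne_zero_iff.mpr fun k _ => hy k
  have hp : ∀ k, edge (vertexOfEdges (extendEdges a z)) (k + n) =
      a * edge (vertexOfEdges (extendEdges a z)) k := fun k => by
    simp only [edge_vertexOfEdges]
    exact extendEdges_add ha z k
  obtain ⟨b, hb⟩ := exists_mono_of_edge hp
  refine ⟨⟨vertexOfEdges (extendEdges a z), ne_of_edge_ne_zero fun k => ?_, a, b, ha, hb⟩,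
    funext fun i => ?_⟩
  · rw [edge_vertexOfEdges]
    exact extendEdges_ne_zero ha hz k
  · change edge _ _ / edge _ _ = _
    rw [edge_vertexOfEdges, edge_vertexOfEdges, extendEdges_val, div_eq_iff (hz i)]
    rcases val_add_one_cases i with h | ⟨h, h'⟩
    · have := Iio_add_one_of_val_eq h
      rw [← h, extendEdges_val]
      change ∏ k ∈ Finset.Iio (i + 1), y k = _
      rw [this, Finset.prod_insert (by simp)]
    · have h0 := Iio_add_one_of_val_eq_zero h'
      have hu := univ_eq_insert_Iio h
      rw [show (i.val : ℤ) + 1 + 1 = ((i + 1 : Fin n).val + 1) + n by omega, extendEdges_add ha,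
        extendEdges_val]
      change (∏ k, y k) * ∏ k ∈ Finset.Iio (i + 1), y k = _
      rw [h0, hu, Finset.prod_insert (by simp), Finset.prod_empty, mul_one]

theorem range_cS : Set.range (cS n) = {y | ∀ i, y i ≠ 0} := by
  ext v
  constructor
  · rintro ⟨x, rfl⟩ i
    exact div_ne_zero (edge_ne_zero x.ne _) (edge_ne_zero x.ne _)
  · exact fun h => exists_polygonS h

theorem isOpen_range_cS : IsOpen (Set.range (cS n)) := by
  rw [range_cS, Set.ofPred_forall]
  exact isOpen_iInter_of_finite fun i => isOpen_ne_fun (continuous_apply i) continuous_const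

theorem cS_eq_of_qS_eq {n : ℕ} {x y : PolygonS n} (h : qS n x = qS n y) : cS n x = cS n y := by
  obtain ⟨a, b, ha, h⟩ := Quotient.exact h
  funext i
  have he : ∀ k, edge y.v k = a * edge x.v k := fun k => by simp only [edge, h]; ring
  change ratio _ _ = ratio _ _
  rw [ratio, ratio, he, he, mul_div_mul_left _ _ ha]

/-- The rotations of the ratios `y_i`, on similarity classes. -/
def fieldsS (n : ℕ) [NeZero n] : CommutingFields (qS n) (cS n) (Fin n) where
  surj := Quotient.exists_rep
  isOpen := isOpen_range_cS
  W i := rotField i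
  smooth i := (rotField i).contDiff
  inv i p p' h := by
    refine ⟨ContinuousLinearMap.id ℝ _, 0, ?_, ?_, fun p₁ => ⟨p₁, rfl, by simp⟩⟩
    · simp [cS_eq_of_qS_eq h]
    · simp [cS_eq_of_qS_eq h]
  comm i j v := by
    rw [ContinuousLinearMap.fderiv, ContinuousLinearMap.fderiv, rotField_comm]

/-- Restriction of a commuting family of fields to an open subset. -/
def CommutingFields.restrict {P M V ι : Type*} [NormedAddCommGroup V] [NormedSpace ℝ V]
    {q : P → M} {c : P → V} (X : CommutingFields q c ι) (D : Set M)
    (hD : IsOpen (Set.range fun p : {p : P // q p ∈ D} => c p.1)) :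
    CommutingFields (fun p : {p : P // q p ∈ D} => (⟨q p.1, p.2⟩ : D)) (fun p => c p.1) ι where
  surj := fun m => by
    obtain ⟨p, hp⟩ := X.surj m.1
    exact ⟨⟨p, by rw [hp]; exact m.2⟩, Subtype.ext hp⟩
  isOpen := hD
  W := X.W
  smooth := X.smooth
  inv i p p' h := by
    obtain ⟨L, b, h1, h2, h3⟩ := X.inv i p.1 p'.1 (congrArg Subtype.val h)
    refine ⟨L, b, h1, h2, fun p₁ => ?_⟩
    obtain ⟨p₂, h4, h5⟩ := h3 p₁.1
    exact ⟨⟨p₂, by rw [h4]; exact p₁.2⟩, Subtype.ext h4, h5⟩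
  comm := X.comm

end Charts

/-! ### The three brackets -/

section Brackets

variable {n : ℕ} [NeZero n]

/-- The structure constants `sign (i - j)` of the bracket of the arguments of the edge vectors. -/
def orderSign {n : ℕ} (i j : Fin n) : ℝ := (if j < i then 1 else 0) - (if i < j then 1 else 0)

theorem orderSign_skew {n : ℕ} (i j : Fin n) : orderSign i j = -orderSign j i := by
  unfold orderSign; ring

theorem cyc_skew (i j : Fin n) : cyc i j = -cyc j i := by
  have h1 : i + 1 = j ↔ j - 1 = i := ⟨fun h => by rw [← h]; simp, fun h => by rw [← h]; simp⟩
  have h2 : j + 1 = i ↔ i - 1 = j := ⟨fun h => by rw [← h]; simp, fun h => by rw [← h]; simp⟩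
  unfold cyc
  simp only [h1, h2]
  ring

/-- The bracket on the double cover. -/
def bracketT (n : ℕ) [NeZero n] : PoissonBracket (smoothT n) :=
  (fieldsT n).poisson orderSign orderSign_skew

/-- The bracket on isometry classes. -/
def bracketE (n : ℕ) [NeZero n] : PoissonBracket (smoothE n) :=
  (fieldsE n).poisson (fun i j => -cyc i j) fun i j => by rw [cyc_skew]

/-- The bracket on similarity classes. -/
def bracketS (n : ℕ) [NeZero n] : PoissonBracket (smoothS n) :=
  (fieldsS n).poisson (fun i j => -cyc i j) fun i j => by rw [cyc_skew]

/-- The derivative of functions on the double cover along the rotation of the `i`-th edge. -/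
def derT (i : Fin n) : Derivation ℝ (smoothT n) (smoothT n) := (fieldsT n).der i

/-- The derivative with respect to the exterior angle `φ_i`. -/
def derE (i : Fin n) : Derivation ℝ (smoothE n) (smoothE n) := (fieldsE n).der i

/-- The derivative with respect to the argument of `y_i`. -/
def derS (i : Fin n) : Derivation ℝ (smoothS n) (smoothS n) := (fieldsS n).der i

theorem derT_apply (i : Fin n) (f : smoothT n) {F : (Fin n → ℂ) × ℝ → ℝ}
    (hF : Represents (qT n) (cT n) F f.1) (p : ParT n) :
    (derT i f).1 (qT n p) = fderiv ℝ F (cT n p) (rotFieldT i (cT n p)) :=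
  (fieldsT n).der_apply i f hF p

theorem derE_apply (i : Fin n) (f : smoothE n) {F : (Fin n → ℝ) × (Fin n → ℝ) → ℝ}
    (hF : Represents (qE n) (cE n) F f.1) (p : ParE n) :
    (derE i f).1 (qE n p) = fderiv ℝ F (cE n p) (0, Pi.single i 1) :=
  (fieldsE n).der_apply i f hF p

theorem derS_apply (i : Fin n) (f : smoothS n) {F : (Fin n → ℂ) → ℝ}
    (hF : Represents (qS n) (cS n) F f.1) (p : PolygonS n) :
    (derS i f).1 (qS n p) = fderiv ℝ F (cS n p) (rotField i (cS n p)) :=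
  (fieldsS n).der_apply i f hF p

theorem derT_eq_of_hasDerivAt {i : Fin n} {f : smoothT n} {F : (Fin n → ℂ) × ℝ → ℝ}
    (hF : Represents (qT n) (cT n) F f.1) {p : ParT n} {γ : ℝ → (Fin n → ℂ) × ℝ}
    (hγ : HasDerivAt γ (rotFieldT i (cT n p)) 0) (h0 : γ 0 = cT n p) {d : ℝ}
    (hd : HasDerivAt (fun s => F (γ s)) d 0) : (derT i f).1 (qT n p) = d :=
  (fieldsT n).der_eq_of_hasDerivAt hF hγ h0 hd

theorem bracketT_apply (f g : smoothT n) (X : SpaceT n) : ((bracketT n).br f g).1 X =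
    ∑ i, ∑ j, orderSign i j * ((derT i f).1 X * (derT j g).1 X) :=
  (fieldsT n).poisson_apply _ _ f g X

theorem bracketE_apply (f g : smoothE n) (X : SpaceE n) : ((bracketE n).br f g).1 X =
    ∑ i, ∑ j, -cyc i j * ((derE i f).1 X * (derE j g).1 X) :=
  (fieldsE n).poisson_apply _ _ f g X

theorem bracketS_apply (f g : smoothS n) (X : SpaceS n) : ((bracketS n).br f g).1 X =
    ∑ i, ∑ j, -cyc i j * ((derS i f).1 X * (derS j g).1 X) :=
  (fieldsS n).poisson_apply _ _ f g X

theorem hasAngleForm_bracketE : HasAngleForm (bracketE n) := fun f g F G hF hG p => by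
  rw [bracketE_apply]
  refine Finset.sum_congr rfl fun i _ => Finset.sum_congr rfl fun j _ => ?_
  rw [derE_apply i f hF, derE_apply j g hG, ← mul_assoc]

/-- In terms of `log y_i`, the cluster bracket is the bracket of the arguments alone. -/
theorem isClusterBracket_bracketS : IsClusterBracket (bracketS n) := fun f g F G hF hG x => by
  rw [bracketS_apply, clusterFormula]
  push_cast
  refine Finset.sum_congr rfl fun i _ => Finset.sum_congr rfl fun j _ => ?_
  have key : ∀ (H : (Fin n → ℂ) → ℝ) (k : Fin n),
      fderiv ℝ H (cS n x) (rotField k (cS n x)) =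
        (cS n x k).re * fderiv ℝ H (cS n x) (Pi.single k Complex.I) -
          (cS n x k).im * fderiv ℝ H (cS n x) (Pi.single k 1) := by
    intro H k
    have h1 : (Pi.single k (Complex.I * cS n x k) : Fin n → ℂ) =
        (cS n x k).re • (Pi.single k Complex.I : Fin n → ℂ) -
          (cS n x k).im • (Pi.single k 1 : Fin n → ℂ) := by
      rw [← Pi.single_smul, ← Pi.single_smul, ← Pi.single_sub]
      congr 1
      apply Complex.ext <;> simp
    rw [rotField_apply, h1, map_sub, map_smul, map_smul, smul_eq_mul, smul_eq_mul]
  rw [derS_apply i f hF, derS_apply j g hG]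
  change -(cyc i j : ℂ) * ((fderiv ℝ F (cS n x) (rotField i (cS n x)) : ℝ) *
    (fderiv ℝ G (cS n x) (rotField j (cS n x)) : ℝ)) = _
  rw [key, key]
  simp only [wirt, wirtBar]
  set yi := cS n x i
  set yj := cS n x j
  generalize fderiv ℝ F (cS n x) (Pi.single i 1) = f1
  generalize fderiv ℝ F (cS n x) (Pi.single i Complex.I) = f2
  generalize fderiv ℝ G (cS n x) (Pi.single j 1) = g1
  generalize fderiv ℝ G (cS n x) (Pi.single j Complex.I) = g2
  apply Complex.ext
  · simp
    ring
  · simp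
    right
    ring

theorem isClusterBracket_unique (B : PoissonBracket (smoothS n)) (hB : IsClusterBracket B) :
    B = bracketS n := by
  ext f g m
  obtain ⟨x, rfl⟩ := (fieldsS n).surj m
  have h1 := hB f g _ _ (CommutingFields.rep_spec f) (CommutingFields.rep_spec g) x
  have h2 := isClusterBracket_bracketS f g _ _ (CommutingFields.rep_spec f)
    (CommutingFields.rep_spec g) x
  exact_mod_cast h1.trans h2.symm

end Brackets

/-! ### Transfer from special quaternionic polynomials -/

section Transfer

variable {n : ℕ}

/-- The linear special polynomial `a + b j t`. -/
def linPoly (a b : ℂ) : Polynomial ℍ[ℝ] :=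
  Polynomial.C (a : ℍ[ℝ]) + Polynomial.C ((b : ℍ[ℝ]) * quatJ) * Polynomial.X

theorem linPoly_coeff_zero (a b : ℂ) : (linPoly a b).coeff 0 = a := by simp [linPoly]

theorem linPoly_coeff_one (a b : ℂ) : (linPoly a b).coeff 1 = (b : ℍ[ℝ]) * quatJ := by
  simp [linPoly]

theorem linPoly_coeff_of_two_le (a b : ℂ) {m : ℕ} (hm : 2 ≤ m) : (linPoly a b).coeff m = 0 := by
  obtain ⟨m, rfl⟩ := Nat.exists_eq_add_of_le' hm
  simp [linPoly]

theorem coeComplex_inj {a b : ℂ} : (a : ℍ[ℝ]) = b ↔ a = b :=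
  ⟨fun h => Complex.ext (congrArg QuaternionAlgebra.re h) (congrArg QuaternionAlgebra.imI h),
    fun h => by rw [h]⟩

theorem norm_coeComplex (z : ℂ) : ‖(z : ℍ[ℝ])‖ = ‖z‖ := by
  rw [← sq_eq_sq₀ (norm_nonneg _) (norm_nonneg _), sq, ← Quaternion.normSq_eq_norm_mul_self,
    ← Complex.normSq_eq_norm_sq, Quaternion.normSq_def']
  simp [Complex.normSq_apply]
  ring

@[simp] theorem quatJ_re : quatJ.re = 0 := rfl

@[simp] theorem quatJ_imI : quatJ.imI = 0 := rfl

@[simp] theorem quatJ_imJ : quatJ.imJ = 1 := rfl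

@[simp] theorem quatJ_imK : quatJ.imK = 0 := rfl

theorem coe_mul_quatJ (b : ℂ) : (b : ℍ[ℝ]) * quatJ = ⟨0, 0, b.re, b.im⟩ := by
  ext <;> simp

theorem quatJ_mul_coe (b : ℂ) : quatJ * (b : ℍ[ℝ]) = ((starRingEnd ℂ b : ℂ) : ℍ[ℝ]) * quatJ := by
  ext <;> simp

theorem linPoly_inj {a b a' b' : ℂ} : linPoly a b = linPoly a' b' ↔ a = a' ∧ b = b' := by
  refine ⟨fun h => ⟨?_, ?_⟩, by rintro ⟨rfl, rfl⟩; rfl⟩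
  · have := congrArg (fun f => Polynomial.coeff f 0) h
    simp only [linPoly_coeff_zero] at this
    exact coeComplex_inj.mp this
  · have := congrArg (fun f => Polynomial.coeff f 1) h
    simp only [linPoly_coeff_one, coe_mul_quatJ] at this
    have h3 := congrArg QuaternionAlgebra.imJ this
    have h4 := congrArg QuaternionAlgebra.imK this
    exact Complex.ext h3 h4

theorem C_mul_linPoly_mul_C (l m a b : ℂ) :
    Polynomial.C (l : ℍ[ℝ]) * linPoly a b * Polynomial.C (m : ℍ[ℝ]) =
      linPoly (l * a * m) (l * b * starRingEnd ℂ m) := by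
  unfold linPoly
  have h1 : Polynomial.C (l : ℍ[ℝ]) * (Polynomial.C ((b : ℍ[ℝ]) * quatJ) * Polynomial.X) *
      Polynomial.C (m : ℍ[ℝ]) =
      Polynomial.C ((l : ℍ[ℝ]) * ((b : ℍ[ℝ]) * quatJ) * m) * Polynomial.X := by
    rw [mul_assoc, mul_assoc, Polynomial.X_mul_C, ← mul_assoc (Polynomial.C _), ← mul_assoc,
      ← Polynomial.C_mul, ← Polynomial.C_mul, mul_assoc]
  rw [mul_add, add_mul, h1, ← Polynomial.C_mul, ← Polynomial.C_mul]
  simp only [Quaternion.coeComplex_mul, mul_assoc, quatJ_mul_coe]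

theorem mem_gaugeSpace_iff {p : Fin n → ℂ × ℂ} : linTuple p ∈ gaugeSpace n ↔
    (∀ i, (p i).1 ≠ 0 ∧ (p i).2 ≠ 0) ∧ ∏ i, ‖(p i).1‖ = 1 := by
  have h0 : ∀ i, (linTuple p i).coeff 0 = ((p i).1 : ℍ[ℝ]) := fun i => linPoly_coeff_zero _ _
  have hc : ∀ z : ℂ, (z : ℍ[ℝ]) = 0 ↔ z = 0 := fun z => by
    rw [← Quaternion.coeComplex_zero, coeComplex_inj]
  have h1 : ∀ i, (linTuple p i).coeff 1 = (⟨0, 0, (p i).2.re, (p i).2.im⟩ : ℍ[ℝ]) := fun i =>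
    (linPoly_coeff_one _ _).trans (coe_mul_quatJ _)
  have h2 : ∀ i m, 2 ≤ m → (linTuple p i).coeff m = 0 := fun i m hm =>
    linPoly_coeff_of_two_le _ _ hm
  simp only [gaugeSpace, Set.mem_ofPred_eq, h0, norm_coeComplex, ne_eq, hc]
  refine and_congr_left fun _ => forall_congr' fun i => ⟨fun h => ⟨h.2.2, fun hb => ?_⟩,
    fun h => ⟨fun m => ?_, ?_, h.1⟩⟩
  · have h3 : (linTuple p i).coeff 1 ≠ 0 := by
      rw [← h.2.1, ← Polynomial.leadingCoeff, ne_eq, Polynomial.leadingCoeff_eq_zero]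
      rintro h4
      simp [h4] at h
    rw [h1, hb] at h3
    exact h3 rfl
  · rcases m with _ | _ | m
    · rw [h0]; simp
    · rw [h1]; simp
    · rw [h2 i _ (by omega)]; simp
  · refine le_antisymm (Polynomial.natDegree_le_iff_coeff_eq_zero.mpr fun m hm => h2 i m hm) ?_
    refine Polynomial.le_natDegree_of_ne_zero fun h3 => h.2 ?_
    rw [h1] at h3
    exact Complex.ext (congrArg QuaternionAlgebra.imJ h3) (congrArg QuaternionAlgebra.imK h3)

/-- The constant coefficients of `gaugeSection x`. -/
def sectionConst (x : PolygonT n) (i : Fin n) : ℂ := if i.val + 1 = n then (x.α : ℂ) else 1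

theorem sectionConst_ne_zero (x : PolygonT n) (i : Fin n) : sectionConst x i ≠ 0 := by
  unfold sectionConst
  split_ifs
  · exact Circle.coe_ne_zero _
  · exact one_ne_zero

theorem gaugeSection_eq_linPoly (x : PolygonT n) (i : Fin n) : gaugeSection x i =
    linPoly (sectionConst x i) (edge x.v (i.val + 1) * starRingEnd ℂ (sectionConst x i)) := by
  have h1 : (1 + Polynomial.C ((edge x.v (i.val + 1) : ℍ[ℝ]) * quatJ) * Polynomial.X) =
      linPoly 1 (edge x.v (i.val + 1)) := by
    rw [linPoly, Quaternion.coeComplex_one, Polynomial.C_1]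
  have h2 : (if i.val + 1 = n then Polynomial.C ((x.α : ℂ) : ℍ[ℝ]) else 1) =
      Polynomial.C ((sectionConst x i : ℂ) : ℍ[ℝ]) := by
    unfold sectionConst
    split_ifs
    · rfl
    · rw [Quaternion.coeComplex_one, Polynomial.C_1]
  have h3 := C_mul_linPoly_mul_C 1 (sectionConst x i) 1 (edge x.v (i.val + 1))
  rw [Quaternion.coeComplex_one, Polynomial.C_1, one_mul, one_mul, one_mul, one_mul] at h3
  rw [gaugeSection, h1, h2, h3]

/-- The product `a_1 ⋯ a_{i-1}` of the preceding constant coefficients. -/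
def partialProd (p : Fin n → ℂ × ℂ) (i : Fin n) : ℂ := ∏ k ∈ Finset.Iio i, (p k).1

/-- The edge vectors of the polygon attached to a tuple of linear special polynomials. -/
def gaugeEdge (p : Fin n → ℂ × ℂ) (i : Fin n) : ℂ :=
  partialProd p i * (p i).2 / starRingEnd ℂ (partialProd p i * (p i).1)

theorem partialProd_ne_zero {p : Fin n → ℂ × ℂ} (hp : ∀ i, (p i).1 ≠ 0 ∧ (p i).2 ≠ 0) (i : Fin n) :
    partialProd p i ≠ 0 := Finset.prod_ne_zero_iff.mpr fun k _ => (hp k).1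

theorem gaugeEdge_ne_zero {p : Fin n → ℂ × ℂ} (hp : ∀ i, (p i).1 ≠ 0 ∧ (p i).2 ≠ 0) (i : Fin n) :
    gaugeEdge p i ≠ 0 :=
  div_ne_zero (mul_ne_zero (partialProd_ne_zero hp i) (hp i).2)
    ((map_ne_zero _).mpr (mul_ne_zero (partialProd_ne_zero hp i) (hp i).1))

variable [NeZero n]

theorem gaugeEquiv_iff_exists {p : Fin n → ℂ × ℂ} {x : PolygonT n} :
    GaugeEquiv (linTuple p) (gaugeSection x) ↔ ∃ l : Fin n → ℂˣ, ∀ i,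
      (l (i + 1) : ℂ) * sectionConst x i = l i * (p i).1 ∧
      starRingEnd ℂ (l (i + 1) : ℂ) * (edge x.v (i.val + 1) * starRingEnd ℂ (sectionConst x i)) =
        l i * (p i).2 := by
  refine exists_congr fun l => forall_congr' fun i => ?_
  have h1 : linTuple p i = linPoly (p i).1 (p i).2 := rfl
  have h2 : (starRingEnd ℂ (l (i + 1) : ℂ)) ≠ 0 := (map_ne_zero _).mpr (l (i + 1)).ne_zero
  rw [gaugeSection_eq_linPoly, h1, C_mul_linPoly_mul_C, linPoly_inj, Units.val_inv_eq_inv_val,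
    map_inv₀, ← div_eq_mul_inv, ← div_eq_mul_inv, eq_div_iff (l (i + 1)).ne_zero, eq_div_iff h2,
    mul_comm (sectionConst x i), mul_comm (starRingEnd ℂ (l (i + 1) : ℂ))]

theorem partialProd_succ {p : Fin n → ℂ × ℂ} (i : Fin n) :
    (i.val + 1 ≠ n ∧ partialProd p (i + 1) = partialProd p i * (p i).1) ∨
    (i.val + 1 = n ∧ partialProd p (i + 1) = 1 ∧ ∏ k, (p k).1 = partialProd p i * (p i).1) := by
  rcases val_add_one_cases i with h | ⟨h, h'⟩
  · left
    refine ⟨by have := (i + 1 : Fin n).2; omega, ?_⟩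
    rw [partialProd, Iio_add_one_of_val_eq h, Finset.prod_insert (by simp), mul_comm, partialProd]
  · right
    refine ⟨h, ?_, ?_⟩
    · rw [partialProd, Iio_add_one_of_val_eq_zero h', Finset.prod_empty]
    · rw [univ_eq_insert_Iio h, Finset.prod_insert (by simp), mul_comm, partialProd]

/-- The identification of the gauge classes with the double cover, in coordinates. -/
theorem gaugeEquiv_iff {p : Fin n → ℂ × ℂ} (hp : ∀ i, (p i).1 ≠ 0 ∧ (p i).2 ≠ 0)
    {x : PolygonT n} : GaugeEquiv (linTuple p) (gaugeSection x) ↔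
      (x.α : ℂ) = ∏ i, (p i).1 ∧
        ∃ u : Circle, ∀ i : Fin n, edge x.v (i.val + 1) = u * gaugeEdge p i := by
  rw [gaugeEquiv_iff_exists]
  have hlast : ∃ i : Fin n, i.val + 1 = n :=
    ⟨⟨n - 1, Nat.sub_lt (Nat.pos_of_ne_zero (NeZero.ne n)) one_pos⟩,
      Nat.sub_add_cancel (Nat.pos_of_ne_zero (NeZero.ne n))⟩
  constructor
  · rintro ⟨l, hl⟩
    have h1 : ∀ (k : ℕ) (hk : k < n), (l ⟨k, hk⟩ : ℂ) = l 0 * partialProd p ⟨k, hk⟩ := by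
      intro k
      induction k with
      | zero =>
        intro hk
        have : Finset.Iio (⟨0, hk⟩ : Fin n) = ∅ :=
          Finset.eq_empty_of_forall_notMem fun k hk => by
            have := Fin.lt_def.mp (Finset.mem_Iio.mp hk)
            simp at this
        rw [partialProd, this, Finset.prod_empty, mul_one]
        rfl
      | succ k ih =>
        intro hk
        have hk' : k < n := by omega
        have h2 : (⟨k, hk'⟩ : Fin n) + 1 = ⟨k + 1, hk⟩ := by
          ext
          rw [Fin.val_add, Fin.val_one', Nat.add_mod_mod, Nat.mod_eq_of_lt hk]
        have h3 := (hl ⟨k, hk'⟩).1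
        rw [sectionConst, if_neg (by simp; omega), mul_one, h2, ih hk'] at h3
        rcases partialProd_succ (p := p) ⟨k, hk'⟩ with h4 | h4
        · rw [h3, ← h2, h4.2, mul_assoc]
        · simp at h4; omega
    have h1' : ∀ i, (l i : ℂ) = l 0 * partialProd p i := fun i => h1 i.1 i.2
    have h0 : (l 0 : ℂ) ≠ 0 := (l 0).ne_zero
    have h0' : starRingEnd ℂ (l 0 : ℂ) ≠ 0 := (map_ne_zero _).mpr h0
    refine ⟨?_, ⟨(l 0 : ℂ) / starRingEnd ℂ (l 0 : ℂ),
      mem_sphere_zero_iff_norm.mpr ?_⟩, fun i => ?_⟩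
    · obtain ⟨i, hi⟩ := hlast
      have h2 := (hl i).1
      rw [sectionConst, if_pos hi, h1' i, h1' (i + 1)] at h2
      rcases partialProd_succ (p := p) i with h3 | ⟨-, h3, h4⟩
      · exact absurd hi h3.1
      · rw [h3, mul_one, mul_assoc] at h2
        rw [h4]
        exact mul_left_cancel₀ h0 h2
    · rw [norm_div, Complex.norm_conj, div_self (norm_ne_zero_iff.mpr h0)]
    · obtain ⟨h2, h3⟩ := hl i
      have hA := partialProd_ne_zero hp i
      have ha := (hp i).1
      have h4 : starRingEnd ℂ (partialProd p i * (p i).1) ≠ 0 :=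
        (map_ne_zero _).mpr (mul_ne_zero hA ha)
      have h5 := congrArg (starRingEnd ℂ) h2
      rw [h1' i, map_mul, mul_assoc, map_mul] at h5
      rw [h1' i] at h3
      rw [gaugeEdge]
      change edge x.v (i.val + 1) = (l 0 : ℂ) / starRingEnd ℂ (l 0 : ℂ) * _
      rw [div_mul_div_comm, eq_div_iff (mul_ne_zero h0' h4)]
      linear_combination h3 - edge x.v (i.val + 1) * h5
  · rintro ⟨hα, u, hu⟩
    set τ := Complex.arg u
    have hut : (u : ℂ) * starRingEnd ℂ (Circle.exp (τ / 2) : ℂ) =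
        (Circle.exp (τ / 2) : ℂ) := by
      have h1 : u = Circle.exp (τ / 2) * Circle.exp (τ / 2) := by
        rw [← Circle.exp_add, add_halves, Circle.exp_arg]
      rw [h1, Circle.coe_mul, mul_assoc, Complex.mul_conj, Circle.normSq_coe, Complex.ofReal_one,
        mul_one]
    set w : ℂ := (Circle.exp (τ / 2) : ℂ)
    have hw : w ≠ 0 := Circle.coe_ne_zero _
    refine ⟨fun i => Units.mk0 (w * partialProd p i) (mul_ne_zero hw (partialProd_ne_zero hp i)),
      fun i => ?_⟩
    have h1 : w * partialProd p (i + 1) * sectionConst x i = w * partialProd p i * (p i).1 := by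
      rcases partialProd_succ (p := p) i with ⟨h, h2⟩ | ⟨h, h2, h3⟩
      · rw [sectionConst, if_neg h, h2]; ring
      · rw [sectionConst, if_pos h, h2, hα, h3]; ring
    refine ⟨h1, ?_⟩
    have h2 := congrArg (starRingEnd ℂ) h1
    have h4 : starRingEnd ℂ (partialProd p i * (p i).1) ≠ 0 :=
      (map_ne_zero _).mpr (mul_ne_zero (partialProd_ne_zero hp i) (hp i).1)
    rw [mul_assoc w (partialProd p i), map_mul _ w (partialProd p i * (p i).1), map_mul] at h2
    have h5 : edge x.v (i.val + 1) * starRingEnd ℂ (partialProd p i * (p i).1) =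
        u * (partialProd p i * (p i).2) := by
      rw [hu, gaugeEdge, mul_assoc, div_mul_cancel₀ _ h4]
    simp only [Units.val_mk0]
    linear_combination edge x.v (i.val + 1) * h2 + starRingEnd ℂ w * h5 +
      partialProd p i * (p i).2 * hut

theorem prod_eq_exp_arg {a : ℂ} (ha : ‖a‖ = 1) (θ : ℝ) :
    (Circle.exp (θ + Complex.arg (a / Circle.exp θ)) : ℂ) = a := by
  have h1 : ‖a / Circle.exp θ‖ = 1 := by rw [norm_div, ha, Circle.norm_coe, div_one]
  have h2 : (Circle.exp (Complex.arg (a / Circle.exp θ)) : ℂ) = a / Circle.exp θ := by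
    have := Complex.norm_mul_exp_arg_mul_I (a / Circle.exp θ)
    rw [h1, Complex.ofReal_one, one_mul] at this
    rw [Circle.coe_exp, this]
  rw [Circle.exp_add, Circle.coe_mul, h2, mul_div_cancel₀ _ (Circle.coe_ne_zero _)]

/-- The coordinates of the polygon attached to a tuple of polynomials, the argument of `α` being
taken near `θ`. -/
def gaugeCoord {n : ℕ} (θ : ℝ) (p : Fin n → ℂ × ℂ) : (Fin n → ℂ) × ℝ :=
  (gaugeEdge p, θ + Complex.arg ((∏ i, (p i).1) / Circle.exp θ))

theorem contDiffAt_gaugeCoord {n : ℕ} {p : Fin n → ℂ × ℂ} (hp : ∀ i, (p i).1 ≠ 0 ∧ (p i).2 ≠ 0) {θ : ℝ}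
    (hθ : ∏ i, (p i).1 = Circle.exp θ) : ContDiffAt ℝ ∞ (gaugeCoord (n := n) θ) p := by
  have hfst : ∀ k, ContDiff ℝ ∞ fun p : Fin n → ℂ × ℂ => (p k).1 := fun k =>
    contDiff_fst.comp (contDiff_apply ℝ (ℂ × ℂ) k)
  have hsnd : ∀ k, ContDiff ℝ ∞ fun p : Fin n → ℂ × ℂ => (p k).2 := fun k =>
    contDiff_snd.comp (contDiff_apply ℝ (ℂ × ℂ) k)
  have hprod : ∀ s : Finset (Fin n), ContDiff ℝ ∞ fun p : Fin n → ℂ × ℂ => ∏ k ∈ s, (p k).1 :=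
    fun s => contDiff_prod fun k _ => hfst k
  refine ContDiffAt.prodMk (contDiffAt_pi.mpr fun i => ?_) (contDiffAt_const.add ?_)
  · simp only [gaugeEdge, partialProd, div_eq_mul_inv]
    refine ContDiffAt.mul ((hprod _).mul (hsnd i)).contDiffAt (ContDiffAt.fun_inv ?_ ?_)
    · exact (Complex.conjCLE.contDiff.comp ((hprod _).mul (hfst i))).contDiffAt
    · exact (map_ne_zero _).mpr (mul_ne_zero (partialProd_ne_zero hp i) (hp i).1)
  · have h1 : ContDiffAt ℝ ∞ (fun p : Fin n → ℂ × ℂ => (∏ i, (p i).1) / (Circle.exp θ : ℂ)) p := by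
      simp only [div_eq_mul_inv]
      exact ((hprod _).mul contDiff_const).contDiffAt
    have h2 : ContDiffAt ℝ ∞ Complex.log ((∏ i, (p i).1) / (Circle.exp θ : ℂ)) := by
      rw [hθ, div_self (Circle.coe_ne_zero _)]
      exact (Complex.contDiffAt_log Complex.one_mem_slitPlane).restrict_scalars ℝ
    have h3 := Complex.imCLM.contDiff.contDiffAt.comp p (h2.comp p h1)
    simpa [Function.comp_def, Complex.log_im] using h3

/-- Every smooth function on the double cover has a local pull-back. -/
theorem isLocalPullback_gaugeCoord {f : SpaceT n → ℝ} {F : (Fin n → ℂ) × ℝ → ℝ}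
    (hF : Represents (qT n) (cT n) F f) {p : Fin n → ℂ × ℂ}
    (hp : ∀ i, (p i).1 ≠ 0 ∧ (p i).2 ≠ 0) {θ : ℝ} (hθ : ∏ i, (p i).1 = Circle.exp θ) :
    IsLocalPullback f p (F ∘ gaugeCoord θ) := by
  constructor
  · refine ContDiffAt.comp p (hF.1.contDiffAt (isOpen_range_cT.mem_nhds ?_))
      (contDiffAt_gaugeCoord hp hθ)
    rw [range_cT]
    exact gaugeEdge_ne_zero hp
  · refine Filter.Eventually.of_forall fun p' hp' x hx => ?_
    obtain ⟨h1, h2⟩ := mem_gaugeSpace_iff.mp hp'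
    obtain ⟨h3, u, h4⟩ := (gaugeEquiv_iff h1).mp hx
    obtain ⟨y, hy, hyc⟩ := exists_parT (gaugeEdge p') (gaugeEdge_ne_zero h1)
      (gaugeCoord θ p').2
    change F (gaugeCoord θ p') = _
    rw [show gaugeCoord θ p' = cT n y from hyc.symm, ← hF.2]
    congr 1
    refine mkT_eq_of_edges ?_ u fun i => ?_
    · ext
      rw [h3, hy]
      exact prod_eq_exp_arg (by rw [norm_prod, h2]) θ
    · rw [h4, hy, edge_polygonT]

/-! ### Derivatives along simultaneous rotations -/

/-- The curve that rotates `z_k` with speed `w_k` and moves `θ` with speed `m`. -/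
def rotCurve {n : ℕ} (w : Fin n → ℝ) (m : ℝ) (v : (Fin n → ℂ) × ℝ) (s : ℝ) : (Fin n → ℂ) × ℝ :=
  (fun k => Complex.exp ((w k * s : ℝ) * Complex.I) * v.1 k, v.2 + m * s)

theorem rotCurve_zero {n : ℕ} (w : Fin n → ℝ) (m : ℝ) (v : (Fin n → ℂ) × ℝ) : rotCurve w m v 0 = v := by
  simp [rotCurve]

theorem hasDerivAt_exp_mul (w : ℝ) (z : ℂ) :
    HasDerivAt (fun s : ℝ => Complex.exp ((w * s : ℝ) * Complex.I) * z) (w * (Complex.I * z)) 0 := by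
  have h1 : HasDerivAt (fun s : ℝ => ((w * s : ℝ) : ℂ) * Complex.I) (w * Complex.I) 0 := by
    have : HasDerivAt (fun s : ℝ => w * s) w 0 := by
      simpa using (hasDerivAt_id (0 : ℝ)).const_mul w
    exact this.ofReal_comp.mul_const Complex.I
  refine ((h1.cexp).mul_const z).congr_deriv ?_
  rw [mul_zero, Complex.ofReal_zero, zero_mul, Complex.exp_zero]
  ring

theorem hasDerivAt_rotCurve {n : ℕ} (w : Fin n → ℝ) (m : ℝ) (v : (Fin n → ℂ) × ℝ) :
    HasDerivAt (rotCurve w m v) (∑ k, w k • rotFieldT k v + m • (0, 1)) 0 := by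
  have h1 : HasDerivAt (rotCurve w m v) (fun k => w k * (Complex.I * v.1 k), m) 0 := by
    refine HasDerivAt.prodMk (hasDerivAt_pi.mpr fun k => hasDerivAt_exp_mul (w k) (v.1 k)) ?_
    simpa using ((hasDerivAt_id (0 : ℝ)).const_mul m).const_add v.2
  convert h1 using 1
  refine Prod.ext (funext fun k => ?_) ?_
  · simp [rotFieldT_apply, Prod.fst_sum, Finset.sum_apply, Pi.single_apply]
  · simp [rotFieldT_apply, Prod.snd_sum]

theorem hasDerivAt_comp_rotCurve {f : smoothT n} {F : (Fin n → ℂ) × ℝ → ℝ}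
    (hF : Represents (qT n) (cT n) F f.1) (p : ParT n) (w : Fin n → ℝ) (m : ℝ) :
    HasDerivAt (fun s => F (rotCurve w m (cT n p) s))
      (∑ k, w k * (derT k f).1 (qT n p) + m * fderiv ℝ F (cT n p) (0, 1)) 0 := by
  have h1 : HasFDerivAt F (fderiv ℝ F (cT n p)) (rotCurve w m (cT n p) 0) := by
    rw [rotCurve_zero]
    exact (hF.differentiableAt isOpen_range_cT p).hasFDerivAt
  have h2 := h1.comp_hasDerivAt 0 (hasDerivAt_rotCurve w m (cT n p))
  rw [map_add, map_sum, map_smul] at h2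
  simp only [map_smul, smul_eq_mul] at h2
  simp only [derT_apply _ f hF]
  exact h2

/-- The derivatives along the rotations of the individual edges add up to the derivative along a
rotation of the whole polygon, which is zero. -/
theorem sum_der_eq_zero (f : smoothT n) (X : SpaceT n) :
    ∑ k, (derT k f).1 X = 0 := by
  obtain ⟨p, rfl⟩ := (fieldsT n).surj X
  obtain ⟨F, hF⟩ := f.2
  have h1 := hasDerivAt_comp_rotCurve hF p (fun _ => 1) 0
  have h2 : (fun s => F (rotCurve (fun _ => 1) 0 (cT n p) s)) = fun _ => F (cT n p) := by
    funext s
    let p' : ParT n := ⟨(rotatePolygonT (Circle.exp s) p.1.1, p.1.2), p.2⟩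
    have : rotCurve (fun _ => 1) 0 (cT n p) s = cT n p' := by
      refine Prod.ext (funext fun k => ?_) (by simp [rotCurve, cT, p'])
      simp [rotCurve, cT, p', edge_rotatePolygonT, Circle.coe_exp]
    rw [this, ← hF.2, ← hF.2]
    exact congrArg f.1 (mk_rotatePolygonT _ _)
  rw [h2] at h1
  have h3 := h1.unique (hasDerivAt_const 0 (F (cT n p)))
  simpa using h3

end Transfer

section Transfer

variable {n : ℕ}

/-- The curve that rotates `a_k` with speed `μ_k` and `b_k` with speed `ν_k`. -/
def gaugeCurve (μ ν : Fin n → ℝ) (p : Fin n → ℂ × ℂ) (s : ℝ) : Fin n → ℂ × ℂ := fun k =>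
  (Complex.exp ((μ k * s : ℝ) * Complex.I) * (p k).1,
    Complex.exp ((ν k * s : ℝ) * Complex.I) * (p k).2)

theorem gaugeCurve_zero (μ ν : Fin n → ℝ) (p : Fin n → ℂ × ℂ) : gaugeCurve μ ν p 0 = p := by
  funext k
  simp [gaugeCurve]

theorem hasDerivAt_gaugeCurve (μ ν : Fin n → ℝ) (p : Fin n → ℂ × ℂ) :
    HasDerivAt (gaugeCurve μ ν p)
      (fun k => (μ k * (Complex.I * (p k).1), ν k * (Complex.I * (p k).2))) 0 :=
  hasDerivAt_pi.mpr fun k =>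
    (hasDerivAt_exp_mul (μ k) (p k).1).prodMk (hasDerivAt_exp_mul (ν k) (p k).2)

/-- The speed of the argument of `z_k` along `gaugeCurve μ ν`. -/
def edgeSpeed (μ ν : Fin n → ℝ) (k : Fin n) : ℝ := ν k + μ k + 2 * ∑ l ∈ Finset.Iio k, μ l

theorem prod_gaugeCurve (μ ν : Fin n → ℝ) (p : Fin n → ℂ × ℂ) (s : ℝ) (t : Finset (Fin n)) :
    ∏ k ∈ t, (gaugeCurve μ ν p s k).1 =
      Complex.exp (((∑ k ∈ t, μ k) * s : ℝ) * Complex.I) * ∏ k ∈ t, (p k).1 := by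
  simp only [gaugeCurve]
  rw [Finset.prod_mul_distrib, ← Complex.exp_sum, ← Finset.sum_mul, ← Complex.ofReal_sum,
    ← Finset.sum_mul]

theorem conj_exp_mul_I (t : ℝ) :
    starRingEnd ℂ (Complex.exp (t * Complex.I)) = Complex.exp (-(t * Complex.I)) := by
  rw [← Complex.exp_conj, map_mul, Complex.conj_I, Complex.conj_ofReal, mul_neg]

/-- Rotating the coefficients of the polynomials rotates the edges of the polygon. -/
theorem gaugeEdge_gaugeCurve (μ ν : Fin n → ℝ) (p : Fin n → ℂ × ℂ) (s : ℝ) (k : Fin n) :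
    gaugeEdge (gaugeCurve μ ν p s) k =
      Complex.exp ((edgeSpeed μ ν k * s : ℝ) * Complex.I) * gaugeEdge p k := by
  have h1 := prod_gaugeCurve μ ν p s (Finset.Iio k)
  have h2 : partialProd (gaugeCurve μ ν p s) k =
      Complex.exp (((∑ l ∈ Finset.Iio k, μ l) * s : ℝ) * Complex.I) * partialProd p k := h1
  rw [gaugeEdge, gaugeEdge, h2]
  simp only [gaugeCurve, map_mul, conj_exp_mul_I, Complex.exp_neg]
  have h3 : ((edgeSpeed μ ν k * s : ℝ) : ℂ) * Complex.I =
      ((∑ l ∈ Finset.Iio k, μ l) * s : ℝ) * Complex.I + ((∑ l ∈ Finset.Iio k, μ l) * s : ℝ) * Complex.I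
        + (μ k * s : ℝ) * Complex.I + (ν k * s : ℝ) * Complex.I := by
    rw [edgeSpeed]; push_cast; ring
  rw [h3, Complex.exp_add, Complex.exp_add, Complex.exp_add]
  have e1 := Complex.exp_ne_zero (((∑ l ∈ Finset.Iio k, μ l) * s : ℝ) * Complex.I)
  have e2 := Complex.exp_ne_zero ((μ k * s : ℝ) * Complex.I)
  rw [div_eq_mul_inv, div_eq_mul_inv, mul_inv, mul_inv, mul_inv, inv_inv, inv_inv, mul_inv]
  ring

theorem gaugeCurve_mem {μ ν : Fin n → ℝ} {p : Fin n → ℂ × ℂ} (hp : linTuple p ∈ gaugeSpace n)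
    (s : ℝ) : linTuple (gaugeCurve μ ν p s) ∈ gaugeSpace n := by
  rw [mem_gaugeSpace_iff] at hp ⊢
  refine ⟨fun i => ⟨mul_ne_zero (Complex.exp_ne_zero _) (hp.1 i).1,
    mul_ne_zero (Complex.exp_ne_zero _) (hp.1 i).2⟩, ?_⟩
  rw [← hp.2]
  refine Finset.prod_congr rfl fun i _ => ?_
  rw [gaugeCurve, norm_mul, Complex.norm_exp_ofReal_mul_I, one_mul]

variable [NeZero n]

/-- The derivatives of a local pull-back in the directions tangent to the rotations of the
coefficients. -/
theorem fderiv_pullback {f : smoothT n} {F : (Fin n → ℂ) × ℝ → ℝ}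
    (hF : Represents (qT n) (cT n) F f.1) {p : Fin n → ℂ × ℂ} (hp : linTuple p ∈ gaugeSpace n)
    {Φ : (Fin n → ℂ × ℂ) → ℝ} (hΦ : IsLocalPullback f.1 p Φ) (x : ParT n)
    (hx : GaugeEquiv (linTuple p) (gaugeSection x.1.1)) (μ ν : Fin n → ℝ) :
    fderiv ℝ Φ p (fun k => (μ k * (Complex.I * (p k).1), ν k * (Complex.I * (p k).2))) =
      ∑ k, edgeSpeed μ ν k * (derT k f).1 (qT n x) +
        (∑ k, μ k) * fderiv ℝ F (cT n x) (0, 1) := by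
  have h0 : HasFDerivAt Φ (fderiv ℝ Φ p) (gaugeCurve μ ν p 0) := by
    rw [gaugeCurve_zero]
    exact (hΦ.1.differentiableAt (by simp)).hasFDerivAt
  have h1 := h0.comp_hasDerivAt 0 (hasDerivAt_gaugeCurve μ ν p)
  have h2 := hasDerivAt_comp_rotCurve hF x (edgeSpeed μ ν) (∑ k, μ k)
  refine h1.unique (h2.congr_of_eventuallyEq ?_)
  have h3 : Filter.Tendsto (gaugeCurve μ ν p) (nhds 0) (nhds p) := by
    have := (hasDerivAt_gaugeCurve μ ν p).continuousAt.tendsto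
    rwa [gaugeCurve_zero] at this
  filter_upwards [h3.eventually hΦ.2] with s hs
  obtain ⟨hne, -⟩ := mem_gaugeSpace_iff.mp hp
  obtain ⟨hα, u, hu⟩ := (gaugeEquiv_iff hne).mp hx
  have hne' := (mem_gaugeSpace_iff.mp (gaugeCurve_mem (μ := μ) (ν := ν) hp s)).1
  have hz : ∀ k, (rotCurve (edgeSpeed μ ν) (∑ k, μ k) (cT n x) s).1 k ≠ 0 := fun k =>
    mul_ne_zero (Complex.exp_ne_zero _) (x.1.1.edge_ne _)
  obtain ⟨y, hy, hyc⟩ := exists_parT _ hz (rotCurve (edgeSpeed μ ν) (∑ k, μ k) (cT n x) s).2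
  have hyα : y.1.1.α = Circle.exp ((∑ k, μ k) * s) * x.1.1.α := by
    rw [hy, x.2, ← Circle.exp_add, add_comm]
    rfl
  change Φ (gaugeCurve μ ν p s) = F (rotCurve (edgeSpeed μ ν) (∑ k, μ k) (cT n x) s)
  rw [show rotCurve (edgeSpeed μ ν) (∑ k, μ k) (cT n x) s = cT n y from hyc.symm, ← hF.2]
  refine hs (gaugeCurve_mem hp s) y.1.1 ((gaugeEquiv_iff hne').mpr ⟨?_, u, fun i => ?_⟩)
  · rw [hyα, Circle.coe_mul, hα, prod_gaugeCurve, Circle.coe_exp]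
  · rw [gaugeEdge_gaugeCurve, hy, edge_polygonT]
    change Complex.exp _ * edge x.1.1.v (i.val + 1) = _
    rw [hu]
    ring

/-- The bracket of special linear polynomials only involves the rotations of the coefficients. -/
theorem linBracket_eq {n : ℕ} (Φ Ψ : (Fin n → ℂ × ℂ) → ℝ) (p : Fin n → ℂ × ℂ) :
    linBracket Φ Ψ p = ((∑ i, (1 / 2 : ℝ) *
      (fderiv ℝ Φ p (Pi.single i (Complex.I * (p i).1, 0)) *
          fderiv ℝ Ψ p (Pi.single i (0, Complex.I * (p i).2)) -
        fderiv ℝ Φ p (Pi.single i (0, Complex.I * (p i).2)) *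
          fderiv ℝ Ψ p (Pi.single i (Complex.I * (p i).1, 0))) : ℝ) : ℂ) := by
  rw [linBracket]
  push_cast
  refine Finset.sum_congr rfl fun i _ => ?_
  have key1 : ∀ H : (Fin n → ℂ × ℂ) → ℝ, fderiv ℝ H p (Pi.single i (Complex.I * (p i).1, 0)) =
      (p i).1.re * fderiv ℝ H p (Pi.single i (Complex.I, 0)) -
        (p i).1.im * fderiv ℝ H p (Pi.single i (1, 0)) := by
    intro H
    have h1 : (Pi.single i (Complex.I * (p i).1, 0) : Fin n → ℂ × ℂ) =
        (p i).1.re • (Pi.single i (Complex.I, 0) : Fin n → ℂ × ℂ) -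
          (p i).1.im • (Pi.single i (1, 0) : Fin n → ℂ × ℂ) := by
      rw [← Pi.single_smul, ← Pi.single_smul, ← Pi.single_sub]
      congr 1
      refine Prod.ext ?_ (by simp)
      apply Complex.ext <;> simp
    rw [h1, map_sub, map_smul, map_smul, smul_eq_mul, smul_eq_mul]
  have key2 : ∀ H : (Fin n → ℂ × ℂ) → ℝ, fderiv ℝ H p (Pi.single i (0, Complex.I * (p i).2)) =
      (p i).2.re * fderiv ℝ H p (Pi.single i (0, Complex.I)) -
        (p i).2.im * fderiv ℝ H p (Pi.single i (0, 1)) := by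
    intro H
    have h1 : (Pi.single i (0, Complex.I * (p i).2) : Fin n → ℂ × ℂ) =
        (p i).2.re • (Pi.single i (0, Complex.I) : Fin n → ℂ × ℂ) -
          (p i).2.im • (Pi.single i (0, 1) : Fin n → ℂ × ℂ) := by
      rw [← Pi.single_smul, ← Pi.single_smul, ← Pi.single_sub]
      congr 1
      refine Prod.ext (by simp) ?_
      apply Complex.ext <;> simp
    rw [h1, map_sub, map_smul, map_smul, smul_eq_mul, smul_eq_mul]
  rw [key1, key1, key2, key2]
  simp only [wirt, wirtBar]
  set a := (p i).1
  set b := (p i).2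
  generalize fderiv ℝ Φ p (Pi.single i (1, 0)) = f1
  generalize fderiv ℝ Φ p (Pi.single i (Complex.I, 0)) = f2
  generalize fderiv ℝ Φ p (Pi.single i (0, 1)) = f3
  generalize fderiv ℝ Φ p (Pi.single i (0, Complex.I)) = f4
  generalize fderiv ℝ Ψ p (Pi.single i (1, 0)) = g1
  generalize fderiv ℝ Ψ p (Pi.single i (Complex.I, 0)) = g2
  generalize fderiv ℝ Ψ p (Pi.single i (0, 1)) = g3
  generalize fderiv ℝ Ψ p (Pi.single i (0, Complex.I)) = g4
  have ha : a = a.re + a.im * Complex.I := (Complex.re_add_im a).symm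
  have hb : b = b.re + b.im * Complex.I := (Complex.re_add_im b).symm
  have ha' : starRingEnd ℂ a = a.re - a.im * Complex.I := by
    apply Complex.ext <;> simp
  have hb' : starRingEnd ℂ b = b.re - b.im * Complex.I := by
    apply Complex.ext <;> simp
  rw [ha', hb']
  conv_lhs => rw [ha, hb]
  simp only [Complex.add_re, Complex.add_im, Complex.mul_re, Complex.mul_im, Complex.ofReal_re,
    Complex.ofReal_im, Complex.I_re, Complex.I_im]
  push_cast
  have hI : Complex.I ^ 2 = -1 := Complex.I_sq
  ring_nf
  simp only [hI]
  ring

/-- The bracket `∑ sign (i - j) D_i ∧ D_j` is the one obtained from special polynomials: a rotation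
of `b_i` rotates `z_i`, and a rotation of `a_i` rotates `z_i` once, all later edges twice, and moves
`θ`. -/
theorem isTransferred_bracketT : IsTransferred (bracketT n) := by
  intro f g p Φ Ψ x hp hx hΦ hΨ
  obtain ⟨y, hy⟩ := surjective_qT (Quotient.mk _ x)
  obtain ⟨F, hF⟩ := f.2
  obtain ⟨G, hG⟩ := g.2
  obtain ⟨hne, -⟩ := mem_gaugeSpace_iff.mp hp
  -- the polygon underlying `y` may differ from `x` by a rotation
  have hyx : GaugeEquiv (linTuple p) (gaugeSection y.1.1) := by
    obtain ⟨h1, u, h2⟩ := (gaugeEquiv_iff hne).mp hx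
    obtain ⟨h3, h4⟩ := Quotient.exact hy.symm
    obtain ⟨w, hw⟩ := edge_iso h3
    refine (gaugeEquiv_iff hne).mpr ⟨?_, w * u, fun i => ?_⟩
    · rw [← h1, ← show x.α = y.1.1.α from h4]
    · rw [hw, h2, Circle.coe_mul, mul_assoc]
  have hA : ∀ i, (Pi.single i (Complex.I * (p i).1, 0) : Fin n → ℂ × ℂ) =
      fun k => (((Pi.single i 1 : Fin n → ℝ) k : ℂ) * (Complex.I * (p k).1),
        ((0 : Fin n → ℝ) k : ℂ) * (Complex.I * (p k).2)) := by
    intro i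
    funext k
    by_cases h : k = i
    · subst h; simp
    · simp [h]
      rfl
  have hB : ∀ i, (Pi.single i (0, Complex.I * (p i).2) : Fin n → ℂ × ℂ) =
      fun k => (((0 : Fin n → ℝ) k : ℂ) * (Complex.I * (p k).1),
        ((Pi.single i 1 : Fin n → ℝ) k : ℂ) * (Complex.I * (p k).2)) := by
    intro i
    funext k
    by_cases h : k = i
    · subst h; simp
    · simp [h]
      rfl
  have hsA : ∀ i k : Fin n, edgeSpeed (Pi.single i 1) 0 k =
      (if k = i then 1 else 0) + 2 * (if i < k then 1 else 0) := by
    intro i k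
    rw [edgeSpeed]
    simp [Pi.single_apply, Finset.sum_ite_eq']
  have hsB : ∀ i k : Fin n, edgeSpeed 0 (Pi.single i 1) k = if k = i then 1 else 0 := by
    intro i k
    simp [edgeSpeed, Pi.single_apply]
  have derA : ∀ (f : smoothT n) (F : (Fin n → ℂ) × ℝ → ℝ) (Φ : (Fin n → ℂ × ℂ) → ℝ),
      Represents (qT n) (cT n) F f.1 → IsLocalPullback f.1 p Φ → ∀ i,
      fderiv ℝ Φ p (Pi.single i (Complex.I * (p i).1, 0)) =
        (derT i f).1 (qT n y) +
          2 * ∑ k, (if i < k then 1 else 0) * (derT k f).1 (qT n y) +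
          fderiv ℝ F (cT n y) (0, 1) := by
    intro f F Φ hF hΦ i
    rw [hA, fderiv_pullback hF hp hΦ y hyx]
    simp only [hsA, add_mul, Finset.sum_add_distrib, mul_assoc, ← Finset.mul_sum]
    simp
  have derB : ∀ (f : smoothT n) (F : (Fin n → ℂ) × ℝ → ℝ) (Φ : (Fin n → ℂ × ℂ) → ℝ),
      Represents (qT n) (cT n) F f.1 → IsLocalPullback f.1 p Φ → ∀ i,
      fderiv ℝ Φ p (Pi.single i (0, Complex.I * (p i).2)) =
        (derT i f).1 (qT n y) := by
    intro f F Φ hF hΦ i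
    rw [hB, fderiv_pullback hF hp hΦ y hyx]
    simp [hsB]
  rw [linBracket_eq, bracketT_apply, ← hy]
  congr 1
  simp only [derA f F Φ hF hΦ, derA g G Ψ hG hΨ, derB f F Φ hF hΦ, derB g G Ψ hG hΨ]
  have sf := sum_der_eq_zero f (qT n y)
  have sg := sum_der_eq_zero g (qT n y)
  generalize fderiv ℝ F (cT n y) (0, 1) = fθ
  generalize fderiv ℝ G (cT n y) (0, 1) = gθ
  set a : Fin n → ℝ := fun k => (derT k f).1 (qT n y)
  set b : Fin n → ℝ := fun k => (derT k g).1 (qT n y)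
  change ∑ i, ∑ j, orderSign i j * (a i * b j) = ∑ i, 1 / 2 *
    ((a i + 2 * ∑ k, (if i < k then 1 else 0) * a k + fθ) * b i -
      a i * (b i + 2 * ∑ k, (if i < k then 1 else 0) * b k + gθ))
  have sa : ∑ k, a k = 0 := sf
  have sb : ∑ k, b k = 0 := sg
  have h1 : ∑ i, ∑ j, orderSign i j * (a i * b j) =
      ∑ i, ∑ k, (if i < k then 1 else 0) * (a k * b i) -
        ∑ i, ∑ k, (if i < k then 1 else 0) * (a i * b k) := by
    rw [Finset.sum_comm, Finset.sum_comm (f := fun i k : Fin n => (if i < k then (1 : ℝ) else 0) *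
      (a i * b k)), ← Finset.sum_sub_distrib]
    refine Finset.sum_congr rfl fun i _ => ?_
    rw [← Finset.sum_sub_distrib]
    refine Finset.sum_congr rfl fun j _ => ?_
    rw [orderSign]
    ring
  have h2 : ∑ i, 1 / 2 * ((a i + 2 * ∑ k, (if i < k then 1 else 0) * a k + fθ) * b i -
      a i * (b i + 2 * ∑ k, (if i < k then 1 else 0) * b k + gθ)) =
      ∑ i, ((∑ k, (if i < k then 1 else 0) * (a k * b i)) -
        (∑ k, (if i < k then 1 else 0) * (a i * b k)) + (fθ / 2 * b i - gθ / 2 * a i)) := by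
    refine Finset.sum_congr rfl fun i _ => ?_
    have e1 : ∑ k, (if i < k then (1 : ℝ) else 0) * (a k * b i) =
        (∑ k, (if i < k then 1 else 0) * a k) * b i := by
      rw [Finset.sum_mul]; exact Finset.sum_congr rfl fun k _ => by ring
    have e2 : ∑ k, (if i < k then (1 : ℝ) else 0) * (a i * b k) =
        a i * (∑ k, (if i < k then 1 else 0) * b k) := by
      rw [Finset.mul_sum]; exact Finset.sum_congr rfl fun k _ => by ring
    rw [e1, e2]
    ring
  rw [h1, h2, Finset.sum_add_distrib, Finset.sum_sub_distrib, Finset.sum_sub_distrib,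
    ← Finset.mul_sum, ← Finset.mul_sum, sa, sb]
  ring

/-- Every point lifts to the polynomials by `gaugeSection`, and every smooth function has a local
pull-back there, so that the bracket is determined. -/
theorem isTransferred_unique (B : PoissonBracket (smoothT n)) (hB : IsTransferred B) :
    B = bracketT n := by
  ext f g m
  obtain ⟨x, rfl⟩ := surjective_qT m
  set p : Fin n → ℂ × ℂ := fun i => (sectionConst x.1.1 i,
    edge x.1.1.v (i.val + 1) * starRingEnd ℂ (sectionConst x.1.1 i)) with hp
  have hlin : linTuple p = gaugeSection x.1.1 := funext fun i => (gaugeSection_eq_linPoly _ i).symm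
  have hne : ∀ i, (p i).1 ≠ 0 ∧ (p i).2 ≠ 0 := fun i => ⟨sectionConst_ne_zero _ i,
    mul_ne_zero (x.1.1.edge_ne _) ((map_ne_zero _).mpr (sectionConst_ne_zero _ i))⟩
  have hge : GaugeEquiv (linTuple p) (gaugeSection x.1.1) := by
    rw [hlin]
    exact ⟨fun _ => 1, fun i => by simp⟩
  have hθ : ∏ i, (p i).1 = Circle.exp x.1.2 := by
    rw [← x.2]
    exact ((gaugeEquiv_iff hne).mp hge).1.symm
  have hmem : linTuple p ∈ gaugeSpace n := by
    refine mem_gaugeSpace_iff.mpr ⟨hne, ?_⟩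
    rw [← norm_prod, hθ, Circle.norm_coe]
  have hf := isLocalPullback_gaugeCoord (CommutingFields.rep_spec f) hne hθ
  have hg := isLocalPullback_gaugeCoord (CommutingFields.rep_spec g) hne hθ
  have h1 := hB f g p _ _ x.1.1 hmem hge hf hg
  have h2 := isTransferred_bracketT f g p _ _ x.1.1 hmem hge hf hg
  exact_mod_cast h1.trans h2.symm

end Transfer

/-! ### The bracket descends to isometry classes and to similarity classes -/

section Descent

variable {n : ℕ} [NeZero n]

theorem extAngle_of_ratio_eq_mul_exp {v w : ℤ → ℂ} {k : ℤ} {t : ℝ} (hv : ratio v k ≠ 0)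
    (h : ratio w k = Complex.exp (t * Complex.I) * ratio v k) :
    extAngle w k = extAngle v k + t := by
  rw [extAngle, extAngle, h, Complex.arg_mul_coe_angle (Complex.exp_ne_zero _) hv,
    Complex.arg_exp_mul_I, Real.Angle.coe_toIocMod, add_comm]

/-- The factor `α²` picked up by the edge following the last one. -/
def wrapFactor {n : ℕ} (i : Fin n) (θ : ℝ) : ℂ :=
  if i.val + 1 = n then (Circle.exp θ : ℂ) ^ 2 else 1

theorem wrapFactor_ne_zero {n : ℕ} (i : Fin n) (θ : ℝ) : wrapFactor i θ ≠ 0 := by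
  unfold wrapFactor
  split_ifs
  · exact pow_ne_zero 2 (Circle.coe_ne_zero _)
  · exact one_ne_zero

theorem contDiff_wrapFactor {n : ℕ} (i : Fin n) : ContDiff ℝ ∞ (wrapFactor i) := by
  unfold wrapFactor
  split_ifs
  · simp only [Circle.coe_exp]
    exact ((Complex.ofRealCLM.contDiff.mul contDiff_const).cexp).pow 2
  · exact contDiff_const

/-- The ratios `y_i` in the coordinates of the double cover. -/
def ratioCoord (v : (Fin n → ℂ) × ℝ) (i : Fin n) : ℂ := wrapFactor i v.2 * v.1 (i + 1) / v.1 i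

theorem ratioCoord_cT (p : ParT n) (i : Fin n) :
    ratioCoord (cT n p) i = ratio p.1.1.v (i.val + 1) := by
  rw [ratio, p.1.1.edge_succ, p.2]
  rfl

/-- The coordinates `|z_i|, φ_i` in terms of the coordinates of the double cover, with `φ_i` taken
near `φ₀ i`. -/
def angleCoord (φ₀ : Fin n → ℝ) (v : (Fin n → ℂ) × ℝ) : (Fin n → ℝ) × (Fin n → ℝ) :=
  (fun i => ‖v.1 i‖, fun i => φ₀ i + Complex.arg (ratioCoord v i / Circle.exp (φ₀ i)))

theorem contDiffAt_angleCoord {v : (Fin n → ℂ) × ℝ} (hv : ∀ i, v.1 i ≠ 0) :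
    ContDiffAt ℝ ∞ (angleCoord fun i => Complex.arg (ratioCoord v i)) v := by
  have hz : ∀ k, ContDiff ℝ ∞ fun v : (Fin n → ℂ) × ℝ => v.1 k := fun k =>
    (contDiff_apply ℝ ℂ k).comp contDiff_fst
  refine ContDiffAt.prodMk (contDiffAt_pi.mpr fun i => (hz i).contDiffAt.norm ℝ (hv i))
    (contDiffAt_pi.mpr fun i => contDiffAt_const.add ?_)
  set φ := Complex.arg (ratioCoord v i)
  have h1 : ContDiffAt ℝ ∞ (fun v => ratioCoord v i / (Circle.exp φ : ℂ)) v := by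
    simp only [ratioCoord, div_eq_mul_inv]
    exact ((((contDiff_wrapFactor i).comp contDiff_snd).contDiffAt.mul (hz (i + 1)).contDiffAt).mul
      ((hz i).contDiffAt.fun_inv (hv i))).mul contDiffAt_const
  have h3 : ratioCoord v i ≠ 0 :=
    div_ne_zero (mul_ne_zero (wrapFactor_ne_zero _ _) (hv _)) (hv _)
  have h2 : ContDiffAt ℝ ∞ Complex.log (ratioCoord v i / (Circle.exp φ : ℂ)) := by
    refine (Complex.contDiffAt_log ?_).restrict_scalars ℝ
    have h4 : ratioCoord v i / (Circle.exp φ : ℂ) = (‖ratioCoord v i‖ : ℝ) := by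
      rw [div_eq_iff (Circle.coe_ne_zero _), Circle.coe_exp]
      exact (Complex.norm_mul_exp_arg_mul_I _).symm
    rw [h4, Complex.ofReal_mem_slitPlane]
    exact norm_pos_iff.mpr h3
  have h4 := Complex.imCLM.contDiff.contDiffAt.comp v (h2.comp v h1)
  simpa [Function.comp_def, Complex.log_im] using h4

/-- The underlying point of isometry classes has the coordinates `angleCoord`. -/
theorem exists_parE_angleCoord (φ₀ : Fin n → ℝ) (p : ParT n) :
    ∃ p' : ParE n, cE n p' = angleCoord φ₀ (cT n p) ∧ qE n p' = projTE n (qT n p) := by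
  refine ⟨⟨(p.1.1.toE, (angleCoord φ₀ (cT n p)).2), fun i => ?_⟩, rfl, rfl⟩
  change ((φ₀ i + Complex.arg (ratioCoord (cT n p) i / Circle.exp (φ₀ i)) : ℝ) : Real.Angle) =
    (Complex.arg (ratio p.1.1.v (i.val + 1)) : Real.Angle)
  rw [ratioCoord_cT, Real.Angle.coe_add, Complex.arg_div_coe_angle
    (show ratio p.1.1.v (i.val + 1) ≠ 0 from p.1.1.toE.ratio_ne _) (Circle.coe_ne_zero _),
    Circle.coe_exp, Complex.arg_exp_mul_I, Real.Angle.coe_toIocMod]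
  abel

theorem represents_comp_projTE {f : SpaceE n → ℝ} {F : (Fin n → ℝ) × (Fin n → ℝ) → ℝ}
    (hF : Represents (qE n) (cE n) F f) :
    Represents (qT n) (cT n) (F ∘ angleCoord 0) (f ∘ projTE n) := by
  have hval : ∀ φ₀ p, F (angleCoord φ₀ (cT n p)) = f (projTE n (qT n p)) := fun φ₀ p => by
    obtain ⟨p', h1, h2⟩ := exists_parE_angleCoord φ₀ p
    rw [← h1, ← h2, hF.2]
  refine ⟨?_, fun p => (hval 0 p).symm⟩
  rintro v ⟨p, rfl⟩
  refine ContDiffAt.contDiffWithinAt ?_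
  have hp : ∀ i, (cT n p).1 i ≠ 0 := fun i => p.1.1.edge_ne _
  have h1 : ContDiffAt ℝ ∞ F (angleCoord (fun i => Complex.arg (ratioCoord (cT n p) i))
      (cT n p)) := by
    obtain ⟨p', h1, -⟩ := exists_parE_angleCoord
      (fun i => Complex.arg (ratioCoord (cT n p) i)) p
    exact hF.1.contDiffAt (isOpen_range_cE.mem_nhds ⟨p', h1⟩)
  refine (h1.comp _ (contDiffAt_angleCoord hp)).congr_of_eventuallyEq ?_
  filter_upwards [isOpen_range_cT.mem_nhds ⟨p, rfl⟩] with v hv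
  obtain ⟨p₁, rfl⟩ := hv
  exact (hval 0 p₁).trans (hval _ p₁).symm

theorem comp_projTE_mem (f : smoothE n) : f.1 ∘ projTE n ∈ smoothT n := by
  obtain ⟨F, hF⟩ := f.2
  exact ⟨_, represents_comp_projTE hF⟩

/-- Rotating the edges with speeds `w` changes the exterior angles with speeds `w (k+1) - w k`. -/
theorem qE_of_rotCurve {p : ParT n} {p' : ParE n} (h : qE n p' = projTE n (qT n p))
    (w : Fin n → ℝ) (s : ℝ) {y : ParT n} (hy : cT n y = rotCurve w 0 (cT n p) s) :
    ∃ y' : ParE n, cE n y' = cE n p' + s • (0, fun k => w (k + 1) - w k) ∧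
      qE n y' = projTE n (qT n y) := by
  have hiso : IsoRel p'.1.1.v p.1.1.v := Quotient.exact h
  have hz : ∀ k : Fin n, edge y.1.1.v (k.val + 1) =
      Complex.exp ((w k * s : ℝ) * Complex.I) * edge p.1.1.v (k.val + 1) := fun k =>
    congrFun (congrArg Prod.fst hy) k
  have hα : y.1.1.α = p.1.1.α := by
    have : y.1.2 = p.1.2 := by simpa [rotCurve, cT] using congrArg Prod.snd hy
    rw [y.2, p.2, this]
  have hratio : ∀ k : Fin n, ratio y.1.1.v (k.val + 1) =
      Complex.exp (((s * (w (k + 1) - w k) : ℝ) : ℂ) * Complex.I) * ratio p.1.1.v (k.val + 1) := by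
    intro k
    have h1 : ((s * (w (k + 1) - w k) : ℝ) : ℂ) * Complex.I =
        ((w (k + 1) * s : ℝ) : ℂ) * Complex.I - ((w k * s : ℝ) : ℂ) * Complex.I := by
      push_cast; ring
    rw [ratio, ratio, y.1.1.edge_succ, p.1.1.edge_succ, hz, hz, hα, h1, Complex.exp_sub]
    have e1 := p.1.1.edge_ne (k.val + 1)
    have e2 := Complex.exp_ne_zero (((w k * s : ℝ) : ℂ) * Complex.I)
    field_simp
  refine ⟨⟨(y.1.1.toE, p'.1.2 + s • fun k => w (k + 1) - w k), fun k => ?_⟩, ?_, rfl⟩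
  · change _ = extAngle y.1.1.v (k.val + 1)
    rw [extAngle_of_ratio_eq_mul_exp (v := p.1.1.v) (p.1.1.toE.ratio_ne _) (hratio k), extAngle_iso hiso,
      ← p'.2 k]
    rfl
  · refine Prod.ext (funext fun k => ?_) rfl
    change ‖edge y.1.1.v (k.val + 1)‖ = ‖edge p'.1.1.v (k.val + 1)‖ + s • (0 : ℝ)
    rw [hz, norm_mul, Complex.norm_exp_ofReal_mul_I, one_mul, norm_edge_iso hiso, smul_zero,
      add_zero]

theorem hasDerivAt_lineE {f : smoothE n} {F : (Fin n → ℝ) × (Fin n → ℝ) → ℝ}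
    (hF : Represents (qE n) (cE n) F f.1) (p : ParE n) (u : Fin n → ℝ) {v : ℝ → _} {t : ℝ}
    (hv : HasDerivAt v (0, u) t) (ht : v t = cE n p) :
    HasDerivAt (fun s => F (v s)) (∑ k, u k * (derE k f).1 (qE n p)) t := by
  have h1 : HasFDerivAt F (fderiv ℝ F (cE n p)) (v t) := by
    rw [ht]
    exact (hF.differentiableAt isOpen_range_cE p).hasFDerivAt
  have h2 := h1.comp_hasDerivAt t hv
  have h3 : ((0, u) : (Fin n → ℝ) × (Fin n → ℝ)) = ∑ k, u k • (0, Pi.single k 1) := by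
    refine Prod.ext (by simp [Prod.fst_sum]) ?_
    funext k
    simp [Prod.snd_sum, Finset.sum_apply, Pi.single_apply]
  rw [h3, map_sum] at h2
  simp only [map_smul, smul_eq_mul] at h2
  simp only [derE_apply _ f hF]
  exact h2

theorem hasDerivAt_line {V : Type*} [NormedAddCommGroup V] [NormedSpace ℝ V] (a u : V) (t : ℝ) :
    HasDerivAt (fun s : ℝ => a + s • u) u t := by
  simpa using ((hasDerivAt_id t).smul_const u).const_add a

/-- The rotation of the edge `z_i` increases `φ_{i-1}` and decreases `φ_i`. -/
theorem der_comp_projTE (f : smoothE n) (i : Fin n) (X : SpaceT n) :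
    (derT i ⟨f.1 ∘ projTE n, comp_projTE_mem f⟩).1 X =
      (derE (i - 1) f).1 (projTE n X) - (derE i f).1 (projTE n X) := by
  obtain ⟨p, rfl⟩ := (fieldsT n).surj X
  obtain ⟨F, hF⟩ := f.2
  obtain ⟨p', hp'⟩ := surjective_qE (projTE n (qT n p))
  have hT := represents_comp_projTE hF
  set w : Fin n → ℝ := Pi.single i 1
  have hγ := hasDerivAt_rotCurve w 0 (cT n p)
  have hγ' : HasDerivAt (rotCurve w 0 (cT n p)) (rotFieldT i (cT n p)) 0 := by
    refine hγ.congr_deriv ?_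
    simp [w, Pi.single_apply]
  have hE := hasDerivAt_lineE hF p' (fun k => w (k + 1) - w k)
    (hasDerivAt_line (cE n p') (0, fun k => w (k + 1) - w k) 0) (by simp)
  rw [derT_eq_of_hasDerivAt hT hγ' (rotCurve_zero _ _ _)
    (d := ∑ k, (w (k + 1) - w k) * (derE k f).1 (qE n p')) ?_]
  · rw [← hp']
    have h1 : ∀ k, w (k + 1) = if k = i - 1 then 1 else 0 := fun k => by
      simp only [w, Pi.single_apply, eq_sub_iff_add_eq]
    have h2 : ∀ k, w k = if k = i then 1 else 0 := fun k => by simp only [w, Pi.single_apply]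
    simp [sub_mul, Finset.sum_sub_distrib, h1, h2]
  · refine hE.congr_of_eventuallyEq (Filter.Eventually.of_forall fun s => ?_)
    have hz : ∀ k, (rotCurve w 0 (cT n p) s).1 k ≠ 0 := fun k =>
      mul_ne_zero (Complex.exp_ne_zero _) (p.1.1.edge_ne _)
    obtain ⟨y, -, hyc⟩ := exists_parT _ hz (rotCurve w 0 (cT n p) s).2
    obtain ⟨y', h1, h2⟩ := qE_of_rotCurve hp' w s (y := y) hyc
    change (F ∘ angleCoord 0) (rotCurve w 0 (cT n p) s) = F _
    rw [← h1, ← hF.2, h2, show rotCurve w 0 (cT n p) s = cT n y from hyc.symm, ← hT.2]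
    rfl

theorem sub_one_eq_iff {i j : Fin n} : i - 1 = j ↔ j + 1 = i :=
  ⟨fun h => by rw [← h]; simp, fun h => by rw [← h]; simp⟩

/-- The second difference of the order sign on the cycle is the structure matrix of the bracket of
the exterior angles. -/
theorem orderSign_second_difference (i j : Fin n) :
    orderSign (i + 1) (j + 1) - orderSign (i + 1) j - orderSign i (j + 1) + orderSign i j =
      -cyc i j := by
  unfold orderSign cyc
  simp only [sub_one_eq_iff]
  simp only [Fin.lt_def, Fin.ext_iff]
  have hi := i.2
  have hj := j.2
  have hi' := (i + 1 : Fin n).2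
  have hj' := (j + 1 : Fin n).2
  rcases val_add_one_cases i with h | ⟨h, h'⟩ <;> rcases val_add_one_cases j with k | ⟨k, k'⟩ <;>
  rcases lt_trichotomy (i.val + 1) j.val with h1 | h1 | h1 <;>
  rcases lt_trichotomy i.val (j.val + 1) with h2 | h2 | h2 <;>
  rcases eq_or_ne i.val j.val with h3 | h3 <;>
  rcases eq_or_ne i.val 0 with h4 | h4 <;> rcases eq_or_ne j.val 0 with h5 | h5 <;>
  first
  | omega
  | (simp (disch := omega) only [if_pos, if_neg]; norm_num)

/-- Summation by parts on the cycle. -/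
theorem sum_orderSign_difference (a b : Fin n → ℝ) :
    ∑ i, ∑ j, orderSign i j * ((a (i - 1) - a i) * (b (j - 1) - b j)) =
      ∑ i, ∑ j, -cyc i j * (a i * b j) := by
  have shift : ∀ g h : Fin n → ℝ, ∑ i, g i * (h (i - 1) - h i) = ∑ i, (g (i + 1) - g i) * h i := by
    intro g h
    have : ∑ i, g i * h (i - 1) = ∑ i, g (i + 1) * h i :=
      (Fintype.sum_equiv (Equiv.addRight (1 : Fin n)) _ _ fun i => by simp).symm
    simp only [mul_sub, sub_mul, Finset.sum_sub_distrib, this]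
  have h1 : ∀ i, ∑ j, orderSign i j * ((a (i - 1) - a i) * (b (j - 1) - b j)) =
      (∑ j, (orderSign i (j + 1) - orderSign i j) * b j) * (a (i - 1) - a i) := fun i => by
    rw [← shift, Finset.sum_mul]
    exact Finset.sum_congr rfl fun j _ => by ring
  simp only [h1]
  rw [shift]
  refine Finset.sum_congr rfl fun i _ => ?_
  rw [← Finset.sum_sub_distrib, Finset.sum_mul]
  refine Finset.sum_congr rfl fun j _ => ?_
  rw [← orderSign_second_difference]
  ring

theorem isPoissonMap_projTE : IsPoissonMap (bracketT n) (bracketE n) (projTE n) := by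
  refine ⟨comp_projTE_mem, fun f g => funext fun X => ?_⟩
  rw [bracketT_apply]
  simp only [der_comp_projTE]
  rw [sum_orderSign_difference (fun i => (derE i f).1 (projTE n X)) fun i =>
    (derE i g).1 (projTE n X)]
  exact (bracketE_apply f g _).symm

theorem surjective_projTE {n : ℕ} : Function.Surjective (projTE n) := fun X => by
  obtain ⟨x, rfl⟩ := Quotient.exists_rep X
  obtain ⟨a, b, h⟩ := x.mono
  refine ⟨Quotient.mk _ ⟨x.v, Circle.exp (Complex.arg a / 2), x.ne, b, fun i => ?_⟩, rfl⟩
  rw [h, ← Circle.coe_pow, sq, ← Circle.exp_add, add_halves, Circle.exp_arg]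

theorem isPoissonMap_projTE_unique (B : PoissonBracket (smoothE n))
    (hB : IsPoissonMap (bracketT n) B (projTE n)) : B = bracketE n := by
  obtain ⟨h1, h2⟩ := hB
  obtain ⟨h3, h4⟩ := isPoissonMap_projTE (n := n)
  ext f g X
  obtain ⟨Y, rfl⟩ := surjective_projTE X
  exact congrFun ((h2 f g).symm.trans (h4 f g)) Y

/-- The ratios `y_i` in terms of `|z_i|, φ_i`. -/
def ratioOfAngles (v : (Fin n → ℝ) × (Fin n → ℝ)) (i : Fin n) : ℂ :=
  (v.1 (i + 1) / v.1 i : ℝ) * Complex.exp (v.2 i * Complex.I)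

theorem ratioOfAngles_cE (p : ParE n) : ratioOfAngles (cE n p) = cS n p.1.1.toS := by
  funext i
  refine Eq.symm ((ratio_eq_norm_mul_exp (p.2 i)).trans ?_)
  rw [p.1.1.norm_edge_succ]
  rfl

theorem represents_comp_mapES {f : SpaceS n → ℝ} {F : (Fin n → ℂ) → ℝ}
    (hF : Represents (qS n) (cS n) F f) :
    Represents (qE n) (cE n) (F ∘ ratioOfAngles) (f ∘ mapES n) := by
  refine ⟨?_, fun p => ?_⟩
  · rintro v ⟨p, rfl⟩
    refine ContDiffAt.contDiffWithinAt (ContDiffAt.comp _ ?_ (contDiffAt_pi.mpr fun i => ?_))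
    · rw [ratioOfAngles_cE]
      exact hF.1.contDiffAt (isOpen_range_cS.mem_nhds ⟨_, rfl⟩)
    · have h1 : ∀ k, ContDiffAt ℝ ∞ (fun v : (Fin n → ℝ) × (Fin n → ℝ) => v.1 k) (cE n p) :=
        fun k => ((contDiff_apply ℝ ℝ k).comp contDiff_fst).contDiffAt
      have h2 : ContDiffAt ℝ ∞ (fun v : (Fin n → ℝ) × (Fin n → ℝ) => v.2 i) (cE n p) :=
        ((contDiff_apply ℝ ℝ i).comp contDiff_snd).contDiffAt
      have h3 : (cE n p).1 i ≠ 0 := norm_ne_zero_iff.mpr (p.1.1.edge_ne _)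
      exact (Complex.ofRealCLM.contDiff.contDiffAt.comp _ ((h1 (i + 1)).fun_div (h1 i) h3)).mul
        ((Complex.ofRealCLM.contDiff.contDiffAt.comp _ h2).mul contDiffAt_const).cexp
  · change f (qS n p.1.1.toS) = F (ratioOfAngles (cE n p))
    rw [ratioOfAngles_cE, hF.2]

theorem comp_mapES_mem (f : smoothS n) : f.1 ∘ mapES n ∈ smoothE n := by
  obtain ⟨F, hF⟩ := f.2
  exact ⟨_, represents_comp_mapES hF⟩

theorem der_comp_mapES (f : smoothS n) (i : Fin n) (X : SpaceE n) :
    (derE i ⟨f.1 ∘ mapES n, comp_mapES_mem f⟩).1 X =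
      (derS i f).1 (mapES n X) := by
  obtain ⟨p, rfl⟩ := (fieldsE n).surj X
  obtain ⟨F, hF⟩ := f.2
  have hE := represents_comp_mapES hF
  refine (fieldsE n).der_eq_of_hasDerivAt hE
    (hasDerivAt_line (cE n p) (0, (Pi.single i 1 : Fin n → ℝ)) 0) (by simp) ?_
  have h1 : HasDerivAt (fun (s : ℝ) (k : Fin n) =>
      Complex.exp (((Pi.single i 1 : Fin n → ℝ) k * s : ℝ) * Complex.I) * cS n p.1.1.toS k)
      (rotField i (cS n p.1.1.toS)) 0 := by
    refine (hasDerivAt_pi.mpr fun k => hasDerivAt_exp_mul _ _).congr_deriv ?_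
    funext k
    rw [rotField_apply]
    by_cases h : k = i
    · subst h; simp
    · simp [h]
  have h2 : ∀ s : ℝ, ratioOfAngles (cE n p + s • (0, (Pi.single i 1 : Fin n → ℝ))) = fun k =>
      Complex.exp (((Pi.single i 1 : Fin n → ℝ) k * s : ℝ) * Complex.I) *
        cS n p.1.1.toS k := fun s => by
    funext k
    rw [← ratioOfAngles_cE]
    simp only [ratioOfAngles, Prod.fst_add, Prod.snd_add, Prod.smul_fst, Prod.smul_snd, smul_zero,
      Pi.zero_apply, add_zero, Pi.add_apply, Pi.smul_apply, smul_eq_mul]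
    rw [Complex.ofReal_add, add_mul, Complex.exp_add, mul_comm s]
    ring
  simp only [Function.comp_apply, h2]
  have h3 := (hF.differentiableAt isOpen_range_cS p.1.1.toS).hasFDerivAt
  have h4 : HasFDerivAt F (fderiv ℝ F (cS n p.1.1.toS)) ((fun (s : ℝ) (k : Fin n) =>
      Complex.exp (((Pi.single i 1 : Fin n → ℝ) k * s : ℝ) * Complex.I) *
        cS n p.1.1.toS k) 0) := by
    simpa using h3
  refine (h4.comp_hasDerivAt 0 h1).congr_deriv ?_
  exact (derS_apply i f hF p.1.1.toS).symm

theorem isPoissonMap_mapES : IsPoissonMap (bracketE n) (bracketS n) (mapES n) := by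
  refine ⟨comp_mapES_mem, fun f g => funext fun X => ?_⟩
  rw [bracketE_apply]
  simp only [der_comp_mapES]
  exact (bracketS_apply f g _).symm

end Descent

/-! ### Casimirs and symplectic leaves on isometry classes -/

section Leaves

variable {n : ℕ} [NeZero n]

/-- The coordinate `|z_i|`. -/
def sideProj {n : ℕ} (i : Fin n) : ((Fin n → ℝ) × (Fin n → ℝ)) →L[ℝ] ℝ :=
  (ContinuousLinearMap.proj (R := ℝ) (φ := fun _ : Fin n => ℝ) i).comp (ContinuousLinearMap.fst ℝ _ _)

/-- The coordinate `φ_i`. -/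
def angleProj {n : ℕ} (i : Fin n) : ((Fin n → ℝ) × (Fin n → ℝ)) →L[ℝ] ℝ :=
  (ContinuousLinearMap.proj (R := ℝ) (φ := fun _ : Fin n => ℝ) i).comp (ContinuousLinearMap.snd ℝ _ _)

theorem sideProj_apply {n : ℕ} (i : Fin n) (v : (Fin n → ℝ) × (Fin n → ℝ)) :
    sideProj i v = v.1 i := rfl

theorem angleProj_apply {n : ℕ} (i : Fin n) (v : (Fin n → ℝ) × (Fin n → ℝ)) :
    angleProj i v = v.2 i := rfl

theorem cE_fst_pos {n : ℕ} (p : ParE n) (i : Fin n) : 0 < (cE n p).1 i :=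
  norm_pos_iff.mpr (p.1.1.edge_ne _)

theorem isCasimir_bracketE {f : SpaceE n → ℝ} (hf : f ∈ smoothE n)
    (h : ∀ X j, ∑ i, cyc i j * (derE i ⟨f, hf⟩).1 X = 0) : IsCasimir (bracketE n) f := by
  refine ⟨hf, fun g => ?_⟩
  ext X
  rw [bracketE_apply, Finset.sum_comm]
  refine Finset.sum_eq_zero fun j _ => ?_
  have : ∑ i, -cyc i j * ((derE i ⟨f, hf⟩).1 X * (derE j g).1 X) =
      -(∑ i, cyc i j * (derE i ⟨f, hf⟩).1 X) * (derE j g).1 X := by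
    rw [← Finset.sum_neg_distrib, Finset.sum_mul]
    exact Finset.sum_congr rfl fun i _ => by ring
  rw [this, h, neg_zero, zero_mul]

theorem sideLength_add {n : ℕ} (k : ℤ) : sideLength n k = sideLength n (k + n) := by
  funext X
  obtain ⟨x, rfl⟩ := Quotient.exists_rep X
  exact (x.norm_edge_add k).symm

theorem isCasimir_sideLength (k : ℤ) : IsCasimir (bracketE n) (sideLength n k) := by
  refine forall_of_periodic (n := n) (Q := fun k => IsCasimir (bracketE n) (sideLength n k))
    (fun k => by rw [sideLength_add]) (fun i => ?_) k
  have hrep : Represents (qE n) (cE n) (fun v => v.1 i) (sideLength n (i.val + 1)) :=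
    ⟨((contDiff_apply ℝ ℝ i).comp contDiff_fst).contDiffOn, fun p => rfl⟩
  refine isCasimir_bracketE ⟨_, hrep⟩ fun X j => Finset.sum_eq_zero fun k _ => ?_
  obtain ⟨p, rfl⟩ := surjective_qE X
  have h1 : HasFDerivAt (fun v : (Fin n → ℝ) × (Fin n → ℝ) => v.1 i) (sideProj i) (cE n p) :=
    (sideProj i).hasFDerivAt
  rw [derE_apply k ⟨_, ⟨_, hrep⟩⟩ hrep, h1.fderiv, sideProj_apply]
  simp

/-- The sum of the exterior angles with indices in `s`. -/
def subsetAngle {n : ℕ} (s : Finset (Fin n)) (X : SpaceE n) : Real.Angle :=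
  ∑ k ∈ s, exteriorAngle n (k.val + 1) X

theorem subsetAngle_qE {n : ℕ} (s : Finset (Fin n)) (p : ParE n) :
    subsetAngle s (qE n p) = ((∑ k ∈ s, (cE n p).2 k : ℝ) : Real.Angle) := by
  have h : ∀ t : Finset (Fin n), ((∑ k ∈ t, (cE n p).2 k : ℝ) : Real.Angle) =
      ∑ k ∈ t, (((cE n p).2 k : ℝ) : Real.Angle) := fun t =>
    map_sum Real.Angle.coeHom _ _
  rw [h]
  exact Finset.sum_congr rfl fun k _ => (p.2 k).symm

theorem cyc_sum (j : Fin n) (c : Fin n → ℝ) : ∑ i, cyc i j * c i = c (j - 1) - c (j + 1) := by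
  have h1 : ∀ i : Fin n, i + 1 = j ↔ i = j - 1 := fun i => eq_sub_iff_add_eq.symm
  have h2 : ∀ i : Fin n, i - 1 = j ↔ i = j + 1 := fun i => sub_eq_iff_eq_add
  simp [cyc, sub_mul, Finset.sum_sub_distrib, h1, h2]

theorem isAngleCasimir_subsetAngle {s : Finset (Fin n)}
    (hs : ∀ j : Fin n, j - 1 ∈ s ↔ j + 1 ∈ s) : IsAngleCasimir (bracketE n) (subsetAngle s) := by
  have hlin : ∀ v : (Fin n → ℝ) × (Fin n → ℝ),
      HasFDerivAt (fun v : (Fin n → ℝ) × (Fin n → ℝ) => ∑ k ∈ s, v.2 k)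
        (∑ k ∈ s, angleProj k) v := fun v =>
    HasFDerivAt.fun_sum fun k _ => (angleProj k).hasFDerivAt
  have hsm : ContDiff ℝ ∞ fun v : (Fin n → ℝ) × (Fin n → ℝ) => ∑ k ∈ s, v.2 k :=
    ContDiff.sum fun k _ => (contDiff_apply ℝ ℝ k).comp contDiff_snd
  -- a function of `∑ φ_k` has derivative proportional to the indicator of `s`
  have key : ∀ (u u' : ℝ → ℝ) (f : SpaceE n → ℝ), ContDiff ℝ ∞ u →
      (∀ t, HasDerivAt u (u' t) t) → (∀ p, f (qE n p) = u (∑ k ∈ s, (cE n p).2 k)) →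
      IsCasimir (bracketE n) f := by
    intro u u' f hu hd hf
    have hrep : Represents (qE n) (cE n) (fun v => u (∑ k ∈ s, v.2 k)) f :=
      ⟨(hu.comp hsm).contDiffOn, hf⟩
    refine isCasimir_bracketE ⟨_, hrep⟩ fun X j => ?_
    obtain ⟨p, rfl⟩ := surjective_qE X
    have h1 : ∀ i, (derE i ⟨f, ⟨_, hrep⟩⟩).1 (qE n p) =
        u' (∑ k ∈ s, (cE n p).2 k) * if i ∈ s then 1 else 0 := fun i => by
      have h2 : HasFDerivAt (fun v : (Fin n → ℝ) × (Fin n → ℝ) => u (∑ k ∈ s, v.2 k))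
          (u' (∑ k ∈ s, (cE n p).2 k) • ∑ k ∈ s, angleProj k) (cE n p) :=
        (hd _).comp_hasFDerivAt (cE n p) (hlin (cE n p))
      rw [derE_apply i ⟨f, ⟨_, hrep⟩⟩ hrep, h2.fderiv]
      simp [angleProj_apply, Pi.single_apply]
    simp only [h1]
    rw [cyc_sum j fun i => u' (∑ k ∈ s, (cE n p).2 k) * if i ∈ s then 1 else 0]
    simp only [hs j, sub_self]
  exact ⟨key Real.cos (fun t => -Real.sin t) _ Real.contDiff_cos Real.hasDerivAt_cos
      fun p => by rw [subsetAngle_qE, Real.Angle.cos_coe],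
    key Real.sin Real.cos _ Real.contDiff_sin Real.hasDerivAt_sin
      fun p => by rw [subsetAngle_qE, Real.Angle.sin_coe]⟩

/-- The indices of the exterior angles with odd number. -/
def oddIndices (n : ℕ) : Finset (Fin n) := Finset.univ.filter fun i => Odd (i.val + 1)

theorem oddAngleSum_eq {n : ℕ} : oddAngleSum n = subsetAngle (oddIndices n) := rfl

theorem angleSum_eq {n : ℕ} : angleSum n = subsetAngle Finset.univ := rfl

theorem mem_oddIndices_add_one (hn : Even n) (i : Fin n) :
    i + 1 ∈ oddIndices n ↔ i ∉ oddIndices n := by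
  simp only [oddIndices, Finset.mem_filter, Finset.mem_univ, true_and, Nat.odd_iff]
  have := Nat.even_iff.mp hn
  rcases val_add_one_cases i with h | ⟨h, h'⟩ <;> omega

theorem isAngleCasimir_angleSum : IsAngleCasimir (bracketE n) (angleSum n) :=
  isAngleCasimir_subsetAngle (s := Finset.univ) fun j => by simp

theorem isAngleCasimir_oddAngleSum (hn : Even n) : IsAngleCasimir (bracketE n) (oddAngleSum n) := by
  refine isAngleCasimir_subsetAngle (s := oddIndices n) fun j => ?_
  have h := mem_oddIndices_add_one hn (j - 1)
  rw [sub_add_cancel] at h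
  rw [mem_oddIndices_add_one hn j, h, not_not]

theorem IsCasimir.eq_of_step {M : Type*} {S : Subalgebra ℝ (M → ℝ)} {B : PoissonBracket S}
    {f : M → ℝ} (hf : IsCasimir B f) {x y : M} (h : HamiltonianStep B x y) : f x = f y := by
  obtain ⟨hS, hc⟩ := hf
  obtain ⟨H, γ, rfl, rfl, hγ⟩ := h
  have hd : ∀ t ∈ Set.Icc (0 : ℝ) 1,
      HasDerivWithinAt (fun s => f (γ s)) 0 (Set.Icc 0 1) t := fun t ht => by
    have := hγ ⟨f, hS⟩ t ht
    rw [hc H] at this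
    exact this
  refine (constant_of_derivWithin_zero (fun t ht => (hd t ht).differentiableWithinAt)
    (fun t ht => ?_) 1 (by simp)).symm
  have ht' := Set.Ico_subset_Icc_self ht
  exact (hd t ht').derivWithin (uniqueDiffOn_Icc zero_lt_one t ht')

theorem IsCasimir.eq_of_sameLeaf {M : Type*} {S : Subalgebra ℝ (M → ℝ)} {B : PoissonBracket S}
    {f : M → ℝ} (hf : IsCasimir B f) {x y : M} (h : SameSymplecticLeaf B x y) : f x = f y := by
  induction h with
  | refl => rfl
  | tail _ h2 ih => exact ih.trans (hf.eq_of_step h2)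

theorem IsAngleCasimir.eq_of_sameLeaf {M : Type*} {S : Subalgebra ℝ (M → ℝ)}
    {B : PoissonBracket S} {f : M → Real.Angle} (hf : IsAngleCasimir B f) {x y : M}
    (h : SameSymplecticLeaf B x y) : f x = f y := by
  have h1 : (f x).cos = (f y).cos := hf.1.eq_of_sameLeaf h
  have h2 : (f x).sin = (f y).sin := hf.2.eq_of_sameLeaf h
  rw [← Real.Angle.coe_toReal (f x), ← Real.Angle.coe_toReal (f y)] at h1 h2 ⊢
  exact Real.Angle.cos_sin_inj h1 h2

/-- The direction in which the Hamiltonian flow of a function of `φ_j` moves the exterior angles. -/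
def flowDir (j i : Fin n) : ℝ := -cyc i j

theorem flowDir_self (j : Fin n) : flowDir j j = 0 := by
  have := cyc_skew j j
  unfold flowDir
  linarith

/-- The function `A sin (φ_j - a)` generates, along the trajectory through a point with `φ_j = a`,
a motion of the exterior angles with constant velocity. -/
theorem hamiltonianStep_flowDir (j : Fin n) (A : ℝ) {p p' : ParE n}
    (h : cE n p' = cE n p + (0, A • flowDir j)) : HamiltonianStep (bracketE n) (qE n p) (qE n p') := by
  set a := (cE n p).2 j
  set H : SpaceE n → ℝ := fun X => A * ((exteriorAngle n (j.val + 1) X).sin * Real.cos a -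
    (exteriorAngle n (j.val + 1) X).cos * Real.sin a)
  have hrep : Represents (qE n) (cE n) (fun v => A * Real.sin (v.2 j - a)) H := by
    refine ⟨(contDiff_const.mul (Real.contDiff_sin.comp
      (((contDiff_apply ℝ ℝ j).comp contDiff_snd).sub contDiff_const))).contDiffOn, fun p₁ => ?_⟩
    have : exteriorAngle n (j.val + 1) (qE n p₁) = ((cE n p₁).2 j : ℝ) := (p₁.2 j).symm
    simp only [H, this, Real.Angle.sin_coe, Real.Angle.cos_coe, Real.sin_sub]
  have hex : ∀ s : ℝ, ∃ y : ParE n, cE n y = cE n p + s • (0, A • flowDir j) := fun s => by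
    refine exists_parE fun i => ?_
    simpa using cE_fst_pos p i
  choose y hy using hex
  refine ⟨⟨H, _, hrep⟩, fun s => qE n (y s), ?_, ?_, fun f t _ => ?_⟩
  · exact (qE_eq_of_coords (by simp [hy]) fun i => by simp [hy])
  · exact (qE_eq_of_coords (by simp [hy, h]) fun i => by simp [hy, h])
  · obtain ⟨F, hF⟩ := f.2
    have h1 := hasDerivAt_lineE hF (y t) (A • flowDir j)
      (hasDerivAt_line (cE n p) (0, A • flowDir j) t) (hy t).symm
    have h2 : (fun s => F (cE n p + s • (0, A • flowDir j))) = fun s => f.1 (qE n (y s)) :=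
      funext fun s => by rw [← hy, hF.2]
    rw [h2] at h1
    refine (h1.congr_deriv ?_).hasDerivWithinAt
    have h3 : ∀ k, (derE k ⟨H, _, hrep⟩).1 (qE n (y t)) = if k = j then A else 0 := fun k => by
      have h4 : HasFDerivAt (fun v : (Fin n → ℝ) × (Fin n → ℝ) => v.2 j - a)
          (angleProj j) (cE n (y t)) := (angleProj j).hasFDerivAt.sub_const a
      have h5 : (cE n (y t)).2 j - a = 0 := by
        rw [hy]
        simp [a, flowDir_self]
      rw [derE_apply k ⟨H, _, hrep⟩ hrep, (h4.sin.const_mul A).fderiv, h5]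
      by_cases hk : k = j
      · subst hk; simp [angleProj_apply]
      · simp [angleProj_apply, hk, Ne.symm hk]
    rw [bracketE_apply]
    refine Finset.sum_congr rfl fun i _ => ?_
    simp only [h3]
    simp [flowDir]
    ring

/-- Flows of the Hamiltonians for different `j`, one after the other. -/
theorem sameLeaf_of_sum_flowDir (A : Fin n → ℝ) (s : Finset (Fin n)) {p p' : ParE n}
    (h : cE n p' = cE n p + (0, ∑ j ∈ s, A j • flowDir j)) :
    SameSymplecticLeaf (bracketE n) (qE n p) (qE n p') := by
  classical
  induction s using Finset.induction_on generalizing p' with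
  | empty =>
    have : qE n p = qE n p' := qE_eq_of_coords (by simp [h]) fun i => by simp [h]
    rw [this]
    exact Relation.ReflTransGen.refl
  | insert j s hj ih =>
    have : ∃ y : ParE n, cE n y = cE n p + (0, ∑ j ∈ s, A j • flowDir j) :=
      exists_parE fun i => by simpa using cE_fst_pos p i
    obtain ⟨y, hy⟩ := this
    refine (ih hy).tail (hamiltonianStep_flowDir j (A j) ?_)
    rw [h, hy, Finset.sum_insert hj, add_assoc]
    congr 1
    rw [Prod.mk_add_mk, add_zero, add_comm]

/-- The span of the flow directions is cut out by the differentials of the Casimirs. -/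
theorem mem_span_flowDir {d : Fin n → ℝ} (h1 : ∑ k, d k = 0)
    (h2 : Even n → ∑ k ∈ oddIndices n, d k = 0) : d ∈ Submodule.span ℝ (Set.range (flowDir (n := n))) := by
  set W := Submodule.span ℝ (Set.range (flowDir (n := n)))
  set E : ℕ → (Fin n → ℝ) ⧸ W := fun m => W.mkQ (Pi.single (Fin.ofNat n m) 1)
  have hstep : ∀ m, E (m + 2) = E m := by
    intro m
    have h3 : flowDir (Fin.ofNat n (m + 1)) =
        Pi.single (Fin.ofNat n (m + 2)) 1 - Pi.single (Fin.ofNat n m) 1 := by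
      have e1 : Fin.ofNat n (m + 1) + 1 = Fin.ofNat n (m + 2) := by
        ext; simp [Fin.val_add, Fin.ofNat]
      have e2 : Fin.ofNat n m + 1 = Fin.ofNat n (m + 1) := by
        ext; simp [Fin.val_add, Fin.ofNat]
      funext i
      have e3 : i + 1 = Fin.ofNat n (m + 1) ↔ i = Fin.ofNat n m := by
        rw [← e2]; exact add_left_inj 1
      have e4 : i - 1 = Fin.ofNat n (m + 1) ↔ i = Fin.ofNat n (m + 2) := by
        rw [← e1]; exact sub_eq_iff_eq_add
      simp only [flowDir, cyc, e3, e4, Pi.sub_apply, Pi.single_apply]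
      ring
    have h4 : W.mkQ (flowDir (Fin.ofNat n (m + 1))) = 0 :=
      (Submodule.Quotient.mk_eq_zero W).mpr (Submodule.subset_span ⟨_, rfl⟩)
    rw [h3, map_sub, sub_eq_zero] at h4
    exact h4
  have hpar : ∀ m, E m = if Odd (m + 1) then E 0 else E 1 := by
    intro m
    induction m using Nat.twoStepInduction with
    | zero => simp
    | one => simp [Nat.odd_iff]
    | more m ih _ =>
      have : Odd (m + 2 + 1) ↔ Odd (m + 1) := by simp only [Nat.odd_iff]; omega
      rw [hstep, ih]
      simp only [this]
  have hd : d = ∑ k, d k • Pi.single k (1 : ℝ) := by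
    funext i
    simp [Finset.sum_apply, Pi.single_apply]
  have hval : ∀ k : Fin n, W.mkQ (Pi.single k 1) = if Odd (k.val + 1) then E 0 else E 1 := by
    intro k
    rw [← hpar]
    simp [E, Fin.ofNat, Nat.mod_eq_of_lt k.2]
  have hq : W.mkQ d = (∑ k ∈ oddIndices n, d k) • E 0 +
      (∑ k, d k - ∑ k ∈ oddIndices n, d k) • E 1 := by
    conv_lhs => rw [hd]
    rw [map_sum]
    simp only [map_smul, hval]
    have e : ∑ k, d k - ∑ k ∈ oddIndices n, d k =
        ∑ k ∈ Finset.univ.filter (fun k : Fin n => ¬ Odd (k.val + 1)), d k := by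
      rw [sub_eq_iff_eq_add', oddIndices, Finset.sum_filter_add_sum_filter_not]
    rw [e, Finset.sum_smul, Finset.sum_smul, oddIndices,
      ← Finset.sum_filter_add_sum_filter_not Finset.univ (fun k : Fin n => Odd (k.val + 1))]
    congr 1
    · exact Finset.sum_congr rfl fun k hk => by rw [if_pos (Finset.mem_filter.mp hk).2]
    · exact Finset.sum_congr rfl fun k hk => by rw [if_neg (Finset.mem_filter.mp hk).2]
  refine (Submodule.Quotient.mk_eq_zero W).mp ?_
  change W.mkQ d = 0
  rw [hq, h1]
  rcases Nat.even_or_odd n with hn | hn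
  · rw [h2 hn]
    simp
  · -- for odd `n` the two parity classes are connected through the end of the cycle
    have h3 : E n = E 0 := by simp [E, Fin.ofNat]
    have h4 : E n = E 1 := by
      rw [hpar, if_neg]
      rw [Nat.not_odd_iff_even]
      exact hn.add_one
    rw [← h4, h3, ← add_smul]
    simp

theorem sameLeaf_iff (x y : SpaceE n) : SameSymplecticLeaf (bracketE n) x y ↔
    (∀ i : ℤ, sideLength n i x = sideLength n i y) ∧ angleSum n x = angleSum n y ∧
      (Even n → oddAngleSum n x = oddAngleSum n y) := by
  refine ⟨fun h => ⟨fun i => (isCasimir_sideLength i).eq_of_sameLeaf h,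
    isAngleCasimir_angleSum.eq_of_sameLeaf h,
    fun hn => (isAngleCasimir_oddAngleSum hn).eq_of_sameLeaf h⟩, ?_⟩
  rintro ⟨h1, h2, h3⟩
  obtain ⟨p, rfl⟩ := surjective_qE x
  obtain ⟨p', rfl⟩ := surjective_qE y
  rw [angleSum_eq, subsetAngle_qE, subsetAngle_qE, Real.Angle.angle_eq_iff_two_pi_dvd_sub] at h2
  obtain ⟨N, hN⟩ := h2
  have h3' : ∃ N' : ℤ, Even n → ∑ k ∈ oddIndices n, (cE n p).2 k -
      ∑ k ∈ oddIndices n, (cE n p').2 k = 2 * Real.pi * N' := by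
    by_cases hn : Even n
    · have := h3 hn
      rw [oddAngleSum_eq, subsetAngle_qE, subsetAngle_qE,
        Real.Angle.angle_eq_iff_two_pi_dvd_sub] at this
      obtain ⟨N', hN'⟩ := this
      exact ⟨N', fun _ => hN'⟩
    · exact ⟨N, fun h => absurd h hn⟩
  obtain ⟨N', hN'⟩ := h3'
  -- lifts of the exterior angles of the second polygon for which the sums agree exactly
  set e : Fin n → ℝ := if Even n then
      Pi.single 0 (2 * Real.pi * N') + Pi.single 1 (2 * Real.pi * (N - N'))
    else Pi.single 0 (2 * Real.pi * N) with he
  have hr : (cE n p').1 = (cE n p).1 := funext fun i => (h1 (i.val + 1)).symm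
  have hang : ∀ k, ((e k : ℝ) : Real.Angle) = 0 := by
    have hz : ∀ (m : ℤ) (i k : Fin n),
        (((Pi.single i (2 * Real.pi * m) : Fin n → ℝ) k : ℝ) : Real.Angle) = 0 := by
      intro m i k
      by_cases hk : k = i
      · subst hk
        rw [Pi.single_eq_same, ← Real.Angle.coe_zero, Real.Angle.angle_eq_iff_two_pi_dvd_sub]
        exact ⟨m, by ring⟩
      · rw [Pi.single_eq_of_ne hk, Real.Angle.coe_zero]
    intro k
    rw [he]
    split_ifs
    · have := hz (N - N') 1 k
      push_cast at this
      rw [Pi.add_apply, Real.Angle.coe_add, hz, this, add_zero]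
    · exact hz N 0 k
  obtain ⟨y, hy⟩ : ∃ y : ParE n, cE n y = cE n p' + (0, e) :=
    exists_parE fun i => by simpa using cE_fst_pos p' i
  have hyq : qE n p' = qE n y := by
    refine qE_eq_of_coords (by simp [hy]) fun i => ?_
    rw [hy]
    simp [Real.Angle.coe_add, hang]
  rw [hyq]
  have hmem : (cE n y).2 - (cE n p).2 ∈ Submodule.span ℝ (Set.range (flowDir (n := n))) := by
    have hs : ∑ k, e k = 2 * Real.pi * N := by
      rw [he]
      split_ifs
      · simp [Finset.sum_add_distrib]; ring
      · simp
    refine mem_span_flowDir ?_ fun hn => ?_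
    · simp only [hy, Prod.snd_add, Pi.sub_apply, Pi.add_apply, Finset.sum_sub_distrib,
        Finset.sum_add_distrib, hs]
      linarith
    · have ho : ∑ k ∈ oddIndices n, e k = 2 * Real.pi * N' := by
        have m0 : (0 : Fin n) ∈ oddIndices n := by simp [oddIndices]
        have m1 : (1 : Fin n) ∉ oddIndices n := by
          have := mem_oddIndices_add_one hn 0
          rw [zero_add] at this
          rw [this, not_not]
          exact m0
        rw [he, if_pos hn]
        simp [Finset.sum_add_distrib, Finset.sum_pi_single', m0, m1]
      have := hN' hn
      simp only [hy, Prod.snd_add, Pi.sub_apply, Pi.add_apply, Finset.sum_sub_distrib,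
        Finset.sum_add_distrib, ho]
      linarith
  obtain ⟨A, hA⟩ := (Submodule.mem_span_range_iff_exists_fun ℝ).mp hmem
  refine sameLeaf_of_sum_flowDir A Finset.univ ?_
  rw [hA]
  refine Prod.ext ?_ ?_
  · simp [hy, hr]
  · simp

end Leaves

/-! ### Recutting of polygons -/

section Recut

/-- The reflection in the perpendicular bisector of two distinct points. -/
theorem reflection_perpBisector {A B : ℂ} (h : A ≠ B) (z : ℂ) :
    EuclideanGeometry.reflection (AffineSubspace.perpBisector A B) z =
      A - (B - A) / starRingEnd ℂ (B - A) * starRingEnd ℂ (z - B) := by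
  set D := B - A with hD
  have hD0 : D ≠ 0 := sub_ne_zero.mpr h.symm
  have hD0' : starRingEnd ℂ D ≠ 0 := (map_ne_zero _).mpr hD0
  obtain ⟨t, rfl⟩ : ∃ t, z = A + D * t := ⟨(z - A) / D, by rw [mul_div_cancel₀ _ hD0]; ring⟩
  have hB : B = A + D := by rw [hD]; ring
  have hQ : ((EuclideanGeometry.orthogonalProjection (AffineSubspace.perpBisector A B) (A + D * t) :
      AffineSubspace.perpBisector A B) : ℂ) = A + D * (1 / 2 + t.im * Complex.I) := by
    rw [EuclideanGeometry.coe_orthogonalProjection_eq_iff_mem]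
    constructor
    · rw [AffineSubspace.mem_perpBisector_iff_dist_eq, dist_eq_norm, dist_eq_norm]
      rw [show A + D * (1 / 2 + t.im * Complex.I) - A = D * (1 / 2 + t.im * Complex.I) by ring,
        show A + D * (1 / 2 + t.im * Complex.I) - B = D * (-1 / 2 + t.im * Complex.I) by
          rw [hB]; ring, norm_mul, norm_mul]
      congr 1
      rw [← sq_eq_sq₀ (norm_nonneg _) (norm_nonneg _), ← Complex.normSq_eq_norm_sq,
        ← Complex.normSq_eq_norm_sq, Complex.normSq_apply, Complex.normSq_apply]
      norm_num
    · rw [AffineSubspace.direction_perpBisector]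
      refine Submodule.le_orthogonal_orthogonal _ (Submodule.mem_span_singleton.mpr
        ⟨t.re - 1 / 2, ?_⟩)
      rw [vsub_eq_sub, vsub_eq_sub, ← hD, Complex.real_smul]
      have : t = t.re + t.im * Complex.I := (Complex.re_add_im t).symm
      push_cast
      linear_combination -D * this
  rw [EuclideanGeometry.reflection_apply', hQ, vsub_eq_sub, vadd_eq_add, hB]
  have h1 : starRingEnd ℂ (A + D * t - (A + D)) = starRingEnd ℂ D * (starRingEnd ℂ t - 1) := by
    rw [← map_one (starRingEnd ℂ), ← map_sub, ← map_mul]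
    congr 1
    ring
  have h2 : t - starRingEnd ℂ t = 2 * t.im * Complex.I := by
    apply Complex.ext <;> simp
    ring
  rw [h1, ← mul_assoc, div_mul_cancel₀ _ hD0']
  linear_combination -D * h2

/-- Reflections in perpendicular bisectors are compatible with isometries. -/
theorem reflection_perpBisector_map {A B z : ℂ} (h : A ≠ B) (u : Circle) (b : ℂ) :
    EuclideanGeometry.reflection (AffineSubspace.perpBisector (u * A + b) (u * B + b)) (u * z + b) =
      u * EuclideanGeometry.reflection (AffineSubspace.perpBisector A B) z + b := by
  have hu : (u : ℂ) ≠ 0 := Circle.coe_ne_zero u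
  have h' : (u : ℂ) * A + b ≠ u * B + b := fun e =>
    h (mul_left_cancel₀ hu (add_right_cancel e))
  rw [reflection_perpBisector h, reflection_perpBisector h',
    show (u : ℂ) * B + b - (u * A + b) = u * (B - A) by ring,
    show (u : ℂ) * z + b - (u * B + b) = u * (z - B) by ring, map_mul, map_mul]
  have h1 : starRingEnd ℂ (u : ℂ) ≠ 0 := (map_ne_zero _).mpr hu
  have h2 : starRingEnd ℂ (B - A) ≠ 0 := (map_ne_zero _).mpr (sub_ne_zero.mpr h.symm)
  field_simp
  ring

variable {n : ℕ}

/-- The neighbours of every vertex congruent to `j` are distinct. -/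
def Recuttable (n : ℕ) (j : ℤ) (v : ℤ → ℂ) : Prop :=
  ∀ k, k ≡ j [ZMOD n] → v (k - 1) ≠ v (k + 1)

theorem sub_eq_edge_add_edge (v : ℤ → ℂ) (k : ℤ) :
    v (k + 1) - v (k - 1) = edge v k + edge v (k + 1) := by
  simp [edge]

/-- By periodicity it suffices to look at one vertex. -/
theorem recuttable_of_ne {j : ℤ} (x : PolygonT n) (h : x.v (j - 1) ≠ x.v (j + 1)) :
    Recuttable n j x.v := by
  have hper : ∀ k, x.v (k - 1) ≠ x.v (k + 1) ↔ x.v (k + n - 1) ≠ x.v (k + n + 1) := fun k => by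
    have h1 := sub_eq_edge_add_edge x.v k
    have h2 := sub_eq_edge_add_edge x.v (k + n)
    rw [x.edge_add, show k + n + 1 = (k + 1) + n by ring, x.edge_add, ← mul_add, ← h1] at h2
    rw [ne_comm, ← sub_ne_zero, ne_comm (a := x.v (k + n - 1)),
      ← sub_ne_zero (b := x.v (k + n - 1)), show k + n + 1 = (k + 1) + n by ring, h2,
      mul_ne_zero_iff_left (pow_ne_zero 2 (Circle.coe_ne_zero _))]
  intro k hk
  obtain ⟨m, hm⟩ := hk.symm.dvd
  have := (periodic_iff (Q := fun k => x.v (k - 1) ≠ x.v (k + 1)) hper m j).mp h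
  rwa [show j + n * m = k by rw [← hm]; ring] at this

theorem Recuttable.map {j : ℤ} {v w : ℤ → ℂ} (hv : Recuttable n j v) {u : Circle} {b : ℂ}
    (h : ∀ i, w i = u * v i + b) : Recuttable n j w := fun k hk e => by
  rw [h, h] at e
  exact hv k hk (mul_left_cancel₀ (Circle.coe_ne_zero u) (add_right_cancel e))

theorem recutVertex_map {j : ℤ} {v w : ℤ → ℂ} (hv : Recuttable n j v) {u : Circle} {b : ℂ}
    (h : ∀ i, w i = u * v i + b) (i : ℤ) :
    recutVertex n j w i = u * recutVertex n j v i + b := by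
  unfold recutVertex
  split_ifs with hi
  · rw [← reflection_perpBisector_map (hv i hi) u b]
    simp only [h]
  · exact h i

theorem recutVertex_shift {j m : ℤ} (hm : (n : ℤ) ∣ m) (v : ℤ → ℂ) (i : ℤ) :
    recutVertex n j v (i + m) = recutVertex n j (fun k => v (k + m)) i := by
  have h1 : i + m ≡ j [ZMOD n] ↔ i ≡ j [ZMOD n] := by
    have h2 : i + m ≡ i [ZMOD n] := by
      refine (Int.modEq_iff_dvd.mpr ?_).symm
      rwa [add_sub_cancel_left]
    exact ⟨fun h => h2.symm.trans h, fun h => h2.trans h⟩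
  unfold recutVertex
  simp only [h1, show i + m - 1 = i - 1 + m by ring, show i + m + 1 = i + 1 + m by ring]

theorem recutVertex_mono {j : ℤ} (x : PolygonT n) (hx : Recuttable n j x.v) :
    ∃ b : ℂ, ∀ i, recutVertex n j x.v (i + n) = (x.α : ℂ) ^ 2 * recutVertex n j x.v i + b := by
  obtain ⟨b, hb⟩ := x.mono
  refine ⟨b, fun i => ?_⟩
  rw [recutVertex_shift (dvd_refl _), recutVertex_map (u := x.α ^ 2) (b := b) hx fun i => ?_,
    Circle.coe_pow]
  rw [hb, Circle.coe_pow]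

theorem not_modEq_sub_one (hn : 2 ≤ n) {k j : ℤ} (h : k ≡ j [ZMOD n]) : ¬ k - 1 ≡ j [ZMOD n] :=
  fun h' => by
    have h1 := (h'.trans h.symm).dvd
    rw [sub_sub_cancel] at h1
    have := Int.le_of_dvd one_pos h1
    omega

theorem edge_recut_self (hn : 2 ≤ n) {j k : ℤ} {v : ℤ → ℂ} (hv : Recuttable n j v)
    (hk : k ≡ j [ZMOD n]) : edge (recutVertex n j v) k = (edge v k + edge v (k + 1)) /
      starRingEnd ℂ (edge v k + edge v (k + 1)) * starRingEnd ℂ (edge v (k + 1)) := by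
  rw [edge, recutVertex, if_pos hk, recutVertex, if_neg (not_modEq_sub_one hn hk),
    reflection_perpBisector (hv k hk), sub_eq_edge_add_edge,
    show v k - v (k + 1) = -edge v (k + 1) by simp [edge], map_neg]
  ring

theorem edge_recut_succ (hn : 2 ≤ n) {j k : ℤ} {v : ℤ → ℂ} (hv : Recuttable n j v)
    (hk : k ≡ j [ZMOD n]) : edge (recutVertex n j v) (k + 1) = (edge v k + edge v (k + 1)) /
      starRingEnd ℂ (edge v k + edge v (k + 1)) * starRingEnd ℂ (edge v k) := by
  have h1 : ¬ k + 1 ≡ j [ZMOD n] := fun h => not_modEq_sub_one hn h (by simpa using hk)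
  have hD : v (k + 1) - v (k - 1) ≠ 0 := sub_ne_zero.mpr (hv k hk).symm
  have hD' : starRingEnd ℂ (v (k + 1) - v (k - 1)) ≠ 0 := (map_ne_zero _).mpr hD
  have h2 : v k - v (k + 1) = edge v k - (v (k + 1) - v (k - 1)) := by rw [edge]; ring
  rw [edge, recutVertex, if_neg h1, add_sub_cancel_right, recutVertex, if_pos hk,
    reflection_perpBisector (hv k hk), h2, ← sub_eq_edge_add_edge,
    map_sub (starRingEnd ℂ) (edge v k), mul_sub,
    div_mul_cancel₀ _ hD']
  ring

theorem edge_recut_of_ne {j k : ℤ} {v : ℤ → ℂ} (h1 : ¬ k ≡ j [ZMOD n])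
    (h2 : ¬ k - 1 ≡ j [ZMOD n]) : edge (recutVertex n j v) k = edge v k := by
  rw [edge, recutVertex, if_neg h1, recutVertex, if_neg h2, edge]

/-- The polygon obtained by recutting. -/
def recutPolygon (hn : 2 ≤ n) (j : ℤ) (x : PolygonT n) (hx : Recuttable n j x.v) : PolygonT n where
  v := recutVertex n j x.v
  α := x.α
  ne := ne_of_edge_ne_zero fun k => by
    have hz := x.edge_ne
    have hS : ∀ k, k ≡ j [ZMOD n] → (edge x.v k + edge x.v (k + 1)) ≠ 0 := fun k hk => by
      rw [← sub_eq_edge_add_edge]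
      exact sub_ne_zero.mpr (hx k hk).symm
    by_cases h1 : k ≡ j [ZMOD n]
    · rw [edge_recut_self hn hx h1]
      exact mul_ne_zero (div_ne_zero (hS k h1) ((map_ne_zero _).mpr (hS k h1)))
        ((map_ne_zero _).mpr (hz _))
    · by_cases h2 : k - 1 ≡ j [ZMOD n]
      · have := edge_recut_succ hn hx h2
        rw [sub_add_cancel] at this
        rw [this]
        have h3 := hS _ h2
        rw [sub_add_cancel] at h3
        exact mul_ne_zero (div_ne_zero h3 ((map_ne_zero _).mpr h3)) ((map_ne_zero _).mpr (hz _))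
      · rw [edge_recut_of_ne h1 h2]
        exact hz k
  mono := recutVertex_mono x hx

theorem recuttable_of_mem {j : ℤ} {x : PolygonT n}
    (h : (Quotient.mk _ x : SpaceT n) ∈ recutDomain n j) : Recuttable n j x.v :=
  recuttable_of_ne x (h x rfl)

theorem mem_recutDomain_iff {j : ℤ} {x : PolygonT n} :
    (Quotient.mk _ x : SpaceT n) ∈ recutDomain n j ↔ x.v (j - 1) ≠ x.v (j + 1) := by
  refine ⟨fun h => h x rfl, fun h y hy => ?_⟩
  obtain ⟨u, b, hu⟩ := (Quotient.exact hy.symm).1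
  exact ((recuttable_of_ne x h).map hu) j rfl

/-- The recutting map for `n ≥ 2`, defined by choosing representatives. For `n = 1` adjacent vertices
are reflected simultaneously and the formulas for the edges do not apply. -/
def recutMap (hn : 2 ≤ n) (j : ℤ) (X : recutDomain n j) : SpaceT n :=
  Quotient.mk _ (recutPolygon hn j X.1.out
    (recuttable_of_mem (by rw [Quotient.out_eq]; exact X.2)))

theorem recutMap_mk (hn : 2 ≤ n) (j : ℤ) (x : PolygonT n)
    (hx : (Quotient.mk _ x : SpaceT n) ∈ recutDomain n j) : recutMap hn j ⟨Quotient.mk _ x, hx⟩ =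
      Quotient.mk _ (recutPolygon hn j x (recuttable_of_mem hx)) := by
  obtain ⟨⟨u, b, hu⟩, hα⟩ := Quotient.exact (Quotient.out_eq (Quotient.mk _ x : SpaceT n)).symm
  symm
  unfold recutMap
  exact Quotient.sound ⟨⟨u, b, recutVertex_map (recuttable_of_mem hx) hu⟩, hα⟩

theorem isRecutting_recutMap (hn : 2 ≤ n) (j : ℤ) : IsRecutting n j (recutMap hn j) :=
  fun x hx => ⟨recutPolygon hn j x (recuttable_of_mem hx), rfl, rfl, recutMap_mk hn j x hx⟩

/-- For `n = 1` all edges have the same length, so that every vertex lies on the perpendicular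
bisector of its neighbours. -/
theorem recutVertex_one (j : ℤ) (x : PolygonT 1) : recutVertex 1 j x.v = x.v := by
  funext i
  unfold recutVertex
  split_ifs
  · rw [EuclideanGeometry.reflection_eq_self_iff, AffineSubspace.mem_perpBisector_iff_dist_eq,
      dist_eq_norm, dist_comm, dist_eq_norm]
    have h1 := x.toE.norm_edge_add i
    have h2 : edge x.v (i + 1) = x.v (i + 1) - x.v i := by simp [edge]
    change ‖edge x.v i‖ = _
    rw [← h2]
    exact h1.symm
  · rfl

theorem recutVertex_add_period (j : ℤ) : recutVertex n (j + n) = recutVertex n j := by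
  funext v i
  have : i ≡ j + n [ZMOD n] ↔ i ≡ j [ZMOD n] := by simp [Int.ModEq]
  unfold recutVertex
  simp only [this]

theorem recutDomain_add_period (j : ℤ) : recutDomain n (j + n) = recutDomain n j := by
  ext X
  obtain ⟨x, rfl⟩ := Quotient.exists_rep X
  have h1 : j + n ≡ j [ZMOD n] := by simp [Int.ModEq]
  rw [mem_recutDomain_iff, mem_recutDomain_iff]
  refine ⟨fun h => recuttable_of_ne x h j h1.symm, fun h => recuttable_of_ne x h _ h1⟩

end Recut

/-! ### Invariance of the bracket under recutting -/

section RecutInvariance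

variable {n : ℕ} [NeZero n]

/-- The diagonal `v_{i+1} - v_{i-1}` in coordinates. -/
def diagonalCoord (i : Fin n) (v : (Fin n → ℂ) × ℝ) : ℂ := v.1 i + wrapFactor i v.2 * v.1 (i + 1)

/-- Recutting in the coordinates of the double cover. -/
def recutCoord (i : Fin n) (v : (Fin n → ℂ) × ℝ) : (Fin n → ℂ) × ℝ :=
  (Function.update (Function.update v.1 (i + 1) ((wrapFactor i v.2)⁻¹ *
      (diagonalCoord i v * (starRingEnd ℂ (diagonalCoord i v))⁻¹ * starRingEnd ℂ (v.1 i))))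
    i (diagonalCoord i v * (starRingEnd ℂ (diagonalCoord i v))⁻¹ *
      starRingEnd ℂ (wrapFactor i v.2 * v.1 (i + 1))), v.2)

theorem wrapFactor_mul_edge (p : ParT n) (i : Fin n) :
    wrapFactor i p.1.2 * edge p.1.1.v ((i + 1 : Fin n).val + 1) = edge p.1.1.v (i.val + 1 + 1) := by
  rw [p.1.1.edge_succ, p.2]
  rfl

theorem diagonalCoord_cT (p : ParT n) (i : Fin n) :
    diagonalCoord i (cT n p) = edge p.1.1.v (i.val + 1) + edge p.1.1.v (i.val + 1 + 1) := by
  rw [← wrapFactor_mul_edge]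
  rfl

theorem qT_mem_recutDomain_iff (p : ParT n) (i : Fin n) :
    qT n p ∈ recutDomain n (i.val + 1) ↔ diagonalCoord i (cT n p) ≠ 0 := by
  rw [diagonalCoord_cT, ← sub_eq_edge_add_edge, sub_ne_zero, ne_comm]
  exact mem_recutDomain_iff

theorem continuous_diagonalCoord (i : Fin n) : Continuous (diagonalCoord i) :=
  ((continuous_apply i).comp continuous_fst).add
    (((contDiff_wrapFactor i).continuous.comp continuous_snd).mul
      ((continuous_apply (i + 1)).comp continuous_fst))

theorem isOpen_range_recutDomain (i : Fin n) : IsOpen (Set.range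
    fun p : {p : ParT n // qT n p ∈ recutDomain n (i.val + 1)} => cT n p.1) := by
  have h : (Set.range fun p : {p : ParT n // qT n p ∈ recutDomain n (i.val + 1)} => cT n p.1) =
      Set.range (cT n) ∩ {v | diagonalCoord i v ≠ 0} := by
    ext v
    constructor
    · rintro ⟨⟨p, hp⟩, rfl⟩
      exact ⟨⟨p, rfl⟩, (qT_mem_recutDomain_iff p i).mp hp⟩
    · rintro ⟨⟨p, rfl⟩, hp⟩
      exact ⟨⟨p, (qT_mem_recutDomain_iff p i).mpr hp⟩, rfl⟩
  rw [h]
  exact isOpen_range_cT.inter (isOpen_ne_fun (continuous_diagonalCoord i) continuous_const)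

/-- The restriction of the bracket to an open subset of the double cover. -/
def restrictedBracket (D : Set (SpaceT n))
    (hD : IsOpen (Set.range fun p : {p : ParT n // qT n p ∈ D} => cT n p.1)) :
    PoissonBracket (smoothFnsOn (qT n) (cT n) D) :=
  ((fieldsT n).restrict D hD).poisson orderSign orderSign_skew

/-- The derivative along the rotation of the `k`-th edge on an open subset of the double cover. -/
def restrictedDer (D : Set (SpaceT n))
    (hD : IsOpen (Set.range fun p : {p : ParT n // qT n p ∈ D} => cT n p.1)) (k : Fin n) :
    Derivation ℝ (smoothFnsOn (qT n) (cT n) D) (smoothFnsOn (qT n) (cT n) D) :=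
  ((fieldsT n).restrict D hD).der k

section

variable {D : Set (SpaceT n)}
  (hD : IsOpen (Set.range fun p : {p : ParT n // qT n p ∈ D} => cT n p.1))

theorem restrictedBracket_apply (f g : smoothFnsOn (qT n) (cT n) D) (X : D) :
    ((restrictedBracket D hD).br f g).1 X = ∑ i, ∑ j, orderSign i j *
      ((restrictedDer D hD i f).1 X * (restrictedDer D hD j g).1 X) :=
  ((fieldsT n).restrict D hD).poisson_apply orderSign orderSign_skew f g X

theorem restrictedDer_apply (k : Fin n) (f : smoothFnsOn (qT n) (cT n) D)
    {F : (Fin n → ℂ) × ℝ → ℝ}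
    (hF : Represents (fun p : {p : ParT n // qT n p ∈ D} => (⟨qT n p.1, p.2⟩ : D))
      (fun p => cT n p.1) F f.1) (p : ParT n) (hp : qT n p ∈ D) :
    (restrictedDer D hD k f).1 ⟨qT n p, hp⟩ = fderiv ℝ F (cT n p) (rotFieldT k (cT n p)) :=
  ((fieldsT n).restrict D hD).der_apply k f hF ⟨p, hp⟩

end

theorem isPoissonMap_val (D : Set (SpaceT n))
    (hD : IsOpen (Set.range fun p : {p : ParT n // qT n p ∈ D} => cT n p.1)) :
    IsPoissonMap (restrictedBracket D hD) (bracketT n) Subtype.val := by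
  have hrep : ∀ {f : SpaceT n → ℝ} {F}, Represents (qT n) (cT n) F f →
      Represents (fun p : {p : ParT n // qT n p ∈ D} => (⟨qT n p.1, p.2⟩ : D))
        (fun p => cT n p.1) F (f ∘ Subtype.val) := fun hF =>
    ⟨hF.1.mono (by rintro _ ⟨p, rfl⟩; exact ⟨p.1, rfl⟩), fun p => hF.2 p.1⟩
  have hmem : ∀ f : smoothT n, f.1 ∘ Subtype.val ∈ smoothFnsOn (qT n) (cT n) D := fun f =>
    ⟨f.2.choose, hrep f.2.choose_spec⟩
  refine ⟨hmem, fun f g => funext fun X => ?_⟩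
  have hder : ∀ (f : smoothT n) (k : Fin n),
      (restrictedDer D hD k ⟨f.1 ∘ Subtype.val, hmem f⟩).1 X = (derT k f).1 X.1 := fun f k => by
    obtain ⟨F, hF⟩ := f.2
    obtain ⟨X, hX⟩ := X
    obtain ⟨p, rfl⟩ := surjective_qT X
    rw [restrictedDer_apply hD k ⟨f.1 ∘ Subtype.val, hmem f⟩ (hrep hF)]
    exact (derT_apply k f hF p).symm
  rw [restrictedBracket_apply, Function.comp_apply, bracketT_apply]
  simp only [hder]

theorem add_one_ne_self (hn : 2 ≤ n) (i : Fin n) : i + 1 ≠ i := fun h => by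
  have h1 : ((i + 1 : Fin n).val : ℤ) = i.val := by rw [h]
  rcases val_add_one_cases i with h2 | ⟨h2, h3⟩ <;> omega

theorem eq_of_val_modEq {n : ℕ} {a b : Fin n} (h : (a.val : ℤ) ≡ b.val [ZMOD n]) : a = b := by
  have h1 : (a.val : ℤ) = b.val := by
    rw [Int.ModEq, Int.emod_eq_of_lt (by omega) (by exact_mod_cast a.2),
      Int.emod_eq_of_lt (by omega) (by exact_mod_cast b.2)] at h
    exact h
  exact Fin.ext (by exact_mod_cast h1)

theorem val_add_one_modEq (i : Fin n) : ((i + 1 : Fin n).val : ℤ) ≡ i.val + 1 [ZMOD n] := by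
  rcases val_add_one_cases i with h | ⟨h, h'⟩
  · rw [h]
  · rw [h', show ((i.val : ℤ) + 1) = n by omega]
    simp [Int.ModEq]

/-- The recut polygon, with the same argument of `α`. -/
def recutParT {n : ℕ} (hn : 2 ≤ n) (i : Fin n) (p : ParT n) (h : qT n p ∈ recutDomain n (i.val + 1)) :
    ParT n := ⟨(recutPolygon hn (i.val + 1) p.1.1 (recuttable_of_mem h), p.1.2), p.2⟩

theorem cT_recutParT (hn : 2 ≤ n) (i : Fin n) (p : ParT n)
    (h : qT n p ∈ recutDomain n (i.val + 1)) :
    cT n (recutParT hn i p h) = recutCoord i (cT n p) := by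
  have hR : Recuttable n (i.val + 1) p.1.1.v := recuttable_of_mem h
  refine Prod.ext (funext fun m => ?_) rfl
  change edge (recutVertex n (i.val + 1) p.1.1.v) (m.val + 1) = (recutCoord i (cT n p)).1 m
  unfold recutCoord
  simp only [diagonalCoord_cT]
  rcases eq_or_ne m i with rfl | h1
  · rw [Function.update_self, edge_recut_self hn hR rfl, div_eq_mul_inv]
    congr 2
    exact (wrapFactor_mul_edge p m).symm
  · rw [Function.update_of_ne h1]
    rcases eq_or_ne m (i + 1) with rfl | h2
    · have h3 := wrapFactor_mul_edge (recutParT hn i p h) i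
      change wrapFactor i p.1.2 * edge (recutVertex n (i.val + 1) p.1.1.v) _ =
        edge (recutVertex n (i.val + 1) p.1.1.v) _ at h3
      rw [edge_recut_succ hn hR rfl, ← eq_inv_mul_iff_mul_eq₀ (wrapFactor_ne_zero i _)] at h3
      rw [Function.update_self, h3, div_eq_mul_inv]
      rfl
    · rw [Function.update_of_ne h2]
      refine edge_recut_of_ne (fun h3 => h1 (eq_of_val_modEq (Int.ModEq.add_right_cancel' 1 h3)))
        fun h3 => h2 (eq_of_val_modEq ?_)
      rw [add_sub_cancel_right] at h3
      exact h3.trans (val_add_one_modEq i).symm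

theorem qT_recutParT {n : ℕ} (hn : 2 ≤ n) (i : Fin n) (p : ParT n)
    (h : qT n p ∈ recutDomain n (i.val + 1)) :
    recutMap hn (i.val + 1) ⟨qT n p, h⟩ = qT n (recutParT hn i p h) :=
  recutMap_mk hn _ p.1.1 h

theorem contDiffAt_recutCoord {i : Fin n} {v : (Fin n → ℂ) × ℝ} (hv : diagonalCoord i v ≠ 0) :
    ContDiffAt ℝ ∞ (recutCoord i) v := by
  have hz : ∀ k, ContDiff ℝ ∞ fun v : (Fin n → ℂ) × ℝ => v.1 k := fun k =>
    (contDiff_apply ℝ ℂ k).comp contDiff_fst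
  have hw : ContDiff ℝ ∞ fun v : (Fin n → ℂ) × ℝ => wrapFactor i v.2 :=
    (contDiff_wrapFactor i).comp contDiff_snd
  have hS : ContDiff ℝ ∞ (diagonalCoord i) := (hz i).add (hw.mul (hz (i + 1)))
  have hc : ∀ {g : (Fin n → ℂ) × ℝ → ℂ}, ContDiff ℝ ∞ g →
      ContDiff ℝ ∞ fun v => starRingEnd ℂ (g v) := fun hg => Complex.conjCLE.contDiff.comp hg
  have hq : ContDiffAt ℝ ∞ (fun v => diagonalCoord i v * (starRingEnd ℂ (diagonalCoord i v))⁻¹) v :=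
    hS.contDiffAt.mul ((hc hS).contDiffAt.fun_inv ((map_ne_zero _).mpr hv))
  refine ContDiffAt.prodMk (contDiffAt_pi.mpr fun m => ?_) contDiff_snd.contDiffAt
  rcases eq_or_ne m i with rfl | h1
  · simp only [Function.update_self]
    exact hq.mul (hc (hw.mul (hz _))).contDiffAt
  · simp only [Function.update_of_ne h1]
    rcases eq_or_ne m (i + 1) with rfl | h2
    · simp only [Function.update_self]
      exact (hw.contDiffAt.fun_inv (wrapFactor_ne_zero _ _)).mul (hq.mul (hc (hz i)).contDiffAt)
    · simp only [Function.update_of_ne h2]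
      exact (hz m).contDiffAt

/-- The reflection formula for an edge, differentiated along rotations of the two edges `a`, `b` at
the recut vertex with speeds `u`, `w`: the reflected edge rotates, too. -/
theorem hasDerivAt_reflected_edge {a b : ℂ} (h : a + b ≠ 0) (u w : ℝ) :
    HasDerivAt (fun s : ℝ =>
      (Complex.exp ((u * s : ℝ) * Complex.I) * a + Complex.exp ((w * s : ℝ) * Complex.I) * b) *
      (starRingEnd ℂ (Complex.exp ((u * s : ℝ) * Complex.I) * a +
        Complex.exp ((w * s : ℝ) * Complex.I) * b))⁻¹ *
      starRingEnd ℂ (Complex.exp ((w * s : ℝ) * Complex.I) * b))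
      (((2 * ((u * a + w * b) / (a + b)).re - w : ℝ) : ℂ) *
        (Complex.I * ((a + b) * (starRingEnd ℂ (a + b))⁻¹ * starRingEnd ℂ b))) 0 := by
  have hc : ∀ {g : ℝ → ℂ} {g' : ℂ}, HasDerivAt g g' 0 →
      HasDerivAt (fun s => starRingEnd ℂ (g s)) (starRingEnd ℂ g') 0 := fun hg =>
    Complex.conjCLE.toContinuousLinearMap.hasFDerivAt.comp_hasDerivAt 0 hg
  have ha := hasDerivAt_exp_mul u a
  have hb := hasDerivAt_exp_mul w b
  have h0 : ∀ (c : ℝ) (z : ℂ), Complex.exp ((c * (0 : ℝ) : ℝ) * Complex.I) * z = z := by simp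
  have hS := ha.fun_add hb
  have h' : starRingEnd ℂ a + starRingEnd ℂ b ≠ 0 := by
    rw [← map_add]; exact (map_ne_zero _).mpr h
  have hne : starRingEnd ℂ (Complex.exp ((u * (0 : ℝ) : ℝ) * Complex.I) * a +
        Complex.exp ((w * (0 : ℝ) : ℝ) * Complex.I) * b) ≠ 0 := by
    rw [h0, h0, map_add]; exact h'
  refine ((hS.fun_mul ((hc hS).fun_inv hne)).fun_mul (hc hb)).congr_deriv ?_
  have hre : ∀ z : ℂ, ((z.re : ℝ) : ℂ) = (z + starRingEnd ℂ z) / 2 := fun z => by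
    rw [Complex.add_conj]; push_cast; ring
  simp only [h0]
  push_cast
  rw [hre]
  simp only [map_div₀, map_add, map_mul, Complex.conj_ofReal, Complex.conj_I]
  field_simp
  ring

/-- The amount by which recutting changes the speeds of rotation of the two edges at the recut
vertex. -/
def recutSpeed (i : Fin n) (v : (Fin n → ℂ) × ℝ) (w : Fin n → ℝ) : ℝ :=
  2 * ((w i * v.1 i + w (i + 1) * (wrapFactor i v.2 * v.1 (i + 1))) / diagonalCoord i v).re -
    w i - w (i + 1)

/-- Recutting maps the rotation of edges with speeds `w` to the same rotation, up to a multiple of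
the simultaneous rotation of the two edges at the recut vertex. -/
theorem hasDerivAt_recutCoord (hn : 2 ≤ n) {i : Fin n} {v : (Fin n → ℂ) × ℝ}
    (hv : diagonalCoord i v ≠ 0) (w : Fin n → ℝ) :
    HasDerivAt (fun s => recutCoord i (rotCurve w 0 v s))
      (∑ k, w k • rotFieldT k (recutCoord i v) + recutSpeed i v w •
        (rotFieldT i (recutCoord i v) + rotFieldT (i + 1) (recutCoord i v))) 0 := by
  have hi := add_one_ne_self hn i
  have hd : ∀ s, diagonalCoord i (rotCurve w 0 v s) =
      Complex.exp ((w i * s : ℝ) * Complex.I) * v.1 i +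
        Complex.exp ((w (i + 1) * s : ℝ) * Complex.I) * (wrapFactor i v.2 * v.1 (i + 1)) := by
    intro s
    simp only [diagonalCoord, rotCurve, zero_mul, add_zero]
    ring
  have h1 : HasDerivAt (fun s => recutCoord i (rotCurve w 0 v s))
      (fun k => ((w k + recutSpeed i v w * ((if k = i then 1 else 0) +
        (if k = i + 1 then 1 else 0)) : ℝ) : ℂ) * (Complex.I * (recutCoord i v).1 k), 0) 0 := by
    refine HasDerivAt.prodMk (hasDerivAt_pi.mpr fun k => ?_) ?_
    · simp only [hd]
      rcases eq_or_ne k i with rfl | h1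
      · simp only [Function.update_self, recutCoord]
        refine ((hasDerivAt_reflected_edge hv (w k) (w (k + 1))).congr_of_eventuallyEq
          (Filter.Eventually.of_forall fun s => ?_)).congr_deriv ?_
        · simp only [rotCurve, zero_mul, add_zero]
          congr 2
          ring
        · simp only [if_true, if_neg hi.symm, recutSpeed]
          congr 2
          simp only [diagonalCoord]
          ring
      · rcases eq_or_ne k (i + 1) with rfl | h2
        · simp only [Function.update_self, Function.update_of_ne h1, recutCoord]
          have hv' : wrapFactor i v.2 * v.1 (i + 1) + v.1 i ≠ 0 := by rw [add_comm]; exact hv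
          refine (((hasDerivAt_reflected_edge hv' (w (i + 1)) (w i)).const_mul
            (wrapFactor i v.2)⁻¹).congr_of_eventuallyEq
            (Filter.Eventually.of_forall fun s => ?_)).congr_deriv ?_
          · simp only [rotCurve, zero_mul, add_zero]
            rw [add_comm (Complex.exp ((w i * s : ℝ) * Complex.I) * v.1 i)]
          · simp only [if_true, if_neg h1, recutSpeed]
            have h3 : diagonalCoord i v = wrapFactor i v.2 * v.1 (i + 1) + v.1 i := add_comm _ _
            rw [h3, add_comm ((w i : ℂ) * v.1 i)]
            push_cast
            ring
        · simp only [Function.update_of_ne h1, Function.update_of_ne h2, recutCoord]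
          refine (hasDerivAt_exp_mul (w k) (v.1 k)).congr_deriv ?_
          rw [if_neg h1, if_neg h2]
          simp
    · simpa [recutCoord, rotCurve] using hasDerivAt_const (0 : ℝ) v.2
  convert h1 using 1
  refine Prod.ext (funext fun k => ?_) ?_
  · simp only [rotFieldT_apply, Prod.fst_add, Prod.fst_sum, Prod.smul_fst, Pi.add_apply,
      Finset.sum_apply, Pi.smul_apply, Pi.single_apply]
    simp only [Complex.real_smul, mul_ite, mul_zero, Finset.sum_ite_eq, Finset.mem_univ, if_true]
    rcases eq_or_ne k i with rfl | h1
    · simp only [if_true, if_neg hi.symm]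
      push_cast
      ring
    · rcases eq_or_ne k (i + 1) with rfl | h2
      · simp only [if_true, if_neg h1]
        push_cast
        ring
      · simp only [if_neg h1, if_neg h2]
        push_cast
        ring
  · simp [rotFieldT_apply, Prod.snd_sum]

end RecutInvariance

section RecutPoisson

variable {n : ℕ} [NeZero n]

theorem orderSign_sub_orderSign_succ (i : Fin n) : ∃ c : ℝ, ∀ l, orderSign i l - orderSign (i + 1) l =
    c - (if l = i then 1 else 0) - (if l = i + 1 then 1 else 0) := by
  have hi := i.2
  rcases val_add_one_cases i with h | ⟨h, h'⟩
  · refine ⟨0, fun l => ?_⟩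
    unfold orderSign
    simp only [Fin.lt_def, Fin.ext_iff]
    rcases lt_trichotomy i.val l.val with h1 | h1 | h1 <;>
    rcases lt_trichotomy (i.val + 1) l.val with h2 | h2 | h2 <;>
    first
    | omega
    | (simp (disch := omega) only [if_pos, if_neg]; norm_num)
  · refine ⟨2, fun l => ?_⟩
    have hl := l.2
    unfold orderSign
    simp only [Fin.lt_def, Fin.ext_iff]
    rcases lt_trichotomy i.val l.val with h1 | h1 | h1 <;>
    rcases eq_or_ne l.val 0 with h2 | h2 <;>
    first
    | omega
    | (simp (disch := omega) only [if_pos, if_neg]; norm_num)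

theorem sum_orderSign_sub {w : Fin n → ℝ} (hw : ∑ l, w l = 0) (i : Fin n) :
    ∑ l, (orderSign i l - orderSign (i + 1) l) * w l = -(w i + w (i + 1)) := by
  obtain ⟨c, hc⟩ := orderSign_sub_orderSign_succ i
  simp only [hc, sub_mul, Finset.sum_sub_distrib, ← Finset.mul_sum, hw, ite_mul, one_mul, zero_mul,
    Finset.sum_ite_eq', Finset.mem_univ, if_true]
  ring

/-- The bilinear form of the bracket is invariant under the linear map by which recutting acts on
the derivatives along rotations of the edges. -/
theorem sum_orderSign_transvection {a b : Fin n → ℝ} (ha : ∑ l, a l = 0) (hb : ∑ l, b l = 0)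
    {i : Fin n} (hi : i + 1 ≠ i) (c : ℝ) :
    ∑ k, ∑ l, orderSign k l *
      ((a k + c * ((if k = i then 1 else 0) - (if k = i + 1 then 1 else 0)) * (a i + a (i + 1))) *
        (b l + c * ((if l = i then 1 else 0) - (if l = i + 1 then 1 else 0)) *
          (b i + b (i + 1)))) = ∑ k, ∑ l, orderSign k l * (a k * b l) := by
  set d : Fin n → ℝ := fun k => (if k = i then 1 else 0) - (if k = i + 1 then 1 else 0) with hd
  have hd0 : ∑ l, d l = 0 := by simp [hd]
  have hd1 : d i + d (i + 1) = 0 := by simp [hd, hi, hi.symm]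
  have hdw : ∀ w : Fin n → ℝ, ∑ l, w l = 0 →
      ∑ k, ∑ l, orderSign k l * (d k * w l) = -(w i + w (i + 1)) := fun w hw => by
    rw [Finset.sum_comm, ← sum_orderSign_sub hw i]
    refine Finset.sum_congr rfl fun l _ => ?_
    simp only [hd, sub_mul, mul_sub, Finset.sum_sub_distrib, ite_mul, mul_ite, one_mul, zero_mul,
      mul_zero, Finset.sum_ite_eq', Finset.mem_univ, if_true]
  have hwd : ∑ k, ∑ l, orderSign k l * (a k * d l) = a i + a (i + 1) := by
    rw [← neg_eq_iff_eq_neg.mpr (hdw a ha), Finset.sum_comm, ← Finset.sum_neg_distrib]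
    refine Finset.sum_congr rfl fun k _ => ?_
    rw [← Finset.sum_neg_distrib]
    refine Finset.sum_congr rfl fun l _ => ?_
    rw [orderSign_skew]
    ring
  have hexp : ∀ k l, orderSign k l * ((a k + c * d k * (a i + a (i + 1))) *
      (b l + c * d l * (b i + b (i + 1)))) = orderSign k l * (a k * b l) +
      c * (b i + b (i + 1)) * (orderSign k l * (a k * d l)) +
      c * (a i + a (i + 1)) * (orderSign k l * (d k * b l)) +
      c * c * (a i + a (i + 1)) * (b i + b (i + 1)) * (orderSign k l * (d k * d l)) := fun k l => by
    ring
  change ∑ k, ∑ l, orderSign k l * ((a k + c * d k * (a i + a (i + 1))) *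
    (b l + c * d l * (b i + b (i + 1)))) = _
  simp only [hexp, Finset.sum_add_distrib, ← Finset.mul_sum]
  rw [hwd, hdw b hb, hdw d hd0, hd1]
  ring

/-- Only the rotations of the two edges at the recut vertex are affected, in opposite ways. -/
theorem recutSpeed_single {i : Fin n} (hi : i + 1 ≠ i) {v : (Fin n → ℂ) × ℝ}
    (hv : diagonalCoord i v ≠ 0) (k : Fin n) : recutSpeed i v (Pi.single k 1) =
      (2 * (v.1 i / diagonalCoord i v).re - 1) *
        ((if k = i then 1 else 0) - (if k = i + 1 then 1 else 0)) := by
  unfold recutSpeed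
  rcases eq_or_ne k i with rfl | h1
  · rw [Pi.single_eq_same, Pi.single_eq_of_ne hi, if_pos rfl, if_neg hi.symm]
    simp
  · rcases eq_or_ne k (i + 1) with rfl | h2
    · rw [Pi.single_eq_same, Pi.single_eq_of_ne hi.symm, if_neg hi, if_pos rfl]
      have h3 : wrapFactor i v.2 * v.1 (i + 1) / diagonalCoord i v =
          1 - v.1 i / diagonalCoord i v := by
        rw [eq_sub_iff_add_eq, ← add_div, add_comm]
        exact div_self hv
      simp only [Complex.ofReal_zero, Complex.ofReal_one, zero_mul, one_mul, zero_add, h3,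
        Complex.sub_re, Complex.one_re]
      ring
    · rw [Pi.single_eq_of_ne h1.symm, Pi.single_eq_of_ne h2.symm, if_neg h1, if_neg h2]
      simp

theorem represents_comp_recutMap (hn : 2 ≤ n) (i : Fin n) {f : SpaceT n → ℝ}
    {F : (Fin n → ℂ) × ℝ → ℝ} (hF : Represents (qT n) (cT n) F f) :
    Represents (fun p : {p : ParT n // qT n p ∈ recutDomain n (i.val + 1)} =>
      (⟨qT n p.1, p.2⟩ : recutDomain n (i.val + 1))) (fun p => cT n p.1)
      (fun v => F (recutCoord i v)) (f ∘ recutMap hn (i.val + 1)) := by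
  constructor
  · rintro _ ⟨⟨p, hp⟩, rfl⟩
    have h1 : ContDiffAt ℝ ∞ F (recutCoord i (cT n p)) := by
      rw [← cT_recutParT hn i p hp]
      exact hF.1.contDiffAt (isOpen_range_cT.mem_nhds ⟨_, rfl⟩)
    exact (h1.comp _ (contDiffAt_recutCoord
      ((qT_mem_recutDomain_iff p i).mp hp))).contDiffWithinAt
  · rintro ⟨p, hp⟩
    rw [Function.comp_apply, qT_recutParT, hF.2, cT_recutParT]

theorem restrictedDer_comp_recutMap (hn : 2 ≤ n) (i k : Fin n) (f : smoothT n)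
    (hf : f.1 ∘ recutMap hn (i.val + 1) ∈ smoothFnsOn (qT n) (cT n) (recutDomain n (i.val + 1)))
    (p : ParT n) (hp : qT n p ∈ recutDomain n (i.val + 1)) :
    (restrictedDer _ (isOpen_range_recutDomain i) k ⟨_, hf⟩).1 ⟨qT n p, hp⟩ =
      (derT k f).1 (qT n (recutParT hn i p hp)) + recutSpeed i (cT n p) (Pi.single k 1) *
        ((derT i f).1 (qT n (recutParT hn i p hp)) +
          (derT (i + 1) f).1 (qT n (recutParT hn i p hp))) := by
  obtain ⟨F, hF⟩ := f.2
  have hR := represents_comp_recutMap hn i hF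
  have hv := (qT_mem_recutDomain_iff p i).mp hp
  rw [restrictedDer_apply _ k ⟨_, hf⟩ hR]
  simp only [derT_apply _ f hF, cT_recutParT]
  have h1 : HasFDerivAt (fun v => F (recutCoord i v)) (fderiv ℝ (fun v => F (recutCoord i v))
      (cT n p)) (rotCurve (Pi.single k 1) 0 (cT n p) 0) := by
    rw [rotCurve_zero]
    exact (hR.differentiableAt (isOpen_range_recutDomain i) ⟨p, hp⟩).hasFDerivAt
  have h2 : HasFDerivAt F (fderiv ℝ F (recutCoord i (cT n p)))
      (recutCoord i (rotCurve (Pi.single k 1) 0 (cT n p) 0)) := by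
    rw [rotCurve_zero, ← cT_recutParT hn i p hp]
    exact (hF.differentiableAt isOpen_range_cT _).hasFDerivAt
  have h2' : HasDerivAt (fun s => F (recutCoord i (rotCurve (Pi.single k 1) 0 (cT n p) s))) _ 0 :=
    h2.comp_hasDerivAt 0 (hasDerivAt_recutCoord hn hv (Pi.single k 1))
  have h3 := (h1.comp_hasDerivAt 0 (hasDerivAt_rotCurve _ _ _)).unique h2'
  have h4 : ∀ v, ∑ l, (Pi.single k (1 : ℝ) : Fin n → ℝ) l • rotFieldT l v = rotFieldT k v :=
    fun v => by
      rw [Finset.sum_eq_single k (fun l _ hl => by rw [Pi.single_eq_of_ne hl, zero_smul]) (by simp),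
        Pi.single_eq_same, one_smul]
  rw [h4, h4, zero_smul, add_zero] at h3
  rw [h3, map_add, map_smul, map_add, smul_eq_mul]

theorem isPoissonMap_recutMap (hn : 2 ≤ n) (i : Fin n) :
    IsPoissonMap (restrictedBracket _ (isOpen_range_recutDomain i)) (bracketT n)
      (recutMap hn (i.val + 1)) := by
  have hi := add_one_ne_self hn i
  have hmem : ∀ f : smoothT n, f.1 ∘ recutMap hn (i.val + 1) ∈
      smoothFnsOn (qT n) (cT n) (recutDomain n (i.val + 1)) := fun f =>
    ⟨_, represents_comp_recutMap hn i f.2.choose_spec⟩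
  refine ⟨hmem, fun f g => funext fun X => ?_⟩
  obtain ⟨X, hX⟩ := X
  obtain ⟨p, rfl⟩ := surjective_qT X
  have hv := (qT_mem_recutDomain_iff p i).mp hX
  rw [restrictedBracket_apply, Function.comp_apply, qT_recutParT, bracketT_apply]
  simp only [restrictedDer_comp_recutMap, recutSpeed_single hi hv]
  exact sum_orderSign_transvection (sum_der_eq_zero f _) (sum_der_eq_zero g _) hi _

/-- A domain `D` carries a bracket for which both the inclusion and recutting, given on vertices by
`R`, are Poisson. -/
def IsInvariantOn (n : ℕ) [NeZero n] (D : Set (SpaceT n)) (R : (ℤ → ℂ) → ℤ → ℂ) : Prop :=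
  ∃ ρ : D → SpaceT n, (∀ (x : PolygonT n) (hx : Quotient.mk _ x ∈ D),
    ∃ x' : PolygonT n, x'.v = R x.v ∧ x'.α = x.α ∧ ρ ⟨Quotient.mk _ x, hx⟩ = Quotient.mk _ x') ∧
    ∃ BD : PoissonBracket (smoothFnsOn (qT n) (cT n) D),
      IsPoissonMap BD (bracketT n) Subtype.val ∧ IsPoissonMap BD (bracketT n) ρ

theorem isInvariantOn_recut (j : ℤ) :
    IsInvariantOn n (recutDomain n j) (recutVertex n j) := by
  refine forall_of_periodic (n := n)
    (Q := fun j => IsInvariantOn n (recutDomain n j) (recutVertex n j)) (fun j => ?_) (fun i => ?_) j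
  · rw [recutDomain_add_period, recutVertex_add_period]
  · rcases Nat.lt_or_ge n 2 with hn | hn
    · obtain rfl : n = 1 := by
        have := NeZero.ne n
        omega
      refine ⟨Subtype.val, fun x hx => ⟨x, (recutVertex_one _ x).symm, rfl, rfl⟩,
        restrictedBracket _ (isOpen_range_recutDomain i), isPoissonMap_val _ _,
        isPoissonMap_val _ _⟩
    · exact ⟨recutMap hn _, isRecutting_recutMap hn _, restrictedBracket _
        (isOpen_range_recutDomain i), isPoissonMap_val _ _, isPoissonMap_recutMap hn i⟩

end RecutPoisson

/-! ### The invariants `E_k`, `I_k` as smooth functions -/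

section Invariants

variable {n : ℕ}

/-- `z` for even `r` and `z̄` for odd `r`. -/
def alternate (r : ℕ) (z : ℂ) : ℂ := if Even r then z else starRingEnd ℂ z

theorem alternate_zero (z : ℂ) : alternate 0 z = z := if_pos Even.zero

theorem alternate_succ (r : ℕ) (z : ℂ) : alternate (r + 1) z = alternate r (starRingEnd ℂ z) := by
  unfold alternate
  by_cases h : Even r
  · rw [if_pos h, if_neg (by rwa [Nat.not_even_iff_odd, Nat.odd_add_one, Nat.not_odd_iff_even])]
  · rw [if_neg h, if_pos (Nat.even_add_one.mpr h), Complex.conj_conj]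

/-- The alternating elementary polynomial `∑_{i_1 < ⋯ < i_r < m} z_{i_1} z̄_{i_2} z_{i_3} ⋯`, by
recursion over the largest index. -/
def altSymm (z : ℕ → ℂ) : ℕ → ℕ → ℂ
  | 0, _ => 1
  | r + 1, m => ∑ x ∈ Finset.range m, altSymm z r x * alternate r (z x)

theorem altSymm_zero (z : ℕ → ℂ) (m : ℕ) : altSymm z 0 m = 1 := by rw [altSymm]

theorem altSymm_succ (z : ℕ → ℂ) (r m : ℕ) :
    altSymm z (r + 1) m = ∑ x ∈ Finset.range m, altSymm z r x * alternate r (z x) := by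
  rw [altSymm]

theorem altSymm_succ_succ (z : ℕ → ℂ) (r m : ℕ) :
    altSymm z (r + 1) (m + 1) = altSymm z (r + 1) m + altSymm z r m * alternate r (z m) := by
  rw [altSymm_succ, altSymm_succ, Finset.sum_range_succ]

theorem altSymm_eq_zero (z : ℕ → ℂ) : ∀ {r m : ℕ}, m < r → altSymm z r m = 0
  | 0, _, h => absurd h (Nat.not_lt_zero _)
  | r + 1, m, h => by
    rw [altSymm_succ]
    refine Finset.sum_eq_zero fun x hx => ?_
    rw [altSymm_eq_zero z (by rw [Finset.mem_range] at hx; omega), zero_mul]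

/-- Extension of a finite sequence by zero. -/
def extendZero (z : Fin n → ℂ) (m : ℕ) : ℂ := if h : m < n then z ⟨m, h⟩ else 0

theorem extendZero_val (z : Fin n → ℂ) (i : Fin n) : extendZero z i.val = z i := dif_pos i.2

theorem strictMono_snoc_iff {r : ℕ} {f : Fin r → Fin n} {x : Fin n} :
    StrictMono (Fin.snoc f x : Fin (r + 1) → Fin n) ↔ StrictMono f ∧ ∀ i, f i < x := by
  constructor
  · intro h
    refine ⟨fun i j hij => ?_, fun i => ?_⟩
    · have := h (Fin.castSucc_lt_castSucc_iff.mpr hij)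
      rwa [Fin.snoc_castSucc, Fin.snoc_castSucc] at this
    · have := h (Fin.castSucc_lt_last i)
      rwa [Fin.snoc_castSucc, Fin.snoc_last] at this
  · rintro ⟨h1, h2⟩ i j hij
    induction j using Fin.lastCases with
    | last =>
      induction i using Fin.lastCases with
      | last => exact absurd hij (lt_irrefl _)
      | cast i => rw [Fin.snoc_castSucc, Fin.snoc_last]; exact h2 i
    | cast j =>
      induction i using Fin.lastCases with
      | last => exact absurd hij (not_lt.mpr (Fin.le_last _))
      | cast i =>
        rw [Fin.snoc_castSucc, Fin.snoc_castSucc]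
        exact h1 (Fin.castSucc_lt_castSucc_iff.mp hij)

open Classical in
/-- `altSymm` is the sum over increasing sequences, by splitting off the last index. -/
theorem sum_strictMono_eq_altSymm (z : Fin n → ℂ) : ∀ (r m : ℕ), m ≤ n →
    ∑ f : Fin r → Fin n, (if StrictMono f ∧ ∀ i, (f i).val < m then
      ∏ i, alternate i.val (z (f i)) else 0) = altSymm (extendZero z) r m
  | 0, m, _ => by
    rw [Fintype.sum_unique, if_pos ⟨fun i => i.elim0, fun i => i.elim0⟩, altSymm_zero]
    simp
  | r + 1, m, hm => by
    rw [← Fintype.sum_equiv (Fin.snocEquiv fun _ : Fin (r + 1) => Fin n) _ _ fun _ => rfl,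
      Fintype.sum_prod_type, altSymm_succ]
    have h1 : ∀ (x : Fin n) (f : Fin r → Fin n),
        (if StrictMono (Fin.snoc f x : Fin (r + 1) → Fin n) ∧
          ∀ i, ((Fin.snoc f x : Fin (r + 1) → Fin n) i).val < m then
          ∏ i, alternate i.val (z ((Fin.snoc f x : Fin (r + 1) → Fin n) i)) else 0) =
        if x.val < m then (if StrictMono f ∧ ∀ i, (f i).val < x.val then
          ∏ i, alternate i.val (z (f i)) else 0) * alternate r (z x) else 0 := fun x f => by
      have h2 : (StrictMono (Fin.snoc f x : Fin (r + 1) → Fin n) ∧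
          ∀ i, ((Fin.snoc f x : Fin (r + 1) → Fin n) i).val < m) ↔
          x.val < m ∧ (StrictMono f ∧ ∀ i, (f i).val < x.val) := by
        simp only [strictMono_snoc_iff, Fin.forall_fin_succ', Fin.snoc_castSucc, Fin.snoc_last,
          Fin.lt_def]
        exact ⟨fun h => ⟨h.2.2, h.1⟩, fun h => ⟨h.2, fun i => (h.2.2 i).trans h.1, h.1⟩⟩
      simp only [h2, Fin.prod_univ_castSucc, Fin.snoc_castSucc, Fin.snoc_last, Fin.val_castSucc,
        Fin.val_last, ite_and, ite_mul, zero_mul]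
    have h3 : ∀ x : Fin n, ∑ f : Fin r → Fin n,
        (if StrictMono (Fin.snoc f x : Fin (r + 1) → Fin n) ∧
          ∀ i, ((Fin.snoc f x : Fin (r + 1) → Fin n) i).val < m then
          ∏ i, alternate i.val (z ((Fin.snoc f x : Fin (r + 1) → Fin n) i)) else 0) =
        if x.val < m then altSymm (extendZero z) r x.val * alternate r (extendZero z x.val)
          else 0 := fun x => by
      simp only [h1]
      split_ifs with hx
      · rw [← Finset.sum_mul, sum_strictMono_eq_altSymm z r x.val x.2.le, extendZero_val]
      · exact Finset.sum_const_zero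
    refine (Finset.sum_congr rfl fun x _ => h3 x).trans ?_
    rw [Fin.sum_univ_eq_sum_range (fun x => if x < m then altSymm (extendZero z) r x *
      alternate r (extendZero z x) else 0) n, ← Finset.sum_subset (Finset.range_mono hm)
      fun x _ hx => if_neg (by simpa using hx)]
    exact Finset.sum_congr rfl fun x hx => if_pos (Finset.mem_range.mp hx)

theorem prod_alternate : ∀ (k : ℕ) (g : Fin (2 * k) → ℂ), ∏ i, alternate i.val (g i) =
    ∏ m : Fin k, (g ⟨2 * m.val, by omega⟩ * starRingEnd ℂ (g ⟨2 * m.val + 1, by omega⟩))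
  | 0, _ => rfl
  | k + 1, g => by
    change ∏ i : Fin (2 * k + 1 + 1), alternate i.val (g i) = _
    rw [Fin.prod_univ_castSucc, Fin.prod_univ_castSucc, Fin.prod_univ_castSucc, mul_assoc]
    have h := prod_alternate k fun i => g (i.castSucc.castSucc)
    have h0 : Even (2 * k) := even_two_mul k
    refine congrArg₂ (· * ·) h (congrArg₂ (· * ·) ?_ ?_)
    · exact if_pos h0
    · exact if_neg (Nat.not_even_iff_odd.mpr h0.add_one)

/-- The function `I_k` in the coordinates of the double cover. -/
def invICoord (k : ℕ) (v : (Fin n → ℂ) × ℝ) : ℝ :=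
  ((Circle.exp v.2 : ℂ) * altSymm (extendZero v.1) (2 * k) n).re

open Classical in
theorem represents_invI (k : ℕ) : Represents (qT n) (cT n) (invICoord k) (invI n k) := by
  constructor
  · have hz : ∀ m, ContDiff ℝ ∞ fun v : (Fin n → ℂ) × ℝ => extendZero v.1 m := fun m => by
      unfold extendZero
      split_ifs with h
      · exact (contDiff_apply ℝ ℂ _).comp contDiff_fst
      · exact contDiff_const
    have ha : ∀ r m, ContDiff ℝ ∞ fun v : (Fin n → ℂ) × ℝ => altSymm (extendZero v.1) r m := by
      intro r
      induction r with
      | zero => exact fun m => by simpa only [altSymm_zero] using contDiff_const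
      | succ r ih =>
        intro m
        simp only [altSymm_succ]
        refine ContDiff.sum fun x _ => (ih x).mul ?_
        unfold alternate
        split_ifs
        · exact hz x
        · exact Complex.conjCLE.contDiff.comp (hz x)
    have he : ContDiff ℝ ∞ fun v : (Fin n → ℂ) × ℝ => (Circle.exp v.2 : ℂ) := by
      simp only [Circle.coe_exp]
      exact ((Complex.ofRealCLM.contDiff.comp contDiff_snd).mul contDiff_const).cexp
    exact (Complex.reCLM.contDiff.comp (he.mul (ha _ _))).contDiffOn
  · intro p
    have h1 := sum_strictMono_eq_altSymm (cT n p).1 (2 * k) n le_rfl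
    have h2 : ∀ f : Fin (2 * k) → Fin n, (StrictMono f ∧ ∀ i, (f i).val < n) ↔ StrictMono f :=
      fun f => and_iff_left fun i => (f i).2
    simp only [h2, prod_alternate] at h1
    rw [← Finset.sum_filter] at h1
    unfold invICoord
    rw [← h1]
    change (((p.1.1.α : Circle) : ℂ) * _).re = _
    rw [p.2]
    rfl

/-- The function `E_k` in the coordinates of the double cover. -/
def invECoord (k : ℕ) (v : (Fin n → ℂ) × ℝ) : ℝ :=
  ∑ s ∈ (Finset.univ : Finset (Fin n)).powersetCard k, ∏ i ∈ s, ‖v.1 i‖ ^ 2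

theorem represents_invE (k : ℕ) : Represents (qT n) (cT n) (invECoord k) (invE n k) := by
  refine ⟨ContDiff.contDiffOn ?_, fun p => rfl⟩
  exact ContDiff.sum fun s _ => contDiff_prod fun i _ =>
    ((contDiff_apply ℝ ℂ i).comp contDiff_fst).norm_sq ℝ

variable [NeZero n]

/-- A function that does not change under rotations of single edges is a Casimir. -/
theorem isCasimir_of_rotCurve {f : SpaceT n → ℝ} {F : (Fin n → ℂ) × ℝ → ℝ}
    (hF : Represents (qT n) (cT n) F f)
    (h : ∀ w v s, F (rotCurve w 0 v s) = F v) : IsCasimir (bracketT n) f := by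
  refine ⟨⟨F, hF⟩, fun g => ?_⟩
  ext X
  obtain ⟨p, rfl⟩ := surjective_qT X
  have h0 : ∀ k, (derT k ⟨f, ⟨F, hF⟩⟩).1 (qT n p) = 0 := fun k => by
    have h1 := hasDerivAt_comp_rotCurve (f := ⟨f, ⟨F, hF⟩⟩) hF p (Pi.single k 1) 0
    simp only [h] at h1
    have h2 := h1.unique (hasDerivAt_const 0 (F (cT n p)))
    simpa [Pi.single_apply] using h2
  rw [bracketT_apply]
  simp only [h0, zero_mul, mul_zero, Finset.sum_const_zero]
  rfl

theorem isCasimir_invE (k : ℕ) : IsCasimir (bracketT n) (invE n k) :=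
  isCasimir_of_rotCurve (represents_invE k) fun w v s => by
    have h : ∀ i, ‖(rotCurve w 0 v s).1 i‖ = ‖v.1 i‖ := fun i => by
      simp only [rotCurve]
      rw [norm_mul, Complex.norm_exp_ofReal_mul_I, one_mul]
    simp only [invECoord, h]

theorem isCasimir_invI_zero : IsCasimir (bracketT n) (invI n 0) :=
  isCasimir_of_rotCurve (represents_invI 0) fun w v s => by
    simp only [invICoord, mul_zero, altSymm_zero, rotCurve, zero_mul, add_zero]

end Invariants

/-! ### The generating function of the `I_k` as a product of quaternionic polynomials -/

section Monodromy

/-- The value `1 + w j t` of a linear special polynomial at a real number `t`. -/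
def edgeFactor (t : ℝ) (w : ℂ) : ℍ[ℝ] := 1 + t • ((w : ℍ[ℝ]) * quatJ)

theorem edgeFactor_re (t : ℝ) (w : ℂ) : (edgeFactor t w).re = 1 := by simp [edgeFactor]

theorem edgeFactor_imI (t : ℝ) (w : ℂ) : (edgeFactor t w).imI = 0 := by simp [edgeFactor]

theorem edgeFactor_imJ (t : ℝ) (w : ℂ) : (edgeFactor t w).imJ = t * w.re := by simp [edgeFactor]

theorem edgeFactor_imK (t : ℝ) (w : ℂ) : (edgeFactor t w).imK = t * w.im := by simp [edgeFactor]

theorem edgeFactor_ne_zero (t : ℝ) (w : ℂ) : edgeFactor t w ≠ 0 := fun h => by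
  have := edgeFactor_re t w
  rw [h] at this
  exact zero_ne_one this

/-- The product of the first `m` factors `1 + z_k j t`. -/
def edgeProd (t : ℝ) (z : ℕ → ℂ) : ℕ → ℍ[ℝ]
  | 0 => 1
  | m + 1 => edgeProd t z m * edgeFactor t (z m)

theorem edgeProd_zero (t : ℝ) (z : ℕ → ℂ) : edgeProd t z 0 = 1 := by rw [edgeProd]

theorem edgeProd_succ (t : ℝ) (z : ℕ → ℂ) (m : ℕ) :
    edgeProd t z (m + 1) = edgeProd t z m * edgeFactor t (z m) := by rw [edgeProd]

theorem edgeProd_ne_zero (t : ℝ) (z : ℕ → ℂ) (m : ℕ) : edgeProd t z m ≠ 0 := by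
  induction m with
  | zero => rw [edgeProd_zero]; exact one_ne_zero
  | succ m ih => rw [edgeProd_succ]; exact mul_ne_zero ih (edgeFactor_ne_zero _ _)

theorem quatJ_pow_mul_coe (r : ℕ) : ∀ w : ℂ,
    quatJ ^ r * (w : ℍ[ℝ]) = ((alternate r w : ℂ) : ℍ[ℝ]) * quatJ ^ r := by
  induction r with
  | zero => intro w; rw [alternate_zero, pow_zero, one_mul, mul_one]
  | succ r ih =>
    intro w
    rw [pow_succ, mul_assoc, quatJ_mul_coe, ← mul_assoc, ih, alternate_succ, mul_assoc]

/-- The coefficients of the product are the alternating elementary polynomials, because moving `j`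
past a complex number conjugates it. -/
theorem edgeProd_eq_sum (t : ℝ) (z : ℕ → ℂ) : ∀ {m N : ℕ}, m < N → edgeProd t z m =
    ∑ r ∈ Finset.range N, t ^ r • (((altSymm z r m : ℂ) : ℍ[ℝ]) * quatJ ^ r)
  | _, 0, h => absurd h (Nat.not_lt_zero _)
  | 0, N + 1, _ => by
    rw [edgeProd_zero, Finset.sum_range_succ', Finset.sum_eq_zero fun r _ => ?_]
    · rw [altSymm_zero, Quaternion.coeComplex_one, pow_zero, pow_zero, one_smul, zero_add, one_mul]
    · rw [altSymm_eq_zero z (Nat.succ_pos r), Quaternion.coeComplex_zero, zero_mul, smul_zero]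
  | m + 1, N + 1, h => by
    have h1 : ∀ r, t ^ (r + 1) • (((altSymm z (r + 1) (m + 1) : ℂ) : ℍ[ℝ]) * quatJ ^ (r + 1)) =
        t ^ (r + 1) • (((altSymm z (r + 1) m : ℂ) : ℍ[ℝ]) * quatJ ^ (r + 1)) +
        t ^ r • (((altSymm z r m : ℂ) : ℍ[ℝ]) * quatJ ^ r) * (t • ((z m : ℍ[ℝ]) * quatJ)) :=
      fun r => by
        rw [altSymm_succ_succ, Quaternion.coeComplex_add, add_mul, smul_add,
          Quaternion.coeComplex_mul, smul_mul_smul_comm, ← pow_succ]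
        congr 2
        rw [mul_assoc, mul_assoc, pow_succ, ← mul_assoc _ (quatJ ^ r), ← quatJ_pow_mul_coe]
        simp only [mul_assoc]
    have h2 : (altSymm z 0 (m + 1)) = altSymm z 0 m := by rw [altSymm_zero, altSymm_zero]
    rw [Finset.sum_range_succ']
    simp only [h1, h2]
    rw [Finset.sum_add_distrib, add_right_comm, ← Finset.sum_range_succ' (fun r =>
        t ^ r • (((altSymm z r m : ℂ) : ℍ[ℝ]) * quatJ ^ r)), ← edgeProd_eq_sum t z (by omega),
      ← Finset.sum_mul, ← edgeProd_eq_sum t z (by omega), edgeProd_succ, edgeFactor, mul_add,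
      mul_one]

theorem quatJ_pow_two_mul (k : ℕ) : quatJ ^ (2 * k) = (((-1) ^ k : ℝ) : ℍ[ℝ]) := by
  have h : quatJ ^ 2 = ((-1 : ℝ) : ℍ[ℝ]) := by
    rw [pow_two]
    ext <;> simp
  rw [pow_mul, h, Quaternion.coe_pow]

/-- Real part as a linear map. -/
def quatRe : ℍ[ℝ] →ₗ[ℝ] ℝ where
  toFun q := q.re
  map_add' _ _ := rfl
  map_smul' _ _ := rfl

theorem re_edgeProd_mul (t : ℝ) (z : ℕ → ℂ) (n : ℕ) (a : ℂ) :
    (edgeProd t z n * (a : ℍ[ℝ])).re =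
      ∑ k ∈ Finset.range (n + 1), (-t ^ 2) ^ k * (a * altSymm z (2 * k) n).re := by
  have split : ∀ (g : ℕ → ℝ) (N : ℕ), ∑ r ∈ Finset.range (2 * N), g r =
      ∑ k ∈ Finset.range N, (g (2 * k) + g (2 * k + 1)) := fun g N => by
    induction N with
    | zero => simp
    | succ N ih => rw [Nat.mul_succ, Finset.sum_range_succ, Finset.sum_range_succ, ih,
        Finset.sum_range_succ, add_assoc]
  rw [edgeProd_eq_sum t z (show n < 2 * (n + 1) by omega), Finset.sum_mul]
  refine (map_sum quatRe _ _).trans ?_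
  rw [split]
  refine Finset.sum_congr rfl fun k _ => ?_
  have h1 : quatRe (t ^ (2 * k) • (((altSymm z (2 * k) n : ℂ) : ℍ[ℝ]) * quatJ ^ (2 * k)) * (a : ℍ[ℝ]))
      = (-t ^ 2) ^ k * (a * altSymm z (2 * k) n).re := by
    rw [quatJ_pow_two_mul, smul_mul_assoc, map_smul, ← Quaternion.coe_commutes, mul_assoc,
      ← Quaternion.coeComplex_mul, mul_comm (altSymm z (2 * k) n), Quaternion.coe_mul_eq_smul,
      map_smul, smul_eq_mul, smul_eq_mul, neg_pow (t ^ 2), pow_mul]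
    change _ * (_ * (a * altSymm z (2 * k) n).re) = _
    ring
  have h2 : quatRe (t ^ (2 * k + 1) • (((altSymm z (2 * k + 1) n : ℂ) : ℍ[ℝ]) *
      quatJ ^ (2 * k + 1)) * (a : ℍ[ℝ])) = 0 := by
    rw [pow_succ quatJ, quatJ_pow_two_mul, smul_mul_assoc, map_smul, ← mul_assoc,
      ← Quaternion.coe_commutes, Quaternion.coe_mul_eq_smul, smul_mul_assoc, smul_mul_assoc,
      map_smul, mul_assoc, quatJ_mul_coe, ← mul_assoc, ← Quaternion.coeComplex_mul, coe_mul_quatJ]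
    change _ * (_ * (0 : ℝ)) = 0
    ring
  rw [h1, h2, add_zero]

/-- The monodromy `(1 + z_m j t) ⋯ (1 + z_n j t) a (1 + z_1 j t) ⋯ (1 + z_{m-1} j t)` read off from
the `m`-th edge on. -/
def monodromyAt (t : ℝ) (z : ℕ → ℂ) (n : ℕ) (a : ℂ) (m : ℕ) : ℍ[ℝ] :=
  (edgeProd t z m)⁻¹ * (edgeProd t z n * (a : ℍ[ℝ])) * edgeProd t z m

theorem monodromyAt_mul (t : ℝ) (z : ℕ → ℂ) (n : ℕ) (a : ℂ) (m : ℕ) :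
    monodromyAt t z n a m * edgeFactor t (z m) =
      edgeFactor t (z m) * monodromyAt t z n a (m + 1) := by
  have h1 := edgeProd_ne_zero t z m
  have h2 := edgeFactor_ne_zero t (z m)
  simp only [monodromyAt, edgeProd_succ, mul_inv_rev, mul_assoc]
  rw [mul_inv_cancel_left₀ h2]

theorem re_mul_comm (p q : ℍ[ℝ]) : (p * q).re = (q * p).re := by
  simp only [Quaternion.re_mul]
  ring

theorem re_monodromyAt (t : ℝ) (z : ℕ → ℂ) (n : ℕ) (a : ℂ) (m : ℕ) :
    (monodromyAt t z n a m).re = (edgeProd t z n * (a : ℍ[ℝ])).re := by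
  rw [monodromyAt, re_mul_comm, mul_inv_cancel_left₀ (edgeProd_ne_zero t z m)]

theorem monodromyAt_zero (t : ℝ) (z : ℕ → ℂ) (n : ℕ) (a : ℂ) :
    monodromyAt t z n a 0 = edgeProd t z n * (a : ℍ[ℝ]) := by
  rw [monodromyAt, edgeProd_zero, inv_one, one_mul, mul_one]

theorem monodromyAt_last (t : ℝ) (z : ℕ → ℂ) (n : ℕ) (a : ℂ) :
    monodromyAt t z n a n = (a : ℍ[ℝ]) * edgeProd t z n := by
  rw [monodromyAt, inv_mul_cancel_left₀ (edgeProd_ne_zero t z n)]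

theorem edgeProd_of_eq_of_ne {t : ℝ} {z z' : ℕ → ℂ} {m : ℕ} (h : ∀ k, k ≠ m → z' k = z k) :
    ∀ k, k ≤ m → edgeProd t z' k = edgeProd t z k
  | 0, _ => by rw [edgeProd_zero, edgeProd_zero]
  | k + 1, hk => by
    rw [edgeProd_succ, edgeProd_succ, edgeProd_of_eq_of_ne h k (by omega), h k (by omega)]

/-- Changing one factor of the product. -/
theorem edgeProd_replace {t : ℝ} {z z' : ℕ → ℂ} {m : ℕ} (h : ∀ k, k ≠ m → z' k = z k) (d : ℕ) :
    edgeProd t z' (m + 1 + d) = edgeProd t z m * edgeFactor t (z' m) *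
      ((edgeProd t z (m + 1))⁻¹ * edgeProd t z (m + 1 + d)) := by
  induction d with
  | zero =>
    rw [add_zero, inv_mul_cancel₀ (edgeProd_ne_zero t z _), mul_one, edgeProd_succ,
      edgeProd_of_eq_of_ne h m le_rfl]
  | succ d ih =>
    rw [← add_assoc, edgeProd_succ, ih, edgeProd_succ t z (m + 1 + d),
      h (m + 1 + d) (by omega)]
    simp only [mul_assoc]

theorem hasDerivAt_re_edgeFactor (t : ℝ) (w : ℂ) (X Y : ℍ[ℝ]) :
    HasDerivAt (fun s : ℝ => (X * edgeFactor t (Complex.exp ((1 * s : ℝ) * Complex.I) * w) * Y).re)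
      (X * (t • (((Complex.I * w : ℂ) : ℍ[ℝ]) * quatJ)) * Y).re 0 := by
  let φ : ℂ →ₗ[ℝ] ℝ :=
    { toFun := fun u => (X * (t • ((u : ℍ[ℝ]) * quatJ)) * Y).re
      map_add' := fun u v => by
        rw [Quaternion.coeComplex_add, add_mul, smul_add, mul_add, add_mul, Quaternion.re_add]
      map_smul' := fun r u => by
        rw [RingHom.id_apply, Complex.real_smul, Quaternion.coeComplex_mul,
          Quaternion.coeComplex_coe, Quaternion.coe_mul_eq_smul, smul_mul_assoc, smul_comm t r,
          mul_smul_comm, smul_mul_assoc, Quaternion.re_smul] }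
  have h1 := (LinearMap.toContinuousLinearMap φ).hasFDerivAt.comp_hasDerivAt (0 : ℝ)
    (hasDerivAt_exp_mul 1 w)
  rw [Complex.ofReal_one, one_mul] at h1
  refine (h1.const_add (X * Y).re).congr_of_eventuallyEq (Filter.Eventually.of_forall fun s => ?_)
  change (X * edgeFactor t _ * Y).re = (X * Y).re + (X * (t • (_ * quatJ)) * Y).re
  rw [edgeFactor, mul_add, mul_one, add_mul, Quaternion.re_add]

/-- The infinitesimal rotation of `w` in `1 + w j t` is the commutator with `i / 2`. -/
theorem two_smul_rotation_edgeFactor (t : ℝ) (w : ℂ) :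
    (2 : ℝ) • (t • (((Complex.I * w : ℂ) : ℍ[ℝ]) * quatJ)) =
      (Complex.I : ℍ[ℝ]) * edgeFactor t w - edgeFactor t w * (Complex.I : ℍ[ℝ]) := by
  unfold edgeFactor
  ext <;> simp <;> ring

/-- Rotating the `m`-th edge changes the real part of the monodromy at a rate given by the
difference of the `i`-components of the monodromies based at the two ends of the edge. -/
theorem hasDerivAt_re_edgeProd {t : ℝ} {z : ℕ → ℂ} {n m : ℕ} (hm : m < n) (a : ℂ)
    {Z : ℝ → ℕ → ℂ} (h : ∀ s k, k ≠ m → Z s k = z k)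
    (h' : ∀ s, Z s m = Complex.exp ((1 * s : ℝ) * Complex.I) * z m) :
    HasDerivAt (fun s => (edgeProd t (Z s) n * (a : ℍ[ℝ])).re)
      (((monodromyAt t z n a (m + 1)).imI - (monodromyAt t z n a m).imI) / 2) 0 := by
  obtain ⟨d, rfl⟩ := Nat.exists_eq_add_of_le (show m + 1 ≤ n from hm)
  set R := (edgeProd t z (m + 1))⁻¹ * (edgeProd t z (m + 1 + d) * (a : ℍ[ℝ])) with hR
  refine ((hasDerivAt_re_edgeFactor t (z m) (edgeProd t z m) R).congr_of_eventuallyEq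
    (Filter.Eventually.of_forall fun s => ?_)).congr_deriv ?_
  · simp only [edgeProd_replace (h s), h', hR, mul_assoc]
  · have hI : ∀ q : ℍ[ℝ], ((Complex.I : ℍ[ℝ]) * q).re = -q.imI := fun q => by simp
    have e1 : (edgeProd t z m * ((Complex.I : ℍ[ℝ]) * edgeFactor t (z m)) * R).re =
        -(monodromyAt t z (m + 1 + d) a m).imI := by
      rw [← hI, mul_assoc, re_mul_comm, monodromyAt, hR, edgeProd_succ, mul_inv_rev]
      congr 1
      simp only [mul_assoc]
      rw [mul_inv_cancel_left₀ (edgeFactor_ne_zero _ _)]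
    have e2 : (edgeProd t z m * (edgeFactor t (z m) * (Complex.I : ℍ[ℝ])) * R).re =
        -(monodromyAt t z (m + 1 + d) a (m + 1)).imI := by
      have e : edgeProd t z m * (edgeFactor t (z m) * (Complex.I : ℍ[ℝ])) * R =
          edgeProd t z (m + 1) * ((Complex.I : ℍ[ℝ]) * R) := by
        rw [edgeProd_succ]
        simp only [mul_assoc]
      rw [← hI, e, re_mul_comm, monodromyAt, hR]
      simp only [mul_assoc]
    have e3 : (2 : ℝ) * (edgeProd t z m * (t • (((Complex.I * z m : ℂ) : ℍ[ℝ]) * quatJ)) * R).re =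
        (edgeProd t z m * ((2 : ℝ) • (t • (((Complex.I * z m : ℂ) : ℍ[ℝ]) * quatJ))) * R).re := by
      simp only [mul_smul_comm, smul_mul_assoc, Quaternion.re_smul, smul_eq_mul]
    rw [two_smul_rotation_edgeFactor, mul_sub, sub_mul, Quaternion.re_sub, e1, e2] at e3
    linarith

/-- The discrete derivative identity behind the involutivity: for two values `t`, `s` of the
parameter, the Poisson bracket density of the two monodromies at an edge is a difference. -/
theorem monodromy_telescope {t s : ℝ} {w : ℂ} {M M' N N' : ℍ[ℝ]}
    (h : M * edgeFactor t w = edgeFactor t w * M') (hr : M.re = M'.re)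
    (k : N * edgeFactor s w = edgeFactor s w * N') (kr : N.re = N'.re) :
    (t ^ 2 - s ^ 2) * (M'.imI * N.imI - M.imI * N'.imI) =
      (2 * t * s * (M'.imJ * N'.imJ + M'.imK * N'.imK) + (t ^ 2 + s ^ 2) * (M'.imI * N'.imI)) -
      (2 * t * s * (M.imJ * N.imJ + M.imK * N.imK) + (t ^ 2 + s ^ 2) * (M.imI * N.imI)) := by
  have components : ∀ {t : ℝ} {M M' : ℍ[ℝ]}, M * edgeFactor t w = edgeFactor t w * M' →
      M.re = M'.re → M'.imJ = M.imJ - t * (M.imI + M'.imI) * w.im ∧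
        M'.imK = M.imK + t * (M.imI + M'.imI) * w.re ∧
        M'.imI = M.imI + 2 * t * (M.imJ * w.im - M.imK * w.re) -
          t ^ 2 * (M.imI + M'.imI) * (w.re ^ 2 + w.im ^ 2) := fun {t M M'} h hr => by
    have h1 := congrArg (fun q : ℍ[ℝ] => q.imI) h
    have h2 := congrArg (fun q : ℍ[ℝ] => q.imJ) h
    have h3 := congrArg (fun q : ℍ[ℝ] => q.imK) h
    simp only [Quaternion.imI_mul, Quaternion.imJ_mul, Quaternion.imK_mul, edgeFactor_re,
      edgeFactor_imI, edgeFactor_imJ, edgeFactor_imK] at h1 h2 h3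
    have hJ : M'.imJ = M.imJ - t * (M.imI + M'.imI) * w.im := by
      linear_combination -h2 + t * w.re * hr
    have hK : M'.imK = M.imK + t * (M.imI + M'.imI) * w.re := by
      linear_combination -h3 + t * w.im * hr
    exact ⟨hJ, hK, by linear_combination -h1 + t * (w.im * hJ - w.re * hK)⟩
  obtain ⟨hJ, hK, hI⟩ := components h hr
  obtain ⟨kJ, kK, kI⟩ := components k kr
  rw [hJ, hK, kJ, kK]
  linear_combination -(s ^ 2 * (N.imI + N'.imI)) * hI - t ^ 2 * (M.imI + M'.imI) * kI

end Monodromy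

/-! ### Involutivity of the `I_k` -/

section Involution

variable {n : ℕ}

/-- `I_k` as an element of the algebra of smooth functions. -/
def smoothInvI (n k : ℕ) : smoothT n := ⟨invI n k, ⟨_, represents_invI k⟩⟩

/-- The `i`-component of the monodromy of a polygon, based at the `m`-th edge. -/
def monodromyI (t : ℝ) (v : (Fin n → ℂ) × ℝ) (m : ℕ) : ℝ :=
  (monodromyAt t (extendZero v.1) n (Circle.exp v.2) m).imI

theorem sum_invICoord (t : ℝ) (v : (Fin n → ℂ) × ℝ) :
    ∑ k ∈ Finset.range (n + 1), (-t ^ 2) ^ k * invICoord k v =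
      (edgeProd t (extendZero v.1) n * ((Circle.exp v.2 : ℂ) : ℍ[ℝ])).re :=
  (re_edgeProd_mul t _ n _).symm

theorem monodromyI_zero (t : ℝ) (v : (Fin n → ℂ) × ℝ) : monodromyI t v 0 = monodromyI t v n := by
  rw [monodromyI, monodromyI, monodromyAt_zero, monodromyAt_last]
  simp only [Quaternion.imI_mul, Quaternion.re_coeComplex, Quaternion.imI_coeComplex,
    Quaternion.imJ_coeComplex, Quaternion.imK_coeComplex]
  ring

/-- The brackets of the generating functions of the `I_k` vanish, in terms of the monodromies. -/
theorem sum_monodromyI (t s : ℝ) (v : (Fin n → ℂ) × ℝ) :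
    (t ^ 2 - s ^ 2) * ∑ m ∈ Finset.range n, (monodromyI t v (m + 1) * monodromyI s v m -
      monodromyI t v m * monodromyI s v (m + 1)) = 0 := by
  set M : ℝ → ℕ → ℍ[ℝ] := fun t m => monodromyAt t (extendZero v.1) n (Circle.exp v.2) m with hM
  have hre : ∀ t m, (M t m).re = (M t (m + 1)).re := fun t m =>
    (re_monodromyAt t _ n _ m).trans (re_monodromyAt t _ n _ (m + 1)).symm
  rw [Finset.mul_sum]
  refine (Finset.sum_congr rfl fun m _ => monodromy_telescope (monodromyAt_mul t _ n _ m) (hre t m)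
    (monodromyAt_mul s _ n _ m) (hre s m)).trans ?_
  rw [Finset.sum_range_sub fun m => 2 * t * s * ((M t m).imJ * (M s m).imJ +
    (M t m).imK * (M s m).imK) + (t ^ 2 + s ^ 2) * ((M t m).imI * (M s m).imI)]
  have h0 : ∀ t, (M t 0).imI = (M t n).imI := fun t => monodromyI_zero t v
  have h1 : (M t 0).imJ * (M s 0).imJ + (M t 0).imK * (M s 0).imK =
      (M t n).imJ * (M s n).imJ + (M t n).imK * (M s n).imK := by
    simp only [hM, monodromyAt_zero, monodromyAt_last]
    simp only [Quaternion.imJ_mul, Quaternion.imK_mul, Quaternion.re_coeComplex,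
      Quaternion.imI_coeComplex, Quaternion.imJ_coeComplex, Quaternion.imK_coeComplex]
    ring
  rw [h0, h0, h1, sub_self]

variable [NeZero n]

/-- The derivative of the generating function of the `I_k` along the rotation of the `i`-th edge. -/
theorem sum_derT_invI (p : ParT n) (t : ℝ) (i : Fin n) :
    ∑ k ∈ Finset.range (n + 1), (-t ^ 2) ^ k * (derT i (smoothInvI n k)).1 (qT n p) =
      (monodromyI t (cT n p) (i.val + 1) - monodromyI t (cT n p) i.val) / 2 := by
  have h1 : ∀ k, HasDerivAt (fun s => invICoord k (rotCurve (Pi.single i 1) 0 (cT n p) s))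
      ((derT i (smoothInvI n k)).1 (qT n p)) 0 := fun k => by
    refine (hasDerivAt_comp_rotCurve (f := smoothInvI n k) (represents_invI k) p
      (Pi.single i 1) 0).congr_deriv ?_
    simp [Pi.single_apply]
  have h2 := HasDerivAt.fun_sum fun k (_ : k ∈ Finset.range (n + 1)) =>
    (h1 k).const_mul ((-t ^ 2) ^ k)
  refine h2.unique ?_
  simp only [sum_invICoord]
  have h3 := hasDerivAt_re_edgeProd (t := t) (z := extendZero (cT n p).1) i.2
    (Circle.exp (cT n p).2)
    (Z := fun s => extendZero (rotCurve (Pi.single i 1) 0 (cT n p) s).1) (fun s k hk => ?_)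
    (fun s => ?_)
  · refine h3.congr_of_eventuallyEq (Filter.Eventually.of_forall fun s => ?_)
    simp only [rotCurve, zero_mul, add_zero]
  · unfold extendZero
    split_ifs with h
    · have : (⟨k, h⟩ : Fin n) ≠ i := fun e => hk (congrArg Fin.val e)
      simp [rotCurve, Pi.single_eq_of_ne this]
    · rfl
  · rw [extendZero_val, extendZero_val]
    simp only [rotCurve, Pi.single_eq_same]

theorem sum_mul_sum_bilinear {n : ℕ} (S : Finset ℕ) (c d : ℕ → ℝ) (w : Fin n → Fin n → ℝ)
    (A B : ℕ → Fin n → ℝ) :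
    ∑ k ∈ S, ∑ l ∈ S, c k * d l * ∑ i, ∑ j, w i j * (A k i * B l j) =
      ∑ i, ∑ j, w i j * ((∑ k ∈ S, c k * A k i) * (∑ l ∈ S, d l * B l j)) := by
  have h : ∀ k, ∑ l ∈ S, c k * d l * ∑ i, ∑ j, w i j * (A k i * B l j) =
      ∑ i, ∑ j, ∑ l ∈ S, w i j * ((c k * A k i) * (d l * B l j)) := fun k => by
    simp only [Finset.mul_sum]
    rw [Finset.sum_comm]
    refine Finset.sum_congr rfl fun i _ => ?_
    rw [Finset.sum_comm]
    exact Finset.sum_congr rfl fun j _ => Finset.sum_congr rfl fun l _ => by ring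
  simp only [h]
  rw [Finset.sum_comm]
  refine Finset.sum_congr rfl fun i _ => ?_
  rw [Finset.sum_comm]
  refine Finset.sum_congr rfl fun j _ => ?_
  rw [Finset.sum_mul_sum, Finset.mul_sum]
  simp only [Finset.mul_sum]

/-- The bracket of the generating functions at the parameters `t` and `s`. -/
theorem sum_bracket_invI (p : ParT n) {t s : ℝ} (hts : t ^ 2 ≠ s ^ 2) :
    ∑ k ∈ Finset.range (n + 1), ∑ l ∈ Finset.range (n + 1), (-t ^ 2) ^ k * (-s ^ 2) ^ l *
      ((bracketT n).br (smoothInvI n k) (smoothInvI n l)).1 (qT n p) = 0 := by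
  set a : ℝ → Fin n → ℝ := fun t i => monodromyI t (cT n p) (i.val + 1) with ha
  have hprev : ∀ t (i : Fin n), a t (i - 1) = monodromyI t (cT n p) i.val := fun t i => by
    obtain ⟨i, rfl⟩ : ∃ k : Fin n, i = k + 1 := ⟨i - 1, (sub_add_cancel i 1).symm⟩
    rw [add_sub_cancel_right]
    rcases val_add_one_cases i with h | ⟨h, h'⟩
    · rw [show (i + 1 : Fin n).val = i.val + 1 by exact_mod_cast h]
    · rw [show (i + 1 : Fin n).val = 0 by exact_mod_cast h', monodromyI_zero]
      simp only [ha, h]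
  have hD : ∀ t (i : Fin n), ∑ k ∈ Finset.range (n + 1), (-t ^ 2) ^ k *
      (derT i (smoothInvI n k)).1 (qT n p) = -(1 / 2) * (a t (i - 1) - a t i) := fun t i => by
    rw [sum_derT_invI, hprev]
    ring
  have h1 : ∑ k ∈ Finset.range (n + 1), ∑ l ∈ Finset.range (n + 1), (-t ^ 2) ^ k * (-s ^ 2) ^ l *
      ((bracketT n).br (smoothInvI n k) (smoothInvI n l)).1 (qT n p) =
      ∑ i : Fin n, ∑ j : Fin n, orderSign i j *
        ((∑ k ∈ Finset.range (n + 1), (-t ^ 2) ^ k * (derT i (smoothInvI n k)).1 (qT n p)) *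
        (∑ l ∈ Finset.range (n + 1), (-s ^ 2) ^ l * (derT j (smoothInvI n l)).1 (qT n p))) := by
    simp only [bracketT_apply]
    exact sum_mul_sum_bilinear _ _ _ _ _ _
  have h2 : ∑ i : Fin n, ∑ j : Fin n, -cyc i j * (a t i * a s j) =
      ∑ i : Fin n, (a t i * a s (i - 1) - a t (i - 1) * a s i) := by
    have e1 : ∀ i : Fin n, ∑ j, -cyc i j * (a t i * a s j) =
        a t i * a s (i - 1) - a t i * a s (i + 1) := fun i => by
      simp [cyc, sub_mul, Finset.sum_sub_distrib]
    have e2 : ∑ i : Fin n, a t i * a s (i + 1) = ∑ i : Fin n, a t (i - 1) * a s i :=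
      Fintype.sum_equiv (Equiv.addRight (1 : Fin n)) _ _ fun i => by simp
    simp only [e1]
    rw [Finset.sum_sub_distrib, e2, ← Finset.sum_sub_distrib]
  have h3 : ∑ i : Fin n, (a t i * a s (i - 1) - a t (i - 1) * a s i) = 0 := by
    simp only [hprev]
    refine (Fin.sum_univ_eq_sum_range (fun m => monodromyI t (cT n p) (m + 1) *
      monodromyI s (cT n p) m - monodromyI t (cT n p) m * monodromyI s (cT n p) (m + 1)) n).trans ?_
    exact (mul_eq_zero.mp (sum_monodromyI t s (cT n p))).resolve_left (sub_ne_zero.mpr hts)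
  have h4 : ∀ i j : Fin n, orderSign i j * (-(1 / 2) * (a t (i - 1) - a t i) *
      (-(1 / 2) * (a s (j - 1) - a s j))) =
      1 / 4 * (orderSign i j * ((a t (i - 1) - a t i) * (a s (j - 1) - a s j))) := fun i j => by
    ring
  rw [h1]
  simp only [hD, h4, ← Finset.mul_sum]
  rw [sum_orderSign_difference, h2, h3, mul_zero]

/-- A polynomial in `-s²` that vanishes for all real `s` with at most one value of `s²` excepted has
zero coefficients. -/
theorem coeff_eq_zero_of_sum_eq_zero {N : ℕ} {c : ℕ → ℝ} (τ : ℝ)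
    (h : ∀ s : ℝ, s ^ 2 ≠ τ → ∑ l ∈ Finset.range N, (-s ^ 2) ^ l * c l = 0) {l : ℕ} (hl : l < N) :
    c l = 0 := by
  set q : Polynomial ℝ := ∑ l ∈ Finset.range N, Polynomial.C (c l) * Polynomial.X ^ l with hq
  have h1 : q = 0 := by
    refine Polynomial.eq_zero_of_infinite_isRoot q
      (((Set.Iio_infinite (0 : ℝ)).sdiff (Set.finite_singleton (-τ))).mono fun x hx => ?_)
    obtain ⟨hx0, hx1⟩ := hx
    have h2 : Real.sqrt (-x) ^ 2 = -x := Real.sq_sqrt (by simpa using le_of_lt hx0)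
    have h3 := h (Real.sqrt (-x)) (by rw [h2]; exact fun e => hx1 (by simp [← e]))
    rw [h2, neg_neg] at h3
    change q.eval x = 0
    rw [hq, Polynomial.eval_finsetSum, ← h3]
    refine Finset.sum_congr rfl fun l _ => ?_
    simp only [Polynomial.eval_mul, Polynomial.eval_C, Polynomial.eval_pow, Polynomial.eval_X]
    ring
  have h4 := congrArg (fun r => r.coeff l) h1
  simpa [hq, Polynomial.finsetSum_coeff, Polynomial.coeff_C_mul, Polynomial.coeff_X_pow, hl] using h4

theorem poissonCommute_invI {k l : ℕ} (hk : k ≤ n) (hl : l ≤ n) :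
    PoissonCommute (bracketT n) (invI n k) (invI n l) := by
  refine ⟨⟨_, represents_invI k⟩, ⟨_, represents_invI l⟩, ?_⟩
  ext X
  obtain ⟨p, rfl⟩ := surjective_qT X
  -- no value of `t` is excepted, as `t² ≠ -1`
  refine coeff_eq_zero_of_sum_eq_zero (N := n + 1) (c := fun k =>
    ((bracketT n).br (smoothInvI n k) (smoothInvI n l)).1 (qT n p)) (-1) (fun t _ => ?_)
    (Nat.lt_succ_of_le hk)
  refine coeff_eq_zero_of_sum_eq_zero (N := n + 1) (c := fun l => ∑ k ∈ Finset.range (n + 1),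
    (-t ^ 2) ^ k * ((bracketT n).br (smoothInvI n k) (smoothInvI n l)).1 (qT n p)) (t ^ 2)
    (fun s hs => ?_) (Nat.lt_succ_of_le hl)
  rw [← sum_bracket_invI p hs.symm, Finset.sum_comm]
  simp only [Finset.mul_sum]
  refine Finset.sum_congr rfl fun l _ => Finset.sum_congr rfl fun k _ => ?_
  ring

end Involution

end Recutting

end

theorem mainTheorem4 (n : ℕ) [NeZero n] :
    ∃ B : PoissonBracket (smoothT n), IsTransferred B ∧
      (∀ B' : PoissonBracket (smoothT n), IsTransferred B' → B' = B) ∧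
      -- 1. invariance under recutting, on the open set where recutting is defined
      (∀ j : ℤ, ∃ ρ : recutDomain n j → SpaceT n, IsRecutting n j ρ ∧
        ∃ BD : PoissonBracket (smoothFnsOn (qT n) (cT n) (recutDomain n j)),
          IsPoissonMap BD B Subtype.val ∧ IsPoissonMap BD B ρ) ∧
      -- 2. the invariants Poisson commute
      ((∀ k ∈ Set.Icc 1 n, ∀ l ∈ Set.Icc 1 n, PoissonCommute B (invE n k) (invE n l)) ∧
        (∀ k ∈ Set.Icc 1 n, ∀ l ≤ n / 2, PoissonCommute B (invE n k) (invI n l)) ∧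
        (∀ k ≤ n / 2, ∀ l ≤ n / 2, PoissonCommute B (invI n k) (invI n l))) ∧
      -- 3. Casimirs
      (∀ k ∈ Set.Icc 1 n, IsCasimir B (invE n k)) ∧ IsCasimir B (invI n 0) ∧
      -- 4. the bracket descends
      ∃ BE : PoissonBracket (smoothE n), IsPoissonMap B BE (projTE n) ∧
        (∀ B' : PoissonBracket (smoothE n), IsPoissonMap B B' (projTE n) → B' = BE) ∧
        -- 5. coordinate form, Casimirs, and symplectic leaves
        (∀ i : ℤ, IsCasimir BE (sideLength n i)) ∧
        HasAngleForm BE ∧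
        IsAngleCasimir BE (angleSum n) ∧
        (Even n → IsAngleCasimir BE (oddAngleSum n)) ∧
        (∀ x y : SpaceE n, SameSymplecticLeaf BE x y ↔
          (∀ i : ℤ, sideLength n i x = sideLength n i y) ∧ angleSum n x = angleSum n y ∧
            (Even n → oddAngleSum n x = oddAngleSum n y)) ∧
        -- 6. the map to similarity classes is Poisson onto the cluster bracket
        ∃ BS : PoissonBracket (smoothS n), IsClusterBracket BS ∧
          (∀ B' : PoissonBracket (smoothS n), IsClusterBracket B' → B' = BS) ∧
          IsPoissonMap BE BS (mapES n) := by
  refine ⟨bracketT n, isTransferred_bracketT, isTransferred_unique, isInvariantOn_recut,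
    ⟨fun k _ l _ => ?_, fun k _ l _ => ?_, fun k hk l hl =>
      poissonCommute_invI (hk.trans (Nat.div_le_self n 2)) (hl.trans (Nat.div_le_self n 2))⟩,
    fun k _ => isCasimir_invE k, isCasimir_invI_zero, bracketE n, isPoissonMap_projTE,
    isPoissonMap_projTE_unique, isCasimir_sideLength, hasAngleForm_bracketE,
    isAngleCasimir_angleSum, isAngleCasimir_oddAngleSum, sameLeaf_iff, bracketS n,
    isClusterBracket_bracketS, isClusterBracket_unique, isPoissonMap_mapES⟩
  · obtain ⟨hk, h⟩ := isCasimir_invE (n := n) k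
    exact ⟨hk, ⟨_, represents_invE l⟩, h _⟩
  · obtain ⟨hk, h⟩ := isCasimir_invE (n := n) k
    exact ⟨hk, ⟨_, represents_invI l⟩, h _⟩
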